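/- Let $\mathfrak g$ be a finite-dimensional complex semisimple Lie algebra with a Cartan subalgebra $\mathfrak h$, a choice of simple roots, and the corresponding triangular decomposition $\mathfrak g=\mathfrak n_+\oplus\mathfrak h\oplus\mathfrak n_-$; let $Q_+$ be the set of nonzero $\mathbb Z_{\ge 0}$-combinations of simple roots. For $\lambda\in\mathfrak h^*$ let $M(\lambda)$ be the Verma module with highest weight vector $\mathbf 1_\lambda$, $K(\lambda)$ its maximal proper submodule, $V(\lambda)=M(\lambda)/K(\lambda)$, and $\overline{\mathbf 1}_\lambda$ the image of $\mathbf 1_\lambda$. Call $\lambda$ generic if $M(\lambda)$ is irreducible. Let $F=\mathbb C[G]\subset (U\mathfrak g)^*$ be the space of matrix elements of finite-dimensional representations of $U\mathfrak g$, with the action $(af)(x)=f(xa)$, and $F[0]$ its subspace of weight $0$. Let $a\mapsto (a)_0$ be the projection $U\mathfrak g\to U\mathfrak h$ along $\mathfrak n_-U\mathfrak g+U\mathfrak g\,\mathfrak n_+$, let $a\mapsto\overline a$ be the antipode and $\varepsilon$ the counit, and let $\pi_\lambda:U\mathfrak n_+\otimes U\mathfrak n_-\to\mathbb C$, $\pi_\lambda(x\otimes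 y)=(\overline x y)_0(\lambda)$. Put $\widetilde K_\lambda=\{x\in U\mathfrak n_+ : \pi_\lambda(x\otimes y)=0 \text{ for all } y\in U\mathfrak n_-\}$ and $F[0]^{\widetilde K_\lambda}=\{f\in F[0] : af=\varepsilon(a)f \text{ for all } a\in\widetilde K_\lambda\}$. For generic $\lambda$ the fusion element is $$J(\lambda)=1\otimes 1+\sum_{\beta\in Q_+}\sum_{i,j}(P_\beta^{-1})_{ij}\,y^\beta_i\otimes x^\beta_j,\qquad (P_\beta)_{ij}=\pi_\lambda(x^\beta_i\otimes y^\beta_j),$$ where $(y^\beta_i)$ and $(x^\beta_j)$ are any bases of $(U\mathfrak n_-)[-\beta]$ and $(U\mathfrak n_+)[\beta]$ (if $x^\beta_j=\omega(\overline{y^\beta_j})$, where $\omega$ is the Chevalley anti-involution, then $P_\beta$ is the matrix of the Shapovalov form). It acts on $M\otimes F$ for every $\mathfrak n_-$-module $M$; denote this operator by $J(\lambda)^M$. We say that $\lambda_0\in\mathfrak h^*$ has the *good regularity property* if for every $\mathfrak n_-$-module $M$ the family of operators $J(\lambda)^M: M\otimes F[0]^{\widetilde K_{\lambda_0}}\to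 M\otimes F$ is regular at $\lambda=\lambda_0$, i.e. for all $m\in M$ and $g\in F[0]^{\widetilde K_{\lambda_0}}$ the vector $J(\lambda)^M(m\otimes g)$ is a finite linear combination of fixed vectors of $M\otimes F$ whose coefficients are rational functions of $\lambda$ with a common denominator that does not vanish at $\lambda_0$. **Proposition.** Assume that $\lambda_0$ has the good regularity property. Then the natural map $$\operatorname{Hom}_{\mathfrak g}(M(\lambda_0),M(\lambda_0)\otimes F)\to\operatorname{Hom}_{\mathfrak g}(V(\lambda_0),V(\lambda_0)\otimes F),$$ sending $\varphi$ with $\varphi(K(\lambda_0))\subseteq K(\lambda_0)\otimes F$ (this inclusion is known to hold for every $\varphi$) to the map induced on the quotients, is surjective. That is, every $\psi\in\operatorname{Hom}_{\mathfrak g}(V(\lambda_0),V(\lambda_0)\otimes F)$ is induced by some $\varphi\in\operatorname{Hom}_{\mathfrak g}(M(\lambda_0),M(\lambda_0)\otimes F)$ with $\varphi(K(\lambda_0))\subseteq K(\lambda_0)\otimes F$. Moreover, if $u\in F[0]$ is the element with $\psi(\overline{\mathbf 1}_{\lambda_0})=\overline{\mathbf 1}_{\lambda_0}\otimes u+\sum_{\mu<\lambda_0}v_\mu\otimes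 f_\mu$, $v_\mu\in V(\lambda_0)[\mu]$, then $\varphi$ can be chosen with $$\varphi(\mathbf 1_{\lambda_0})=\lim_{\lambda\to\lambda_0}J(\lambda)^{M(\lambda)}(\mathbf 1_\lambda\otimes u),$$ where the limit exists, is taken over generic $\lambda$, and is taken in a finite-dimensional subspace of $U\mathfrak n_-\otimes F$ after identifying each $M(\lambda)$ with $U\mathfrak n_-$ via $y\mathbf 1_\lambda\leftrightarrow y$. -/

import Mathlib

open scoped TensorProduct
open Filter Topology

noncomputable section

namespace EquivQuant

universe u

attribute [local instance] LieRing.ofAssociativeRing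

/-! ### Enveloping algebras -/

section Enveloping

variable (L : Type u) [LieRing L] [LieAlgebra ℂ L]

/-- The universal enveloping algebra of a complex Lie algebra. -/
abbrev U : Type u := UniversalEnvelopingAlgebra ℂ L

/-- The antipode of `U L`, as an algebra morphism into the opposite algebra. -/
def antipodeHom : U L →ₐ[ℂ] (U L)ᵐᵒᵖ :=
  UniversalEnvelopingAlgebra.lift ℂ
    { toFun := fun x => MulOpposite.op (-(UniversalEnvelopingAlgebra.ι ℂ x))
      map_add' := fun x y => by
        rw [map_add, neg_add, MulOpposite.op_add]
      map_smul' := fun c x => by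
        rw [map_smul, ← smul_neg, MulOpposite.op_smul, RingHom.id_apply]
      map_lie' := fun {x y} => by
        rw [LieHom.map_lie, LieRing.of_associative_ring_bracket,
          LieRing.of_associative_ring_bracket, ← MulOpposite.op_mul, ← MulOpposite.op_mul,
          ← MulOpposite.op_sub, neg_mul_neg, neg_mul_neg, neg_sub] }

/-- The antipode `a ↦ ā` of `U L`: the anti-automorphism with `x ↦ -x` for `x ∈ L`. -/
def antipode (a : U L) : U L := (antipodeHom L a).unop

/-- The counit of `U L`. -/
def counit : U L →ₐ[ℂ] ℂ := UniversalEnvelopingAlgebra.lift ℂ (0 : L →ₗ⁅ℂ⁆ ℂ)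

variable {L}

/-- The action of `U L` on an `L`-module. -/
def act (M : Type*) [AddCommGroup M] [Module ℂ M] [LieRingModule L M] [LieModule ℂ L M] :
    U L →ₐ[ℂ] Module.End ℂ M :=
  UniversalEnvelopingAlgebra.lift ℂ (LieModule.toEnd ℂ L M)

/-- The canonical map `U 𝔫 → U L` for a Lie subalgebra `𝔫` of `L`. -/
def inclU (𝔫 : LieSubalgebra ℂ L) : U 𝔫 →ₐ[ℂ] U L :=
  UniversalEnvelopingAlgebra.lift ℂ ((UniversalEnvelopingAlgebra.ι ℂ).comp 𝔫.incl)

end Enveloping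

/-! ### Matrix elements of finite-dimensional representations -/

section MatrixElements

variable (L : Type u) [LieRing L] [LieAlgebra ℂ L]

/-- `ℂ[G]` as a subspace of the dual of `U L`: the span of the matrix elements
`x ↦ ρ(x)ᵢⱼ` of all finite-dimensional representations `ρ` of `U L`. -/
def matrixElements : Submodule ℂ (Module.Dual ℂ (U L)) :=
  Submodule.span ℂ {f | ∃ (n : ℕ) (ρ : U L →ₐ[ℂ] Matrix (Fin n) (Fin n) ℂ) (i j : Fin n),
    ∀ x, f x = ρ x i j}

/-- The space `F = ℂ[G]` of all matrix elements of finite-dimensional representations. -/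
def F : Type u := matrixElements L

instance : AddCommGroup (F L) := inferInstanceAs (AddCommGroup (matrixElements L))

instance : Module ℂ (F L) := inferInstanceAs (Module ℂ (matrixElements L))

variable {L}

/-- The left regular action of `a` on a functional: `(a f)(x) = f(xa)`. -/
def translate (a : U L) : Module.Dual ℂ (U L) →ₗ[ℂ] Module.Dual ℂ (U L) :=
  (LinearMap.mulRight ℂ a).dualMap

theorem translate_apply (a x : U L) (f : Module.Dual ℂ (U L)) : translate a f x = f (x * a) :=
  rfl

theorem translate_mem (a : U L) (f : Module.Dual ℂ (U L)) (hf : f ∈ matrixElements L) :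
    translate a f ∈ matrixElements L := by
  induction hf using Submodule.span_induction with
  | mem f hf =>
    obtain ⟨n, ρ, i, j, h⟩ := hf
    have : translate a f = ∑ k, ρ a k j •
        ((Matrix.entryLinearMap ℂ ℂ i k).comp ρ.toLinearMap : Module.Dual ℂ (U L)) := by
      ext x
      simp [translate_apply, h, Matrix.mul_apply, mul_comm]
    rw [this]
    exact Submodule.sum_mem _ fun k _ =>
      Submodule.smul_mem _ _ (Submodule.subset_span ⟨n, ρ, i, k, fun _ => rfl⟩)
  | zero => rw [map_zero]; exact Submodule.zero_mem _
  | add f g _ _ hf hg => rw [map_add]; exact Submodule.add_mem _ hf hg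
  | smul c f _ hf => rw [map_smul]; exact Submodule.smul_mem _ _ hf

/-- `F` is an `L`-module under the left regular action `(x f)(a) = f(ax)`. -/
instance : LieRingModule L (F L) where
  bracket x f := (⟨translate (UniversalEnvelopingAlgebra.ι ℂ x) f.1,
    translate_mem _ _ f.2⟩ : matrixElements L)
  add_lie x y f := by
    refine Subtype.ext (LinearMap.ext fun a => ?_)
    change f.1 (a * UniversalEnvelopingAlgebra.ι ℂ (x + y)) =
      f.1 (a * UniversalEnvelopingAlgebra.ι ℂ x) + f.1 (a * UniversalEnvelopingAlgebra.ι ℂ y)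
    rw [map_add, mul_add, map_add]
  lie_add x f g := by
    refine Subtype.ext (LinearMap.ext fun a => ?_)
    rfl
  leibniz_lie x y f := by
    refine Subtype.ext (LinearMap.ext fun a => ?_)
    change f.1 (a * UniversalEnvelopingAlgebra.ι ℂ x * UniversalEnvelopingAlgebra.ι ℂ y) =
      f.1 (a * UniversalEnvelopingAlgebra.ι ℂ ⁅x, y⁆) +
        f.1 (a * UniversalEnvelopingAlgebra.ι ℂ y * UniversalEnvelopingAlgebra.ι ℂ x)
    rw [← map_add, LieHom.map_lie, LieRing.of_associative_ring_bracket, mul_sub, mul_assoc,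
      mul_assoc, sub_add_cancel]

instance : LieModule ℂ L (F L) where
  smul_lie c x f := by
    refine Subtype.ext (LinearMap.ext fun a => ?_)
    change f.1 (a * UniversalEnvelopingAlgebra.ι ℂ (c • x)) =
      c • f.1 (a * UniversalEnvelopingAlgebra.ι ℂ x)
    rw [map_smul, mul_smul_comm, map_smul]
  lie_smul c x f := by
    refine Subtype.ext (LinearMap.ext fun a => ?_)
    rfl

end MatrixElements

/-! ### Triangular decomposition, Verma modules, fusion element -/

section Main

variable {𝔤 : Type u} [LieRing 𝔤] [LieAlgebra ℂ 𝔤] [FiniteDimensional ℂ 𝔤]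
  [LieAlgebra.IsSemisimple ℂ 𝔤] {H : LieSubalgebra ℂ 𝔤} [H.IsCartanSubalgebra]
  (b : (LieAlgebra.IsKilling.rootSystem H).Base)

/-- `𝔫₊`, generated by (in fact, the sum of) the root spaces of the positive roots. -/
def nPlus : LieSubalgebra ℂ 𝔤 :=
  LieSubalgebra.lieSpan ℂ 𝔤 {x | ∃ α : H.root, b.IsPos α ∧ x ∈ LieAlgebra.rootSpace H ⇑α.1}

/-- `𝔫₋`, generated by (in fact, the sum of) the root spaces of the negative roots. -/
def nMinus : LieSubalgebra ℂ 𝔤 :=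
  LieSubalgebra.lieSpan ℂ 𝔤 {x | ∃ α : H.root, b.IsPos α ∧ x ∈ LieAlgebra.rootSpace H (-⇑α.1)}

/-- `Q₊`: the nonzero sums of simple roots with coefficients in `ℤ₊`. -/
def QPlus : Set (Module.Dual ℂ H) :=
  {β | β ∈ AddSubmonoid.closure ((LieAlgebra.IsKilling.rootSystem H).root '' b.support) ∧ β ≠ 0}

/-- The left ideal `U𝔤·𝔫₊ + ∑ U𝔤·(h - lam(h))` of `U𝔤`. -/
def vermaIdeal (lam : Module.Dual ℂ H) : Submodule (U 𝔤) (U 𝔤) :=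
  Submodule.span (U 𝔤)
    ({a | ∃ x ∈ nPlus b, a = UniversalEnvelopingAlgebra.ι ℂ x} ∪
      {a | ∃ h : H, a = UniversalEnvelopingAlgebra.ι ℂ (h : 𝔤) - algebraMap ℂ (U 𝔤) (lam h)})

/-- The Verma module `M(lam)` of highest weight `lam`. -/
def Verma (lam : Module.Dual ℂ H) : Type u := U 𝔤 ⧸ vermaIdeal b lam

section VermaInstances

variable (lam : Module.Dual ℂ H)

instance : AddCommGroup (Verma b lam) := inferInstanceAs (AddCommGroup (U 𝔤 ⧸ vermaIdeal b lam))

instance : Module (U 𝔤) (Verma b lam) := inferInstanceAs (Module (U 𝔤) (U 𝔤 ⧸ vermaIdeal b lam))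

instance : Module ℂ (Verma b lam) := inferInstanceAs (Module ℂ (U 𝔤 ⧸ vermaIdeal b lam))

instance : IsScalarTower ℂ (U 𝔤) (Verma b lam) :=
  inferInstanceAs (IsScalarTower ℂ (U 𝔤) (U 𝔤 ⧸ vermaIdeal b lam))

instance : LieRingModule 𝔤 (Verma b lam) where
  bracket x m := UniversalEnvelopingAlgebra.ι ℂ x • m
  add_lie x y m := by
    rw [map_add, add_smul]
  lie_add x m n := smul_add _ _ _
  leibniz_lie x y m := by
    change UniversalEnvelopingAlgebra.ι ℂ x • (UniversalEnvelopingAlgebra.ι ℂ y • m) =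
      UniversalEnvelopingAlgebra.ι ℂ ⁅x, y⁆ • m +
        UniversalEnvelopingAlgebra.ι ℂ y • (UniversalEnvelopingAlgebra.ι ℂ x • m)
    rw [LieHom.map_lie, LieRing.of_associative_ring_bracket, sub_smul, mul_smul, mul_smul,
      sub_add_cancel]

instance : LieModule ℂ 𝔤 (Verma b lam) where
  smul_lie c x m := by
    change UniversalEnvelopingAlgebra.ι ℂ (c • x) • m = c • (UniversalEnvelopingAlgebra.ι ℂ x • m)
    rw [map_smul, smul_assoc]
  lie_smul c x m := by
    change UniversalEnvelopingAlgebra.ι ℂ x • (c • m) = c • (UniversalEnvelopingAlgebra.ι ℂ x • m)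
    rw [← algebraMap_smul (U 𝔤) c m, ← algebraMap_smul (U 𝔤) c, smul_smul, smul_smul,
      Algebra.commutes]

/-- The highest weight vector `1_lam` of `M(lam)`. -/
def vermaOne : Verma b lam := Submodule.Quotient.mk (p := vermaIdeal b lam) 1

/-- The canonical map `U𝔫₋ → M(lam)`, `y ↦ y·1_lam`. -/
def vermaCan : U (nMinus b) →ₗ[ℂ] Verma b lam :=
  (LinearMap.applyₗ (R := ℂ) (vermaOne b lam)) ∘ₗ (act (Verma b lam)).toLinearMap

/-- `K(lam)`: the maximal (proper) submodule of `M(lam)`, the sum of all proper submodules. -/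
def maxSub : LieSubmodule ℂ 𝔤 (Verma b lam) := sSup {N | N ≠ ⊤}

/-- The irreducible highest weight module `V(lam) = M(lam)/K(lam)`. -/
abbrev Irr : Type u := Verma b lam ⧸ maxSub b lam

/-- The projection `M(lam) → V(lam)`. -/
def irrProj : Verma b lam →ₗ⁅ℂ, 𝔤⁆ Irr b lam := LieSubmodule.Quotient.mk' (maxSub b lam)

/-- The weight `lam` is generic: `M(lam)` is irreducible. -/
def Generic : Prop := LieModule.IsIrreducible ℂ 𝔤 (Verma b lam)

end VermaInstances

/-- Evaluation at `lam` of elements of `U𝔥 = S𝔥 = ℂ[𝔥*]`. -/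
def evalCartan (lam : Module.Dual ℂ H) : U H →ₐ[ℂ] ℂ :=
  UniversalEnvelopingAlgebra.lift ℂ
    { lam with
      map_lie' := fun {x y} => by
        change lam ⁅x, y⁆ = ⁅lam x, lam y⁆
        rw [LieModule.IsTrivial.trivial, map_zero, LieRing.of_associative_ring_bracket, mul_comm,
          sub_self] }

/-- The subspace `𝔫₋·U𝔤 + U𝔤·𝔫₊`, a complement of `U𝔥` in `U𝔤`. -/
def hcKernel : Submodule ℂ (U 𝔤) :=
  Submodule.span ℂ
    ({a | ∃ y ∈ nMinus b, ∃ c, a = UniversalEnvelopingAlgebra.ι ℂ y * c} ∪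
      {a | ∃ x ∈ nPlus b, ∃ c, a = c * UniversalEnvelopingAlgebra.ι ℂ x})

/-- `(a)₀(lam)`, where `a ↦ (a)₀` is the projection `U𝔤 → U𝔥` along `𝔫₋·U𝔤 + U𝔤·𝔫₊`
(the element `z` below exists and is unique since `U𝔤 = U𝔥 ⊕ (𝔫₋·U𝔤 + U𝔤·𝔫₊)`). -/
def hcEval (lam : Module.Dual ℂ H) (a : U 𝔤) : ℂ :=
  evalCartan lam (Classical.epsilon fun z : U H => a - inclU H z ∈ hcKernel b)

/-- The pairing `π_lam : U𝔫₊ ⊗ U𝔫₋ → ℂ`, `π_lam(x ⊗ y) = (x̄ y)₀(lam)`. -/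
def pairing (lam : Module.Dual ℂ H) (x : U (nPlus b)) (y : U (nMinus b)) : ℂ :=
  hcEval b lam (antipode 𝔤 (inclU (nPlus b) x) * inclU (nMinus b) y)

/-- `K̃_lam ⊆ U𝔫₊`: the kernel of `π_lam` on the side of `U𝔫₊`. -/
def KTilde (lam : Module.Dual ℂ H) : Set (U (nPlus b)) :=
  {x | ∀ y, pairing b lam x y = 0}

/-- `F[0]^{K̃_lam}`: the elements `f ∈ F` of weight zero with `a f = ε(a) f` for all
`a ∈ K̃_lam`. -/
def FInv (lam : Module.Dual ℂ H) : Set (F 𝔤) :=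
  {f | (∀ h : H, ⁅(h : 𝔤), f⁆ = 0) ∧
    ∀ a ∈ KTilde b lam, act (F 𝔤) a f = counit (nPlus b) a • f}

/-- `(U𝔫)[μ]`: the elements of weight `μ` in `U𝔫`, for the adjoint action of `𝔥`. -/
def weightU (𝔫 : LieSubalgebra ℂ 𝔤) (μ : Module.Dual ℂ H) : Submodule ℂ (U 𝔫) where
  carrier := {y | ∀ h : H, UniversalEnvelopingAlgebra.ι ℂ (h : 𝔤) * inclU 𝔫 y -
    inclU 𝔫 y * UniversalEnvelopingAlgebra.ι ℂ (h : 𝔤) = μ h • inclU 𝔫 y}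
  add_mem' := fun {y z} hy hz h => by
    rw [map_add, mul_add, add_mul, smul_add, ← hy h, ← hz h]; abel
  zero_mem' := fun h => by simp
  smul_mem' := fun c y hy h => by
    rw [map_smul, mul_smul_comm, smul_mul_assoc, ← smul_sub, hy h, smul_comm]

/-- A choice of bases of `(U𝔫₋)[-β]` and `(U𝔫₊)[β]` (two spaces of the same finite dimension). -/
structure WeightBases (β : Module.Dual ℂ H) where
  /-- the common dimension -/
  n : ℕ
  /-- the basis of `(U𝔫₋)[-β]` -/
  y : Module.Basis (Fin n) ℂ (weightU (nMinus b) (-β))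
  /-- the basis of `(U𝔫₊)[β]` -/
  x : Module.Basis (Fin n) ℂ (weightU (nPlus b) β)

/-- The component `∑ᵢⱼ (P⁻¹)ᵢⱼ yᵢ ⊗ xⱼ` of the fusion element, where `(yᵢ)` and `(xⱼ)` are bases
of `(U𝔫₋)[-β]` and `(U𝔫₊)[β]` and `Pᵢⱼ = π_lam(xᵢ ⊗ yⱼ)`. For `xⱼ = ω(ȳⱼ)` the matrix `P` is the
matrix of the Shapovalov form in the basis `(yᵢ)`. The sum does not depend on the bases. -/
def fusionElement (lam β : Module.Dual ℂ H) (B : WeightBases b β) :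
    U (nMinus b) ⊗[ℂ] U (nPlus b) :=
  ∑ i, ∑ j, (Matrix.of fun i j => pairing b lam (B.x i).1 (B.y j).1)⁻¹ i j •
    ((B.y i).1 ⊗ₜ[ℂ] (B.x j).1)

open Classical in
/-- The component of weight `(-β, β)` of the fusion element `J(lam)`. -/
def fusionComponent (lam β : Module.Dual ℂ H) : U (nMinus b) ⊗[ℂ] U (nPlus b) :=
  if h : Nonempty (WeightBases b β) then fusionElement b lam β h.some else 0

/-- The operator `J(lam)^M` on `M ⊗ F` for an `𝔫₋`-module `M` and generic `lam`, where
`J(lam) = 1 ⊗ 1 + ∑_{β ∈ Q₊} ∑ᵢⱼ (P⁻¹)ᵢⱼ yᵢ ⊗ xⱼ`; on each vector only finitely many terms of the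
sum are nonzero. -/
def fusionOp (lam : Module.Dual ℂ H) (M : Type*) [AddCommGroup M] [Module ℂ M]
    [LieRingModule (nMinus b) M] [LieModule ℂ (nMinus b) M] (w : M ⊗[ℂ] F 𝔤) : M ⊗[ℂ] F 𝔤 :=
  w + ∑ᶠ β ∈ QPlus b,
    TensorProduct.homTensorHomMap (RingHom.id ℂ) M (F 𝔤) M (F 𝔤)
      (TensorProduct.map (act M).toLinearMap (act (F 𝔤)).toLinearMap (fusionComponent b lam β)) w

/-- A family `f(lam)` of vectors, given for generic `lam`, is regular at `lam₀`: it is a rational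
function of `lam` of the form `q⁻¹ ∑ p_w w` (a finite sum) with polynomials `q`, `p_w` on `𝔥*` such
that `q(lam₀) ≠ 0`. -/
def IsRegularAt {W : Type*} [AddCommGroup W] [Module ℂ W] (f : Module.Dual ℂ H → W)
    (lam₀ : Module.Dual ℂ H) : Prop :=
  ∃ (q : MvPolynomial H ℂ) (P : W →₀ MvPolynomial H ℂ), MvPolynomial.eval (fun h => lam₀ h) q ≠ 0 ∧
    ∀ lam, Generic b lam → MvPolynomial.eval (fun h => lam h) q • f lam =
      P.sum fun w p => MvPolynomial.eval (fun h => lam h) p • w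

/-- The good regularity property of `lam₀`: for every `𝔫₋`-module `M` the family of operators
`J(lam)^M : M ⊗ F[0]^{K̃_{lam₀}} → M ⊗ F` is regular at `lam = lam₀`. -/
def GoodRegularity (lam₀ : Module.Dual ℂ H) : Prop :=
  ∀ (M : Type u) [AddCommGroup M] [Module ℂ M] [LieRingModule (nMinus b) M]
    [LieModule ℂ (nMinus b) M] (m : M), ∀ g ∈ FInv b lam₀,
    IsRegularAt b (fun lam => fusionOp b lam M (m ⊗ₜ[ℂ] g)) lam₀

/-! ### The natural map and limits -/

/-- The `φ ∈ Hom_𝔤(M(lam), M(lam) ⊗ F)` with `φ(K(lam)) ⊆ K(lam) ⊗ F`. -/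
def homPreserving (lam : Module.Dual ℂ H) :
    Submodule ℂ (Verma b lam →ₗ⁅ℂ, 𝔤⁆ Verma b lam ⊗[ℂ] F 𝔤) where
  carrier := {φ | ∀ m ∈ maxSub b lam,
    φ m ∈ LinearMap.range ((maxSub b lam).toSubmodule.subtype.rTensor (F 𝔤))}
  add_mem' := fun hφ hψ m hm => Submodule.add_mem _ (hφ m hm) (hψ m hm)
  zero_mem' := fun _ _ => Submodule.zero_mem _
  smul_mem' := fun c _ hφ m hm => Submodule.smul_mem _ c (hφ m hm)

/-- The map `M(lam) ⊗ F → V(lam) ⊗ F`. -/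
def projF (lam : Module.Dual ℂ H) : Verma b lam ⊗[ℂ] F 𝔤 →ₗ⁅ℂ, 𝔤⁆ Irr b lam ⊗[ℂ] F 𝔤 :=
  TensorProduct.LieModule.map (irrProj b lam) LieModuleHom.id

theorem projF_eq_zero (lam : Module.Dual ℂ H) (w : Verma b lam ⊗[ℂ] F 𝔤)
    (hw : w ∈ LinearMap.range ((maxSub b lam).toSubmodule.subtype.rTensor (F 𝔤))) :
    projF b lam w = 0 := by
  obtain ⟨z, rfl⟩ := hw
  induction z using TensorProduct.induction_on with
  | zero => simp
  | add x y hx hy => rw [map_add, map_add, hx, hy, add_zero]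
  | tmul k f =>
    have hk : irrProj b lam k.1 = 0 := (LieSubmodule.Quotient.mk_eq_zero' (N := maxSub b lam)).2 k.2
    change irrProj b lam k.1 ⊗ₜ[ℂ] f = 0
    rw [hk, TensorProduct.zero_tmul]

/-- The natural map `Hom_𝔤(M(lam), M(lam) ⊗ F) → Hom_𝔤(V(lam), V(lam) ⊗ F)`, which sends `φ` to
the map induced by it on the quotient `V(lam) = M(lam)/K(lam)`; here `φ(K(lam)) ⊆ K(lam) ⊗ F`. -/
def naturalMap (lam : Module.Dual ℂ H) :
    homPreserving b lam →ₗ[ℂ] (Irr b lam →ₗ⁅ℂ, 𝔤⁆ Irr b lam ⊗[ℂ] F 𝔤) where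
  toFun φ :=
    { (maxSub b lam).toSubmodule.liftQ ((projF b lam).toLinearMap ∘ₗ φ.1.toLinearMap)
        (fun m hm => projF_eq_zero b lam _ (φ.2 m hm)) with
      map_lie' := fun {x v} => by
        obtain ⟨m, rfl⟩ := LieSubmodule.Quotient.surjective_mk' (maxSub b lam) v
        change projF b lam (φ.1 ⁅x, m⁆) = ⁅x, projF b lam (φ.1 m)⁆
        rw [LieModuleHom.map_lie, LieModuleHom.map_lie] }
  map_add' φ ψ := by
    refine LieModuleHom.ext fun v => ?_
    obtain ⟨m, rfl⟩ := LieSubmodule.Quotient.surjective_mk' (maxSub b lam) v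
    exact map_add (projF b lam) (φ.1 m) (ψ.1 m)
  map_smul' c φ := by
    refine LieModuleHom.ext fun v => ?_
    obtain ⟨m, rfl⟩ := LieSubmodule.Quotient.surjective_mk' (maxSub b lam) v
    exact map_smul (projF b lam) c (φ.1 m)

theorem naturalMap_apply (lam : Module.Dual ℂ H) (φ : homPreserving b lam) (m : Verma b lam) :
    naturalMap b lam φ (irrProj b lam m) = projF b lam (φ.1 m) :=
  rfl

/-- `u = Θ(ψ)`: the vector `u ∈ F[0]` with `ψ(1̄) = 1̄ ⊗ u + ∑_{μ < lam} v_μ ⊗ f_μ`, where `1̄` is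
the highest weight vector of `V(lam)` and `v_μ ∈ V(lam)[μ]`. -/
def IsTheta (lam : Module.Dual ℂ H) (ψ : Irr b lam →ₗ⁅ℂ, 𝔤⁆ Irr b lam ⊗[ℂ] F 𝔤) (u : F 𝔤) :
    Prop :=
  (∀ h : H, ⁅(h : 𝔤), u⁆ = 0) ∧
    ψ (irrProj b lam (vermaOne b lam)) - irrProj b lam (vermaOne b lam) ⊗ₜ[ℂ] u ∈
      Submodule.span ℂ {w | ∃ β ∈ QPlus b, ∃ (v : Irr b lam) (f : F 𝔤),
        (∀ h : H, ⁅(h : 𝔤), v⁆ = (lam h - β h) • v) ∧ w = v ⊗ₜ[ℂ] f}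

/-- `lam → lam₀` in `𝔥*` through generic `lam`. -/
def genericNhds (lam₀ : Module.Dual ℂ H) : Filter (Module.Dual ℂ H) :=
  comap (fun (lam : Module.Dual ℂ H) (h : H) => lam h) (𝓝 fun h => lam₀ h) ⊓
    𝓟 {lam | Generic b lam}

/-- Convergence `f → Z` in a complex vector space: the values of `f` eventually lie in one
finite-dimensional subspace, and `f` converges there to `Z`, that is, after applying any linear
functional. -/
def TendstoFin {X W : Type*} [AddCommGroup W] [Module ℂ W] (f : X → W) (l : Filter X) (Z : W) :
    Prop :=
  (∃ S : Submodule ℂ W, FiniteDimensional ℂ S ∧ ∀ᶠ x in l, f x ∈ S) ∧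
    ∀ ξ : Module.Dual ℂ W, Tendsto (fun x => ξ (f x)) l (𝓝 (ξ Z))

end Main

end EquivQuant

end

open scoped TensorProduct
open Filter Topology

noncomputable section

namespace EquivQuant

universe u

attribute [local instance] LieRing.ofAssociativeRing

/-! ### Generalities on enveloping algebras -/

section EnvelopingGeneral

variable {L : Type u} [LieRing L] [LieAlgebra ℂ L]

/-! The functional `vacuum` reads off the coefficient of the highest weight vector, and everything
is tested against its translates under `U𝔫₊`. If a vector `w` of `V ⊗ E` is killed by `𝔫₊`,
contraction intertwines: contracting `w` with `x·ν` gives `x` applied to the contraction with `ν`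
(`contract_twist_of_singular`). So when the translates of `ν` separate the points of `V`, a singular
vector is determined by its leading coefficient (`eq_zero_of_singular`), and conversely these
contraction identities force singularity (`singular_of_contract_twist`). Translates of the vacuum do
separate points of `V(lam)`, and of `M(lam)` for generic `lam`, because a vector on which they all
vanish lies in `K(lam)` (`mem_maxSub_of_twist`).

Given `ψ`, let `u` be the leading coefficient of `ψ(1̄)`. Elements of `K̃` kill the vacuum
functional of `V(lam₀)` and have counit zero, so `u` lies in `F[0]^{K̃}` (`leadingCoeff_mem_FInv`)
and good regularity applies to it. For generic `lam` the Shapovalov-type matrices are invertible,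
the fusion element is the canonical element of the pairing, and `J(lam)(1 ⊗ u)` has exactly the
contractions of a singular vector of weight `lam` with leading coefficient `u`
(`contract_fusionOp`).

After `M(lam)` is identified with `U𝔫₋`, the equations "killed by `𝔫₊`, of weight `lam`, leading
coefficient `u`" are linear with coefficients polynomial in `lam`. They hold for the regular family
at all generic weights, which are Zariski dense, hence for its value at `lam₀`
(`exists_limit_fusionOp`). That value defines `φ` on `M(lam₀)`. Its projection to `V(lam₀) ⊗ F` and
`ψ(1̄)` are singular vectors with the same leading coefficient, so they coincide; thus `φ` covers
`ψ` and in particular preserves `K` (`exists_lift`).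

Two inputs are obtained by hand. Freeness of Verma modules over `U𝔫₋` rests on PBW, whose
independence half comes from left invariant vector fields on matrices
(`linearIndependent_mon_comp`). Density of generic weights comes from the Casimir operator: a
reducible `M(lam)` forces a coincidence of Casimir eigenvalues, and on a suitable line through any
weight only countably many points allow one (`countable_not_generic`). -/

theorem enveloping_induction {p : U L → Prop} (hc : ∀ c : ℂ, p (algebraMap ℂ (U L) c))
    (hι : ∀ x : L, p (UniversalEnvelopingAlgebra.ι ℂ x))
    (hmul : ∀ a b, p a → p b → p (a * b)) (hadd : ∀ a b, p a → p b → p (a + b)) (a : U L) :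
    p a := by
  let S : Subalgebra ℂ (U L) :=
    { carrier := {a | p a}
      mul_mem' := fun {a b} ha hb => hmul a b ha hb
      add_mem' := fun {a b} ha hb => hadd a b ha hb
      algebraMap_mem' := hc }
  let j : L →ₗ⁅ℂ⁆ S :=
    { toFun := fun x => ⟨UniversalEnvelopingAlgebra.ι ℂ x, hι x⟩
      map_add' := fun x y => Subtype.ext (map_add _ x y)
      map_smul' := fun c x => Subtype.ext (map_smul _ c x)
      map_lie' := fun {x y} => Subtype.ext (LieHom.map_lie _ x y) }
  have h : S.val.comp (UniversalEnvelopingAlgebra.lift ℂ j) = AlgHom.id ℂ (U L) := by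
    ext x
    change ((UniversalEnvelopingAlgebra.lift ℂ j (UniversalEnvelopingAlgebra.ι ℂ x) : S) : U L) = _
    rw [UniversalEnvelopingAlgebra.lift_ι_apply]
    rfl
  have := congrArg (fun φ => φ a) h
  change ((UniversalEnvelopingAlgebra.lift ℂ j a : S) : U L) = a at this
  rw [← this]
  exact (UniversalEnvelopingAlgebra.lift ℂ j a).2

theorem antipode_ι (x : L) :
    antipode L (UniversalEnvelopingAlgebra.ι ℂ x) = -UniversalEnvelopingAlgebra.ι ℂ x := by
  rw [antipode, antipodeHom, UniversalEnvelopingAlgebra.lift_ι_apply]; rfl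

theorem antipode_mul (a b : U L) : antipode L (a * b) = antipode L b * antipode L a := by
  simp [antipode]

theorem antipode_add (a b : U L) : antipode L (a + b) = antipode L a + antipode L b := by
  simp [antipode]

theorem antipode_smul (c : ℂ) (a : U L) : antipode L (c • a) = c • antipode L a := by
  simp [antipode]

theorem antipode_algebraMap (c : ℂ) :
    antipode L (algebraMap ℂ (U L) c) = algebraMap ℂ (U L) c := by
  rw [antipode, AlgHom.commutes]; rfl

theorem antipode_one : antipode L 1 = 1 := by
  simp [antipode]

theorem antipode_antipode (a : U L) : antipode L (antipode L a) = a := by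
  induction a using enveloping_induction with
  | hc c => rw [antipode_algebraMap, antipode_algebraMap]
  | hι x =>
    rw [antipode_ι, ← neg_one_smul ℂ, antipode_smul, antipode_ι, smul_neg, neg_one_smul, neg_neg]
  | hmul a b ha hb => rw [antipode_mul, antipode_mul, ha, hb]
  | hadd a b ha hb => rw [antipode_add, antipode_add, ha, hb]

theorem counit_ι (x : L) : counit L (UniversalEnvelopingAlgebra.ι ℂ x) = 0 := by
  rw [counit, UniversalEnvelopingAlgebra.lift_ι_apply]; rfl

theorem act_ι (M : Type*) [AddCommGroup M] [Module ℂ M] [LieRingModule L M] [LieModule ℂ L M]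
    (x : L) (m : M) : act M (UniversalEnvelopingAlgebra.ι ℂ x) m = ⁅x, m⁆ := by
  rw [act, UniversalEnvelopingAlgebra.lift_ι_apply]; rfl

theorem inclU_ι (𝔫 : LieSubalgebra ℂ L) (x : 𝔫) :
    inclU 𝔫 (UniversalEnvelopingAlgebra.ι ℂ x) = UniversalEnvelopingAlgebra.ι ℂ (x : L) := by
  rw [inclU, UniversalEnvelopingAlgebra.lift_ι_apply]; rfl

theorem antipode_inclU (𝔫 : LieSubalgebra ℂ L) (a : U 𝔫) :
    antipode L (inclU 𝔫 a) = inclU 𝔫 (antipode 𝔫 a) := by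
  induction a using enveloping_induction with
  | hc c => rw [AlgHom.commutes, antipode_algebraMap, antipode_algebraMap, AlgHom.commutes]
  | hι x => rw [inclU_ι, antipode_ι, antipode_ι, map_neg, inclU_ι]
  | hmul a b ha hb => rw [map_mul, antipode_mul, antipode_mul, ha, hb, map_mul]
  | hadd a b ha hb => rw [map_add, antipode_add, antipode_add, ha, hb, map_add]

theorem act_inclU (𝔫 : LieSubalgebra ℂ L) (M : Type*) [AddCommGroup M] [Module ℂ M]
    [LieRingModule L M] [LieModule ℂ L M] (a : U 𝔫) (m : M) :
    act M (inclU 𝔫 a) m = act (L := 𝔫) M a m := by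
  induction a using enveloping_induction generalizing m with
  | hc c => simp only [AlgHom.commutes]
  | hι x => rw [inclU_ι, act_ι, act_ι]; rfl
  | hmul a b ha hb => simp only [map_mul, Module.End.mul_apply, ha, hb]
  | hadd a b ha hb => simp only [map_add, LinearMap.add_apply, ha, hb]

theorem act_equivariant {M N : Type*} [AddCommGroup M] [Module ℂ M] [LieRingModule L M]
    [LieModule ℂ L M] [AddCommGroup N] [Module ℂ N] [LieRingModule L N] [LieModule ℂ L N]
    (φ : M →ₗ[ℂ] N) (hφ : ∀ (x : L) (m : M), φ ⁅x, m⁆ = ⁅x, φ m⁆) (a : U L) (m : M) :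
    φ (act M a m) = act N a (φ m) := by
  induction a using enveloping_induction generalizing m with
  | hc c => simp only [AlgHom.commutes, Module.algebraMap_end_apply, map_smul]
  | hι x => rw [act_ι, act_ι, hφ]
  | hmul a b ha hb => simp only [map_mul, Module.End.mul_apply, ha, hb]
  | hadd a b ha hb => simp only [map_add, LinearMap.add_apply, ha, hb]

end EnvelopingGeneral

/-! ### The Poincaré–Birkhoff–Witt theorem for linear Lie algebras -/

section PBW

variable {L : Type u} [LieRing L] [LieAlgebra ℂ L] {ι : Type*} (X : ι → L)

/-- The monomial `X_{i₁} ⋯ X_{iₖ}` in the enveloping algebra. -/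
def mon (l : List ι) : U L := (l.map fun i => UniversalEnvelopingAlgebra.ι ℂ (X i)).prod

@[simp] theorem mon_nil : mon X [] = 1 := rfl

@[simp] theorem mon_cons (i : ι) (l : List ι) :
    mon X (i :: l) = UniversalEnvelopingAlgebra.ι ℂ (X i) * mon X l := by
  simp [mon]

theorem mon_append (l l' : List ι) : mon X (l ++ l') = mon X l * mon X l' := by
  simp [mon]

theorem mon_map {κ : Type*} (g : κ → ι) (l : List κ) : mon X (l.map g) = mon (X ∘ g) l := by
  simp [mon, Function.comp_def]

theorem inclU_mon (𝔫 : LieSubalgebra ℂ L) (Y : ι → 𝔫) (l : List ι) :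
    inclU 𝔫 (mon Y l) = mon (fun i => (Y i : L)) l := by
  induction l with
  | nil => simp
  | cons i l ih => rw [mon_cons, mon_cons, map_mul, ih, inclU_ι]

/-- The span of the monomials of degree at most `k`. -/
def monFilt (k : ℕ) : Submodule ℂ (U L) := Submodule.span ℂ (mon X '' {l | l.length ≤ k})

theorem monFilt_mono {j k : ℕ} (h : j ≤ k) : monFilt X j ≤ monFilt X k :=
  Submodule.span_mono (Set.image_mono fun _ hl => le_trans hl h)

variable {X} (hX : Submodule.span ℂ (Set.range X) = ⊤)

include hX

theorem ι_mul_mem_monFilt (x : L) {k : ℕ} {a : U L} (ha : a ∈ monFilt X k) :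
    UniversalEnvelopingAlgebra.ι ℂ x * a ∈ monFilt X (k + 1) := by
  have hx : x ∈ Submodule.span ℂ (Set.range X) := hX ▸ Submodule.mem_top
  induction hx using Submodule.span_induction with
  | mem x hx =>
    obtain ⟨i, rfl⟩ := hx
    induction ha using Submodule.span_induction with
    | mem a ha =>
      obtain ⟨l, hl, rfl⟩ := ha
      exact Submodule.subset_span ⟨i :: l, Nat.succ_le_succ hl, mon_cons X i l⟩
    | zero => rw [mul_zero]; exact Submodule.zero_mem _
    | add a b _ _ ha hb => rw [mul_add]; exact Submodule.add_mem _ ha hb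
    | smul c a _ ha => rw [mul_smul_comm]; exact Submodule.smul_mem _ _ ha
  | zero => rw [map_zero, zero_mul]; exact Submodule.zero_mem _
  | add x y _ _ hx hy => rw [map_add, add_mul]; exact Submodule.add_mem _ hx hy
  | smul c x _ hx => rw [map_smul, smul_mul_assoc]; exact Submodule.smul_mem _ _ hx

/-- Exchanging two neighbouring factors costs a commutator, which is a single element of `L`, so the
error is shorter by one. Modulo lower degree a monomial therefore depends only on its multiset of
factors. -/
theorem mon_sub_mon_mem_of_perm {l l' : List ι} (h : l.Perm l') (k : ℕ) (hk : l.length ≤ k + 1) :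
    mon X l - mon X l' ∈ monFilt X k := by
  induction h generalizing k with
  | nil => rw [sub_self]; exact Submodule.zero_mem _
  | @cons i l₁ l₂ h ih =>
    rw [mon_cons, mon_cons, ← mul_sub]
    cases k with
    | zero =>
      have h₁ : l₁ = [] := List.length_eq_zero_iff.1 (by simpa using hk)
      subst h₁
      rw [h.nil_eq, sub_self, mul_zero]
      exact Submodule.zero_mem _
    | succ k => exact ι_mul_mem_monFilt hX _ (ih k (by simpa using hk))
  | swap i j l =>
    simp only [mon_cons]
    rw [← mul_assoc, ← mul_assoc, ← sub_mul, ← LieRing.of_associative_ring_bracket,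
      ← LieHom.map_lie]
    refine monFilt_mono X ?_ (ι_mul_mem_monFilt hX _
      (Submodule.subset_span ⟨l, le_refl l.length, rfl⟩))
    simpa using hk
  | trans h₁ _ ih₁ ih₂ =>
    rw [← sub_add_sub_cancel]
    exact Submodule.add_mem _ (ih₁ k hk) (ih₂ k (h₁.length_eq ▸ hk))

theorem span_range_mon : Submodule.span ℂ (Set.range (mon X)) = ⊤ := by
  rw [eq_top_iff]
  rintro a -
  induction a using enveloping_induction with
  | hc c =>
    rw [Algebra.algebraMap_eq_smul_one]
    exact Submodule.smul_mem _ _ (Submodule.subset_span ⟨[], rfl⟩)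
  | hι x =>
    have := ι_mul_mem_monFilt hX x (k := 0) (Submodule.subset_span ⟨[], le_refl 0, mon_nil X⟩)
    rw [mul_one] at this
    exact Submodule.span_mono (Set.image_subset_range _ _) this
  | hmul a b ha hb =>
    have := Submodule.mul_mem_mul ha hb
    rw [Submodule.span_mul_span] at this
    refine Submodule.span_mono ?_ this
    rintro _ ⟨_, ⟨l, rfl⟩, _, ⟨l', rfl⟩, rfl⟩
    exact ⟨l ++ l', mon_append X l l'⟩
  | hadd a b ha hb => exact Submodule.add_mem _ ha hb

/-- The spanning half of the PBW theorem, for an arbitrary choice of orderings `s ↦ ℓ s`. -/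
theorem span_range_mon_comp (ℓ : Multiset ι → List ι) (hℓ : ∀ s, (ℓ s : Multiset ι) = s) :
    Submodule.span ℂ (Set.range (mon X ∘ ℓ)) = ⊤ := by
  rw [eq_top_iff, ← span_range_mon hX, Submodule.span_le]
  rintro _ ⟨l, rfl⟩
  suffices h : ∀ n : ℕ, ∀ l : List ι, l.length ≤ n →
      mon X l ∈ Submodule.span ℂ (Set.range (mon X ∘ ℓ)) from h _ l le_rfl
  intro n
  induction n with
  | zero =>
    intro l hl
    have hl' : l = [] := List.length_eq_zero_iff.1 (by simpa using hl)
    have := hℓ (l : Multiset ι)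
    refine Submodule.subset_span ⟨l, ?_⟩
    subst hl'
    rw [Function.comp_apply, (Multiset.coe_eq_coe.1 this).eq_nil]
  | succ n ih =>
    intro l hl
    -- Passing to the prescribed ordering changes the monomial only by terms of degree at most `n`,
    -- which the induction hypothesis covers.
    have h₁ : mon X l - mon X (ℓ l) ∈ monFilt X n :=
      mon_sub_mon_mem_of_perm hX (Multiset.coe_eq_coe.1 (hℓ (l : Multiset ι))).symm n hl
    have h₂ : monFilt X n ≤ Submodule.span ℂ (Set.range (mon X ∘ ℓ)) := by
      rw [monFilt, Submodule.span_le]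
      rintro _ ⟨l, hl, rfl⟩
      exact ih l hl
    rw [← sub_add_cancel (mon X l) (mon X (ℓ l))]
    exact Submodule.add_mem _ (h₂ h₁) (Submodule.subset_span ⟨(l : Multiset ι), rfl⟩)

end PBW

/-! ### Independence of ordered monomials from a representation by derivations. -/

section PBWIndependence

variable {A : Type*} [CommRing A] [Algebra ℂ A]

/-- A derivation lowers the order of vanishing along `I` by at most one: each Leibniz term
differentiates only one of the factors. -/
theorem leibniz_mem_pow (I : Ideal A) (D : A →ₗ[ℂ] A) (hD : ∀ f g, D (f * g) = D f * g + f * D g)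
    (n : ℕ) {f : A} (hf : f ∈ I ^ (n + 1)) : D f ∈ I ^ n := by
  induction n generalizing f with
  | zero => simp
  | succ n ih =>
    rw [pow_succ] at hf
    induction hf using Submodule.mul_induction_on' with
    | mem_mul_mem a ha c hc =>
      rw [hD]
      refine Ideal.add_mem _ ?_ (Ideal.mul_mem_right _ _ ha)
      rw [pow_succ]
      exact Ideal.mul_mem_mul (ih ha) hc
    | add a _ c _ ha hc => rw [map_add]; exact Ideal.add_mem _ ha hc

omit [Algebra ℂ A] in
theorem prod_map_mem_pow {ι : Type*} (I : Ideal A) (t : ι → A) (ht : ∀ i, t i ∈ I)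
    (s : Multiset ι) : (s.map t).prod ∈ I ^ s.card := by
  induction s using Multiset.induction with
  | empty => simp
  | cons i s ih =>
    rw [Multiset.map_cons, Multiset.prod_cons, Multiset.card_cons, pow_succ']
    exact Ideal.mul_mem_mul (ht i) ih

/-- When `D` sends `t j` to the Kronecker delta modulo `I`, it acts on monomials in the `t j` as the
partial derivative in `t i`, up to an error vanishing one order higher than the main term; the
multiplicity of `i` is the exponent brought down. -/
theorem leibniz_prod_sub_mem {ι : Type*} [DecidableEq ι] (I : Ideal A) (t : ι → A)
    (ht : ∀ i, t i ∈ I) (D : A →ₗ[ℂ] A) (hD : ∀ f g, D (f * g) = D f * g + f * D g) (i : ι)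
    (hDt : ∀ j, D (t j) - (if i = j then 1 else 0) ∈ I) (s : Multiset ι) :
    D (s.map t).prod - s.count i • ((s.erase i).map t).prod ∈ I ^ s.card := by
  induction s using Multiset.induction with
  | empty => simp
  | cons j s ih =>
    have h₁ : (D (t j) - (if i = j then 1 else 0)) * (s.map t).prod ∈ I ^ (s.card + 1) := by
      rw [pow_succ']
      exact Ideal.mul_mem_mul (hDt j) (prod_map_mem_pow I t ht s)
    have h₂ := Ideal.mul_mem_mul (ht j) ih
    rw [← pow_succ'] at h₂
    rw [Multiset.card_cons]
    convert Ideal.add_mem _ h₁ h₂ using 1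
    rw [Multiset.map_cons, Multiset.prod_cons, hD]
    by_cases hij : i = j
    · subst hij
      rw [Multiset.count_cons_self, Multiset.erase_cons_head, if_pos rfl]
      by_cases hs : i ∈ s
      · have : (s.map t).prod = t i * ((s.erase i).map t).prod := by
          conv_lhs => rw [← Multiset.cons_erase hs, Multiset.map_cons, Multiset.prod_cons]
        simp only [nsmul_eq_mul, Nat.cast_add, Nat.cast_one]
        linear_combination (-(s.count i : A)) * this
      · rw [Multiset.count_eq_zero_of_notMem hs]
        simp only [zero_smul]
        ring
    · rw [Multiset.count_cons_of_ne hij, if_neg hij]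
      by_cases hs : i ∈ s
      · rw [Multiset.erase_cons_tail s (Ne.symm hij), Multiset.map_cons, Multiset.prod_cons]
        simp only [nsmul_eq_mul]
        ring
      · rw [Multiset.count_eq_zero_of_notMem hs]
        simp only [zero_smul]
        ring

variable {L : Type u} [LieRing L] [LieAlgebra ℂ L] {ι : Type*} (X : ι → L)
  (D : L →ₗ⁅ℂ⁆ Module.End ℂ A) (hD : ∀ x f g, D x (f * g) = D x f * g + f * D x g)
  (p : A →ₐ[ℂ] ℂ) (t : ι → A) (ht : ∀ i, p (t i) = 0)

include hD

theorem lift_mon_mem_pow (I : Ideal A) (l : List ι) (k : ℕ) {f : A} (hf : f ∈ I ^ (l.length + k)) :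
    UniversalEnvelopingAlgebra.lift ℂ D (mon X l) f ∈ I ^ k := by
  induction l generalizing k with
  | nil => simpa using hf
  | cons i l ih =>
    rw [mon_cons, map_mul, Module.End.mul_apply, UniversalEnvelopingAlgebra.lift_ι_apply]
    refine leibniz_mem_pow I (D (X i)) (hD (X i)) k (ih (k + 1) ?_)
    convert hf using 2
    simp only [List.length_cons]; omega

include ht

/-- The product vanishes to order `s.card` at the point `p`, and fewer derivations than that cannot
make its value nonzero. -/
theorem eval_lift_mon_eq_zero {l : List ι} {s : Multiset ι} (h : l.length < s.card) :
    p (UniversalEnvelopingAlgebra.lift ℂ D (mon X l) (s.map t).prod) = 0 := by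
  have h₁ := prod_map_mem_pow (RingHom.ker p) t ht s
  have h₂ := lift_mon_mem_pow X D hD (RingHom.ker p) l 1 (Ideal.pow_le_pow_right h h₁)
  rwa [pow_one] at h₂

variable [DecidableEq ι] (hX : ∀ i j, p (D (X i) (t j)) = if i = j then 1 else 0)

include hX

/-- In equal degree, monomials in the vector fields and monomials in the coordinates are dual up to
factorials of multiplicities, which are nonzero in `ℂ`. The rightmost factor acts first and removes
one coordinate; the Leibniz error still vanishes at `p` after the remaining derivations. -/
theorem eval_lift_mon_of_length_eq (l : List ι) (s : Multiset ι) (h : l.length = s.card) :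
    ((l : Multiset ι) = s → p (UniversalEnvelopingAlgebra.lift ℂ D (mon X l) (s.map t).prod) ≠ 0) ∧
    ((l : Multiset ι) ≠ s →
      p (UniversalEnvelopingAlgebra.lift ℂ D (mon X l) (s.map t).prod) = 0) := by
  induction l using List.reverseRecOn generalizing s with
  | nil =>
    have : s = 0 := Multiset.card_eq_zero.1 h.symm
    subst this
    simp
  | append_singleton l i ih =>
    have hlen : l.length + 1 = s.card := by simpa using h
    have hdiff := leibniz_prod_sub_mem (RingHom.ker p) t ht (D (X i)) (hD (X i)) i
      (fun j => by
        rw [RingHom.mem_ker, map_sub, hX]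
        split_ifs <;> simp) s
    rw [← hlen] at hdiff
    have h₀ := lift_mon_mem_pow X D hD (RingHom.ker p) l 1 hdiff
    rw [pow_one, RingHom.mem_ker, map_sub, map_sub, map_nsmul, map_nsmul, sub_eq_zero] at h₀
    have key : p (UniversalEnvelopingAlgebra.lift ℂ D (mon X (l ++ [i])) (s.map t).prod) =
        s.count i •
          p (UniversalEnvelopingAlgebra.lift ℂ D (mon X l) ((s.erase i).map t).prod) := by
      rw [← h₀, mon_append, map_mul, Module.End.mul_apply, mon_cons, mon_nil, mul_one,
        UniversalEnvelopingAlgebra.lift_ι_apply]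
    rw [key]
    by_cases hs : i ∈ s
    · obtain ⟨h₁, h₂⟩ := ih (s.erase i) (by rw [Multiset.card_erase_of_mem hs, ← hlen]; rfl)
      have hiff : ((l ++ [i] : List ι) : Multiset ι) = s ↔ (l : Multiset ι) = s.erase i := by
        conv_lhs => rw [← Multiset.cons_erase hs]
        rw [← Multiset.coe_add, add_comm, Multiset.coe_singleton, Multiset.singleton_add,
          Multiset.cons_inj_right]
      refine ⟨fun h => ?_, fun h => by rw [h₂ fun h' => h (hiff.2 h'), smul_zero]⟩
      rw [nsmul_eq_mul]
      exact mul_ne_zero (Nat.cast_ne_zero.2 (Multiset.count_ne_zero.2 hs)) (h₁ (hiff.1 h))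
    · refine ⟨fun h => absurd ?_ hs, fun _ => ?_⟩
      · rw [← h]; simp
      · rw [Multiset.count_eq_zero_of_notMem hs, zero_smul]

/-- In a relation, take a monomial `s` of maximal degree, apply the relation to the product of
coordinates over `s` and evaluate at `p`. Shorter monomials and other monomials of the same degree
give zero, so the coefficient of `s` vanishes. -/
theorem linearIndependent_mon_comp_of_derivation (ℓ : Multiset ι → List ι)
    (hℓ : ∀ s, (ℓ s : Multiset ι) = s) : LinearIndependent ℂ (mon X ∘ ℓ) := by
  have hlen : ∀ s, (ℓ s).length = s.card := fun s => by
    conv_rhs => rw [← hℓ s, Multiset.coe_card]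
  rw [linearIndependent_iff]
  intro c hc
  by_contra hne
  obtain ⟨s, hs, hmax⟩ := c.support.exists_max_image Multiset.card
    (Finsupp.support_nonempty_iff.2 hne)
  have h₀ := congrArg
    (fun a => p (UniversalEnvelopingAlgebra.lift ℂ D a (s.map t).prod)) hc
  simp only [map_zero, LinearMap.zero_apply] at h₀
  rw [Finsupp.linearCombination_apply, Finsupp.sum, map_sum, LinearMap.sum_apply, map_sum,
    Finset.sum_eq_single s] at h₀
  · rw [map_smul, LinearMap.smul_apply, map_smul, smul_eq_mul, mul_eq_zero] at h₀
    exact h₀.elim (Finsupp.mem_support_iff.1 hs)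
      ((eval_lift_mon_of_length_eq X D hD p t ht hX (ℓ s) s (hlen s)).1 (hℓ s))
  · intro s' hs' hss'
    rw [map_smul, LinearMap.smul_apply, map_smul]
    rcases (hmax s' hs').lt_or_eq with h | h
    · rw [Function.comp_apply, eval_lift_mon_eq_zero X D hD p t ht (by rwa [hlen]), smul_zero]
    · rw [Function.comp_apply, (eval_lift_mon_of_length_eq X D hD p t ht hX (ℓ s') s
        (by rw [hlen, h])).2 (by rwa [hℓ]), smul_zero]
  · exact fun h => absurd hs h

end PBWIndependence

/-! ### Left invariant vector fields and PBW for matrix Lie algebras. -/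

section PBWMatrix

variable {L : Type u} [LieRing L] [LieAlgebra ℂ L] {κ : Type*} [Fintype κ] [DecidableEq κ]

/-- The left invariant vector field of a matrix, acting on polynomials in the matrix entries. -/
def matrixField (a : Matrix κ κ ℂ) :
    Derivation ℂ (MvPolynomial (κ × κ) ℂ) (MvPolynomial (κ × κ) ℂ) :=
  MvPolynomial.mkDerivation ℂ fun ij => ∑ k, MvPolynomial.C (a k ij.2) * MvPolynomial.X (ij.1, k)

omit [DecidableEq κ] in
theorem matrixField_X (a : Matrix κ κ ℂ) (i j : κ) :
    matrixField a (MvPolynomial.X (i, j)) =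
      ∑ k, MvPolynomial.C (a k j) * MvPolynomial.X (i, k) := by
  rw [matrixField, MvPolynomial.mkDerivation_X]

omit [DecidableEq κ] in
theorem matrixField_matrixField_X (a c : Matrix κ κ ℂ) (i j : κ) :
    matrixField a (matrixField c (MvPolynomial.X (i, j))) =
      matrixField (a * c) (MvPolynomial.X (i, j)) := by
  rw [matrixField_X, map_sum]
  simp only [← MvPolynomial.smul_eq_C_mul, Derivation.map_smul, matrixField_X, Finset.smul_sum,
    smul_smul]
  rw [Finset.sum_comm]
  refine Finset.sum_congr rfl fun k _ => ?_
  rw [← Finset.sum_smul, Matrix.mul_apply]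
  simp only [mul_comm]

/-- Left invariant vector fields, as a representation by derivations. -/
def matrixFieldHom : Matrix κ κ ℂ →ₗ⁅ℂ⁆ Module.End ℂ (MvPolynomial (κ × κ) ℂ) where
  toFun a := (matrixField a).toLinearMap
  map_add' a c := by
    rw [← Derivation.coe_add_linearMap]
    congr 1
    refine MvPolynomial.derivation_ext fun ⟨i, j⟩ => ?_
    rw [Derivation.add_apply]
    simp only [matrixField_X, Matrix.add_apply, map_add, add_mul, Finset.sum_add_distrib]
  map_smul' r a := by
    rw [RingHom.id_apply, ← Derivation.coe_smul_linearMap]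
    congr 1
    refine MvPolynomial.derivation_ext fun ⟨i, j⟩ => ?_
    rw [Derivation.smul_apply]
    simp only [matrixField_X, Matrix.smul_apply, smul_eq_mul, map_mul, Finset.smul_sum,
      MvPolynomial.smul_eq_C_mul, mul_assoc]
  map_lie' {a c} := by
    rw [← Derivation.commutator_coe_linear_map]
    congr 1
    refine MvPolynomial.derivation_ext fun ⟨i, j⟩ => ?_
    rw [Derivation.commutator_apply, matrixField_matrixField_X, matrixField_matrixField_X,
      LieRing.of_associative_ring_bracket]
    simp only [matrixField_X, Matrix.sub_apply, map_sub, sub_mul, Finset.sum_sub_distrib]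

/-- The linear independence half of the PBW theorem, for Lie algebras with a faithful
finite-dimensional representation and an arbitrary choice of orderings `s ↦ ℓ s`. -/
theorem linearIndependent_mon_comp (ρ : L →ₗ⁅ℂ⁆ Matrix κ κ ℂ) (hρ : Function.Injective ρ)
    {ι : Type*} (X : Module.Basis ι ℂ L) (ℓ : Multiset ι → List ι)
    (hℓ : ∀ s, (ℓ s : Multiset ι) = s) : LinearIndependent ℂ (mon X ∘ ℓ) := by
  classical
  obtain ⟨σ, hσ⟩ := (ρ : L →ₗ[ℂ] Matrix κ κ ℂ).exists_leftInverse_of_injective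
    (LinearMap.ker_eq_bot.2 hρ)
  have hσ' : ∀ x, σ (ρ x) = x := fun x => LinearMap.congr_fun hσ x
  -- `p` evaluates at the identity matrix, and `t m` is the function sending a matrix `g` to the
  -- `m`-th coordinate of `σ (g - 1)`. These functions vanish at the identity, and there the left
  -- invariant field of `ρ (X m)` differentiates them to Kronecker deltas because `σ` is a left
  -- inverse of `ρ`.
  let p : MvPolynomial (κ × κ) ℂ →ₐ[ℂ] ℂ :=
    MvPolynomial.aeval fun ij => if ij.1 = ij.2 then 1 else 0
  let t : ι → MvPolynomial (κ × κ) ℂ := fun m =>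
    ∑ i, ∑ j, X.coord m (σ (Matrix.single i j 1)) •
      (MvPolynomial.X (i, j) - MvPolynomial.C (if i = j then 1 else 0))
  refine linearIndependent_mon_comp_of_derivation X (matrixFieldHom.comp ρ)
    (fun x f g => ?_) p t (fun m => ?_) (fun m n => ?_) ℓ hℓ
  · change matrixField (ρ x) (f * g) = matrixField (ρ x) f * g + f * matrixField (ρ x) g
    rw [Derivation.leibniz, smul_eq_mul, smul_eq_mul]
    ring
  · simp [t, p]
  · change p (matrixField (ρ (X m)) (t n)) = _
    have h₁ : ∀ i j, p (matrixField (ρ (X m)) (MvPolynomial.X (i, j) -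
        MvPolynomial.C (if i = j then 1 else 0))) = ρ (X m) i j := fun i j => by
      rw [map_sub, ← MvPolynomial.algebraMap_eq, Derivation.map_algebraMap, sub_zero,
        matrixField_X]
      simp [p]
    simp only [t, map_sum, Derivation.map_smul, map_smul, h₁]
    have h₂ : (∑ i, ∑ j, ρ (X m) i j • Matrix.single i j (1 : ℂ)) = ρ (X m) := by
      conv_rhs => rw [Matrix.matrix_eq_sum_single (ρ (X m))]
      simp [Matrix.smul_single]
    have h₃ := congrArg (fun a => X.coord n (σ a)) h₂
    simp only [map_sum, map_smul, hσ'] at h₃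
    simp only [smul_eq_mul] at h₃ ⊢
    simp only [mul_comm (X.coord n _), h₃]
    rw [Module.Basis.coord_apply, Module.Basis.repr_self, Finsupp.single_apply]

end PBWMatrix


/-! ### Root vectors and the triangular decomposition -/

section RootVectors

variable {𝔤 : Type u} [LieRing 𝔤] [LieAlgebra ℂ 𝔤] [FiniteDimensional ℂ 𝔤]
  [LieAlgebra.IsSemisimple ℂ 𝔤] {H : LieSubalgebra ℂ 𝔤} [H.IsCartanSubalgebra]

open LieAlgebra LieAlgebra.IsKilling

/-- A nonzero vector in the root space of `α`. -/
def rootVec (α : H.root) : 𝔤 := (LieModule.Weight.exists_ne_zero α.1).choose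

omit [IsSemisimple ℂ 𝔤] in
theorem rootVec_mem (α : H.root) : rootVec α ∈ rootSpace H α.1 :=
  (LieModule.Weight.exists_ne_zero α.1).choose_spec.1

omit [IsSemisimple ℂ 𝔤] in
theorem rootVec_ne_zero (α : H.root) : rootVec α ≠ 0 :=
  (LieModule.Weight.exists_ne_zero α.1).choose_spec.2

theorem rootSpace_eq_span (α : H.root) :
    (rootSpace H α.1).toSubmodule = Submodule.span ℂ {rootVec α} := by
  refine le_antisymm (fun x hx => ?_) ?_
  · have h := finrank_rootSpace_eq_one α.1 (LieSubalgebra.isNonZero_coe_root α)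
    obtain ⟨c, hc⟩ := (finrank_eq_one_iff_of_nonzero' (⟨rootVec α, rootVec_mem α⟩ : rootSpace H α.1)
      (fun h => rootVec_ne_zero α (congrArg Subtype.val h))).1 h ⟨x, hx⟩
    exact Submodule.mem_span_singleton.2 ⟨c, congrArg Subtype.val hc⟩
  · rw [Submodule.span_singleton_le_iff_mem]
    exact rootVec_mem α

theorem lie_rootVec (h : H) (α : H.root) : ⁅(h : 𝔤), rootVec α⁆ = α.1 h • rootVec α :=
  lie_eq_smul_of_mem_rootSpace (rootVec_mem α) h

/-- The root `-α`. -/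
def negRoot (α : H.root) : H.root := (rootSystem H).reflectionPerm α α

theorem root_negRoot (α : H.root) : (rootSystem H).root (negRoot α) = -(rootSystem H).root α := by
  rw [negRoot, RootPairing.root_reflectionPerm, RootPairing.reflection_apply_self]

theorem negRoot_apply (α : H.root) (h : H) : (negRoot α).1 h = -α.1 h :=
  LinearMap.congr_fun (root_negRoot α) h

theorem coe_negRoot (α : H.root) : ⇑(negRoot α).1 = -⇑α.1 := funext (negRoot_apply α)

theorem negRoot_negRoot (α : H.root) : negRoot (negRoot α) = α := by
  apply (rootSystem H).root.injective
  rw [root_negRoot, root_negRoot, neg_neg]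

/-- The span of the root vectors is already a subalgebra. The bracket for `α` and `β` lies in the
weight space of `α + β`: either it is zero, or `α + β` is a root, which `hT` puts in `T`. The
assumption `hT₀` keeps the bracket from landing in the Cartan subalgebra. -/
theorem lieSpan_rootSpace_eq_span (T : Set H.root)
    (hT₀ : ∀ α ∈ T, ∀ β ∈ T, (rootSystem H).root α + (rootSystem H).root β ≠ 0)
    (hT : ∀ α ∈ T, ∀ β ∈ T, ∀ γ, (rootSystem H).root γ =
      (rootSystem H).root α + (rootSystem H).root β → γ ∈ T) :
    (LieSubalgebra.lieSpan ℂ 𝔤 {x | ∃ α ∈ T, x ∈ rootSpace H α.1}).toSubmodule =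
      Submodule.span ℂ (rootVec '' T) := by
  refine le_antisymm ?_ ?_
  · let K : LieSubalgebra ℂ 𝔤 :=
      { Submodule.span ℂ (rootVec '' T) with
        lie_mem' := fun {x y} hx hy => by
          change ⁅x, y⁆ ∈ Submodule.span ℂ (rootVec '' T)
          induction hx, hy using Submodule.span_induction₂ with
          | mem_mem x y hx hy =>
            obtain ⟨α, hα, rfl⟩ := hx
            obtain ⟨β, hβ, rfl⟩ := hy
            have hmem : ⁅rootVec α, rootVec β⁆ ∈ rootSpace H (⇑α.1 + ⇑β.1) :=
              lie_mem_genWeightSpace_of_mem_genWeightSpace (rootVec_mem α) (rootVec_mem β)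
            by_cases hz : ⁅rootVec α, rootVec β⁆ = 0
            · rw [hz]; exact Submodule.zero_mem _
            · have hbot : LieModule.genWeightSpace 𝔤 (⇑α.1 + ⇑β.1) ≠ ⊥ := fun h => by
                rw [rootSpace, h] at hmem
                exact hz hmem
              let γ : LieModule.Weight ℂ H 𝔤 := ⟨⇑α.1 + ⇑β.1, hbot⟩
              have hγ : γ ∈ H.root := by
                rw [LieSubalgebra.root, Finset.mem_filter]
                refine ⟨Finset.mem_univ _, fun h0 => hT₀ α hα β hβ ?_⟩
                ext x
                exact congrFun h0 x
              have hγT : (⟨γ, hγ⟩ : H.root) ∈ T := hT α hα β hβ ⟨γ, hγ⟩ (by ext x; rfl)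
              have := rootSpace_eq_span (⟨γ, hγ⟩ : H.root)
              have hm : ⁅rootVec α, rootVec β⁆ ∈ (rootSpace H γ).toSubmodule := hmem
              rw [this] at hm
              exact Submodule.span_mono (Set.singleton_subset_iff.2
                (Set.mem_image_of_mem rootVec hγT)) hm
          | zero_left y hy => rw [zero_lie]; exact Submodule.zero_mem _
          | zero_right x hx => rw [lie_zero]; exact Submodule.zero_mem _
          | add_left x y z _ _ _ h₁ h₂ => rw [add_lie]; exact Submodule.add_mem _ h₁ h₂
          | add_right x y z _ _ _ h₁ h₂ => rw [lie_add]; exact Submodule.add_mem _ h₁ h₂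
          | smul_left c x y _ _ h => rw [smul_lie]; exact Submodule.smul_mem _ _ h
          | smul_right c x y _ _ h => rw [lie_smul]; exact Submodule.smul_mem _ _ h }
    have : LieSubalgebra.lieSpan ℂ 𝔤 {x | ∃ α ∈ T, x ∈ rootSpace H α.1} ≤ K := by
      rw [LieSubalgebra.lieSpan_le]
      rintro x ⟨α, hα, hx⟩
      change x ∈ Submodule.span ℂ (rootVec '' T)
      have hx' : x ∈ (rootSpace H α.1).toSubmodule := hx
      rw [rootSpace_eq_span] at hx'
      exact Submodule.span_mono (Set.singleton_subset_iff.2 (Set.mem_image_of_mem rootVec hα)) hx'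
    exact this
  · rw [Submodule.span_le]
    rintro _ ⟨α, hα, rfl⟩
    exact LieSubalgebra.subset_lieSpan ⟨α, hα, rootVec_mem α⟩

variable (b : (rootSystem H).Base)

/-- The positive roots. -/
def PosRoot : Type _ := {α : H.root // b.IsPos α}

instance : Finite (PosRoot b) := inferInstanceAs (Finite {α : H.root // b.IsPos α})

instance : Fintype (PosRoot b) := Fintype.ofFinite _

variable {b}

/-- A positive root as an element of `𝔥*`. -/
def posWt (α : PosRoot b) : Module.Dual ℂ H := (rootSystem H).root α.1

theorem isPos_negRoot_iff (α : H.root) : b.IsPos (negRoot α) ↔ ¬ b.IsPos α :=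
  RootPairing.Base.IsPos.neg_iff_not b α

theorem not_isPos_add_eq_zero {α β : H.root} (hα : b.IsPos α) (hβ : b.IsPos β) :
    (rootSystem H).root α + (rootSystem H).root β ≠ 0 := fun h => by
  have : β = negRoot α := by
    apply (rootSystem H).root.injective
    rw [root_negRoot]
    exact (neg_eq_of_add_eq_zero_right h).symm
  exact (isPos_negRoot_iff α).1 (this ▸ hβ) hα

/-- A root vector of a positive root, as an element of `𝔫₊`. -/
def eVec (α : PosRoot b) : nPlus b :=
  ⟨rootVec α.1, LieSubalgebra.subset_lieSpan ⟨α.1, α.2, rootVec_mem α.1⟩⟩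

/-- A root vector of a negative root, as an element of `𝔫₋`. -/
def fVec (α : PosRoot b) : nMinus b :=
  ⟨rootVec (negRoot α.1), LieSubalgebra.subset_lieSpan
    ⟨α.1, α.2, by rw [← coe_negRoot]; exact rootVec_mem (negRoot α.1)⟩⟩

theorem lie_eVec (h : H) (α : PosRoot b) :
    ⁅(h : 𝔤), (eVec α : 𝔤)⁆ = posWt α h • (eVec α : 𝔤) := lie_rootVec h α.1

theorem lie_fVec (h : H) (α : PosRoot b) :
    ⁅(h : 𝔤), (fVec α : 𝔤)⁆ = -posWt α h • (fVec α : 𝔤) := by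
  change ⁅(h : 𝔤), rootVec (negRoot α.1)⁆ = _
  rw [lie_rootVec, negRoot_apply]
  rfl

omit [FiniteDimensional ℂ 𝔤] [IsSemisimple ℂ 𝔤] in
theorem span_subtype_eq_top {K : LieSubalgebra ℂ 𝔤} {ι : Type*} (v : ι → K)
    (h : K.toSubmodule ≤ Submodule.span ℂ (Set.range fun i => (v i : 𝔤))) :
    Submodule.span ℂ (Set.range v) = ⊤ := by
  rw [eq_top_iff]
  rintro ⟨x, hx⟩ -
  have h₁ := h hx
  have h₂ : (Set.range fun i => (v i : 𝔤)) = K.toSubmodule.subtype '' Set.range v := by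
    rw [← Set.range_comp]; rfl
  rw [h₂, ← Submodule.map_span] at h₁
  obtain ⟨y, hy, hyx⟩ := h₁
  have : y = ⟨x, hx⟩ := Subtype.ext hyx
  exact this ▸ hy

theorem span_eVec : Submodule.span ℂ (Set.range (eVec (b := b))) = ⊤ := by
  apply span_subtype_eq_top
  have := lieSpan_rootSpace_eq_span {α | b.IsPos α} (fun α hα β hβ => not_isPos_add_eq_zero hα hβ)
    (fun α hα β hβ γ h => RootPairing.Base.IsPos.add hα hβ h)
  change (nPlus b).toSubmodule = _ at this
  rw [this, Submodule.span_le]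
  rintro _ ⟨α, hα, rfl⟩
  exact Submodule.subset_span ⟨⟨α, hα⟩, rfl⟩

theorem span_fVec : Submodule.span ℂ (Set.range (fVec (b := b))) = ⊤ := by
  apply span_subtype_eq_top
  have := lieSpan_rootSpace_eq_span {α | b.IsPos (negRoot α)}
    (fun α hα β hβ h => not_isPos_add_eq_zero hα hβ (by
      rw [root_negRoot, root_negRoot, ← neg_add, h, neg_zero]))
    (fun α hα β hβ γ h => RootPairing.Base.IsPos.add hα hβ (by
      rw [root_negRoot, root_negRoot, root_negRoot, h, neg_add]))
  have hset : {x : 𝔤 | ∃ α ∈ {α | b.IsPos (negRoot α)}, x ∈ rootSpace H α.1} =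
      {x | ∃ α : H.root, b.IsPos α ∧ x ∈ rootSpace H (-⇑α.1)} := by
    ext x
    constructor
    · rintro ⟨α, hα, hx⟩
      refine ⟨negRoot α, hα, ?_⟩
      rwa [← coe_negRoot, negRoot_negRoot]
    · rintro ⟨α, hα, hx⟩
      refine ⟨negRoot α, ?_, ?_⟩
      · rwa [Set.mem_ofPred_eq, negRoot_negRoot]
      · rwa [coe_negRoot]
  rw [hset] at this
  change (nMinus b).toSubmodule = _ at this
  rw [this, Submodule.span_le]
  rintro _ ⟨α, hα, rfl⟩
  refine Submodule.subset_span ⟨⟨negRoot α, hα⟩, ?_⟩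
  change rootVec (negRoot (negRoot α)) = _
  rw [negRoot_negRoot]

/-- The index set of a basis of `𝔤` adapted to the triangular decomposition. -/
abbrev TriIndex (b : (rootSystem H).Base) : Type _ :=
  PosRoot b ⊕ (Fin (Module.finrank ℂ H) ⊕ PosRoot b)

/-- A family of vectors adapted to the triangular decomposition. -/
def triVec : TriIndex b → 𝔤 :=
  Sum.elim (fun α => (fVec α : 𝔤))
    (Sum.elim (fun i => (Module.finBasis ℂ H i : 𝔤)) fun α => (eVec α : 𝔤))

/-- Generalized weight spaces for distinct weights are independent. The positive and negative roots
give pairwise distinct nonzero weights, and the Cartan vectors sit in weight zero, where they are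
independent as a basis of `H`. -/
theorem linearIndependent_triVec : LinearIndependent ℂ (triVec (b := b)) := by
  have hind : iSupIndep fun χ : H → ℂ => (LieModule.genWeightSpace 𝔤 χ).toSubmodule :=
    LieSubmodule.iSupIndep_toSubmodule.2 (LieModule.iSupIndep_genWeightSpace ℂ H 𝔤)
  let g : Fin (Module.finrank ℂ H) ⊕ (PosRoot b ⊕ PosRoot b) → TriIndex b :=
    Sum.elim (fun i => .inr (.inl i)) (Sum.elim .inl fun α => .inr (.inr α))
  -- Regrouping puts the Cartan block first, so that independence reduces to weight zero against all
  -- nonzero weights.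
  let g' : TriIndex b → Fin (Module.finrank ℂ H) ⊕ (PosRoot b ⊕ PosRoot b) :=
    Sum.elim (fun α => .inr (.inl α)) (Sum.elim .inl fun α => .inr (.inr α))
  have hg' : Function.Injective g' := by
    rintro (α | i | α) (β | j | β) h <;> simp_all [g']
  let r : PosRoot b ⊕ PosRoot b → H.root := Sum.elim (fun α => negRoot α.1) fun α => α.1
  have hr : Function.Injective r := by
    rintro (α | α) (β | β) h
    · have h' := congrArg negRoot (show negRoot α.1 = negRoot β.1 from h)
      rw [negRoot_negRoot, negRoot_negRoot] at h'
      exact congrArg Sum.inl (Subtype.ext h')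
    · exact absurd α.2 ((isPos_negRoot_iff α.1).1
        ((show negRoot α.1 = β.1 from h) ▸ β.2))
    · exact absurd β.2 ((isPos_negRoot_iff β.1).1
        ((show α.1 = negRoot β.1 from h) ▸ α.2))
    · exact congrArg Sum.inr (Subtype.ext h)
  have h₁ : LinearIndependent ℂ fun i => (Module.finBasis ℂ H i : 𝔤) :=
    (Module.finBasis ℂ H).linearIndependent.map' H.toSubmodule.subtype
      (Submodule.ker_subtype _)
  have h₂ : LinearIndependent ℂ fun i => rootVec (r i) := by
    refine iSupIndep.linearIndependent
      (p := fun i => (LieModule.genWeightSpace 𝔤 ⇑(r i).1).toSubmodule) (hind.comp ?_)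
      (fun i => rootVec_mem (r i)) (fun i => rootVec_ne_zero (r i))
    intro i j hij
    exact hr (Subtype.ext (DFunLike.coe_injective hij))
  have h₃ : LinearIndependent ℂ
      (Sum.elim (fun i => (Module.finBasis ℂ H i : 𝔤)) fun i => rootVec (r i)) := by
    refine h₁.sum_type h₂ ?_
    refine (hind 0).mono ?_ ?_
    · rw [Submodule.span_le]
      rintro _ ⟨i, rfl⟩
      have : ((Module.finBasis ℂ H i : H) : 𝔤) ∈ H.toLieSubmodule := (Module.finBasis ℂ H i).2
      rw [← rootSpace_zero_eq ℂ 𝔤 H] at this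
      exact this
    · rw [Submodule.span_le]
      rintro _ ⟨i, rfl⟩
      refine Submodule.mem_iSup_of_mem (⇑(r i).1) (Submodule.mem_iSup_of_mem ?_ (rootVec_mem _))
      exact (LieSubalgebra.isNonZero_coe_root (r i))
  have h₄ := h₃.comp g' hg'
  convert h₄ using 1
  funext i
  rcases i with α | i | α <;> rfl

theorem span_triVec : Submodule.span ℂ (Set.range (triVec (b := b))) = ⊤ := by
  rw [eq_top_iff]
  have h := cartan_sup_iSup_rootSpace_eq_top (K := ℂ) H
  have h' : (⊤ : Submodule ℂ 𝔤) = H.toSubmodule ⊔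
      ⨆ α : LieModule.Weight ℂ H 𝔤, ⨆ (_ : α.IsNonZero), (rootSpace H α).toSubmodule := by
    have := congrArg LieSubmodule.toSubmodule h
    simp only [LieSubmodule.sup_toSubmodule, LieSubmodule.iSup_toSubmodule,
      LieSubmodule.top_toSubmodule] at this
    exact this.symm
  rw [h']
  refine sup_le ?_ (iSup_le fun α => iSup_le fun hα => ?_)
  · have h₀ : (⊤ : Submodule ℂ H) ≤ (Submodule.span ℂ (Set.range (triVec (b := b)))).comap
        H.toSubmodule.subtype := by
      rw [← (Module.finBasis ℂ H).span_eq, Submodule.span_le]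
      rintro _ ⟨i, rfl⟩
      exact Submodule.subset_span ⟨.inr (.inl i), rfl⟩
    intro x hx
    exact h₀ (Submodule.mem_top (x := (⟨x, hx⟩ : H)))
  · have hα' : α ∈ H.root := by
      rw [LieSubalgebra.root, Finset.mem_filter]
      exact ⟨Finset.mem_univ _, hα⟩
    rw [rootSpace_eq_span (⟨α, hα'⟩ : H.root), Submodule.span_singleton_le_iff_mem]
    by_cases hp : b.IsPos (⟨α, hα'⟩ : H.root)
    · exact Submodule.subset_span ⟨.inr (.inr ⟨_, hp⟩), rfl⟩
    · rw [← negRoot_negRoot (⟨α, hα'⟩ : H.root), isPos_negRoot_iff, not_not] at hp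
      refine Submodule.subset_span ⟨.inl ⟨_, hp⟩, ?_⟩
      change rootVec (negRoot (negRoot (⟨α, hα'⟩ : H.root))) = _
      rw [negRoot_negRoot]

variable (b) in
/-- A basis of `𝔤` adapted to the triangular decomposition. -/
def triBasis : Module.Basis (TriIndex b) ℂ 𝔤 :=
  Module.Basis.mk linearIndependent_triVec span_triVec.ge

theorem coe_triBasis : ⇑(triBasis b) = triVec (b := b) := Module.Basis.coe_mk _ _

/-! ### Heights -/

variable (b) in
/-- The element of `𝔥` on which all simple roots take the value `1`. -/
def principal : H :=
  (Module.evalEquiv ℂ H).symm (b.toWeightBasis.constr ℂ fun _ => (1 : ℂ))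

theorem simple_principal {i : H.root} (hi : i ∈ b.support) :
    (rootSystem H).root i (principal b) = 1 := by
  rw [principal, Module.apply_evalEquiv_symm_apply, ← b.toWeightBasis_apply ⟨i, hi⟩,
    Module.Basis.constr_basis]

/-- The value at `principal b` is the height: additive, a natural number, and zero only for the zero
weight. It turns comparisons of weights into comparisons of natural numbers. -/
theorem closure_principal {β : Module.Dual ℂ H}
    (hβ : β ∈ AddSubmonoid.closure ((rootSystem H).root '' b.support)) :
    ∃ n : ℕ, β (principal b) = n ∧ (n = 0 → β = 0) := by
  induction hβ using AddSubmonoid.closure_induction with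
  | mem β hβ =>
    obtain ⟨i, hi, rfl⟩ := hβ
    exact ⟨1, by rw [simple_principal hi, Nat.cast_one], fun h => absurd h one_ne_zero⟩
  | zero => exact ⟨0, by simp, fun _ => rfl⟩
  | add β γ _ _ hβ hγ =>
    obtain ⟨m, hm, hm'⟩ := hβ
    obtain ⟨n, hn, hn'⟩ := hγ
    refine ⟨m + n, by rw [LinearMap.add_apply, hm, hn, Nat.cast_add], fun h => ?_⟩
    rw [hm' (by omega), hn' (by omega), add_zero]

theorem QPlus_principal {β : Module.Dual ℂ H} (hβ : β ∈ QPlus b) :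
    ∃ n : ℕ, 0 < n ∧ β (principal b) = n := by
  obtain ⟨n, hn, hn'⟩ := closure_principal hβ.1
  exact ⟨n, Nat.pos_of_ne_zero fun h => hβ.2 (hn' h), hn⟩

theorem posWt_mem_QPlus (α : PosRoot b) : posWt α ∈ QPlus b := by
  obtain ⟨n, f, hf, h, -⟩ := RootPairing.Base.exists_eq_sum_and_forall_sum_mem_of_isPos α.2
  refine ⟨?_, (rootSystem H).ne_zero α.1⟩
  rw [posWt, h]
  exact AddSubmonoid.sum_mem _ fun m _ => AddSubmonoid.subset_closure ⟨f m, hf ⟨m, rfl⟩, rfl⟩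

/-- The weight `∑ α` of a multiset of positive roots. -/
def msWt (s : Multiset (PosRoot b)) : Module.Dual ℂ H := (s.map posWt).sum

@[simp] theorem msWt_zero : msWt (0 : Multiset (PosRoot b)) = 0 := by simp [msWt]

@[simp] theorem msWt_cons (α : PosRoot b) (s : Multiset (PosRoot b)) :
    msWt (α ::ₘ s) = posWt α + msWt s := by simp [msWt]

theorem msWt_principal (s : Multiset (PosRoot b)) :
    ∃ n : ℕ, s.card ≤ n ∧ msWt s (principal b) = n := by
  induction s using Multiset.induction with
  | empty => exact ⟨0, by simp⟩
  | cons α s ih =>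
    obtain ⟨n, hn, hn'⟩ := ih
    obtain ⟨m, hm, hm'⟩ := QPlus_principal (posWt_mem_QPlus α)
    refine ⟨m + n, by rw [Multiset.card_cons]; omega, ?_⟩
    rw [msWt_cons, LinearMap.add_apply, hm', hn', Nat.cast_add]

theorem msWt_mem_closure (s : Multiset (PosRoot b)) :
    msWt s ∈ AddSubmonoid.closure ((rootSystem H).root '' b.support) :=
  AddSubmonoid.multiset_sum_mem _ _ fun x hx => by
    obtain ⟨α, -, rfl⟩ := Multiset.mem_map.1 hx
    exact (posWt_mem_QPlus α).1

theorem msWt_ne_zero {s : Multiset (PosRoot b)} (hs : s ≠ 0) : msWt s ≠ 0 := fun h => by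
  obtain ⟨n, hn, hn'⟩ := msWt_principal s
  rw [h, LinearMap.zero_apply, eq_comm, Nat.cast_eq_zero] at hn'
  exact hs (Multiset.card_eq_zero.1 (by omega))

theorem msWt_mem_QPlus {s : Multiset (PosRoot b)} (hs : s ≠ 0) : msWt s ∈ QPlus b :=
  ⟨msWt_mem_closure s, msWt_ne_zero hs⟩

/-- Every positive root has height at least one, so a bound on the height bounds the cardinality,
and a finite set has finitely many multisets of each size. -/
theorem finite_msWt_principal_le (n : ℕ) :
    {s : Multiset (PosRoot b) | ∃ m : ℕ, m ≤ n ∧ msWt s (principal b) = m}.Finite := by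
  classical
  refine (Set.finite_iUnion (fun k : Fin (n + 1) => Set.finite_range
    (fun s : Sym (PosRoot b) k => (s : Multiset (PosRoot b))))).subset ?_
  rintro s ⟨m, hm, hs⟩
  obtain ⟨k, hk, hk'⟩ := msWt_principal s
  have : m = k := Nat.cast_injective (R := ℂ) (hs.symm.trans hk')
  exact Set.mem_iUnion.2 ⟨⟨s.card, by omega⟩, ⟨⟨s, rfl⟩, rfl⟩⟩

theorem finite_msWt_eq (β : Module.Dual ℂ H) :
    {s : Multiset (PosRoot b) | msWt s = β}.Finite := by
  rcases Set.eq_empty_or_nonempty {s : Multiset (PosRoot b) | msWt s = β} with h | ⟨s₀, hs₀⟩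
  · rw [h]; exact Set.finite_empty
  · obtain ⟨n, -, hn⟩ := msWt_principal s₀
    refine (finite_msWt_principal_le n).subset fun s hs => ⟨n, le_rfl, ?_⟩
    rw [← hn, show msWt s = β from hs, show msWt s₀ = β from hs₀]

end RootVectors

/-! ### Multisets on a sum type -/

section MultisetSum

/-- Multisets on `α ⊕ β` are pairs of multisets. -/
def multisetSumEquiv (α β : Type*) : Multiset (α ⊕ β) ≃ Multiset α × Multiset β where
  toFun s := (s.filterMap Sum.getLeft?, s.filterMap Sum.getRight?)
  invFun p := p.1.map Sum.inl + p.2.map Sum.inr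
  left_inv s := by
    induction s using Multiset.induction with
    | empty => rfl
    | cons x s ih =>
      dsimp only at ih ⊢
      rcases x with x | x
      · rw [Multiset.filterMap_cons_some Sum.getLeft? _ s (b := x) rfl,
          Multiset.filterMap_cons_none (f := Sum.getRight?) _ s rfl, Multiset.map_cons,
          Multiset.cons_add, ih]
      · rw [Multiset.filterMap_cons_none (f := Sum.getLeft?) _ s rfl,
          Multiset.filterMap_cons_some Sum.getRight? _ s (b := x) rfl, Multiset.map_cons,
          Multiset.add_cons, ih]
  right_inv p := by
    have h₁ : ((Sum.getLeft? : α ⊕ β → _) ∘ Sum.inl : α → Option α) = some := rfl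
    have h₂ : ((Sum.getLeft? : α ⊕ β → _) ∘ Sum.inr : β → Option α) = fun _ => none := rfl
    have h₃ : ((Sum.getRight? : α ⊕ β → _) ∘ Sum.inl : α → Option β) = fun _ => none := rfl
    have h₄ : ((Sum.getRight? : α ⊕ β → _) ∘ Sum.inr : β → Option β) = some := rfl
    have h₅ : ∀ s : Multiset α, s.filterMap (fun _ => (none : Option β)) = 0 := fun s => by
      induction s using Multiset.induction with
      | empty => rfl
      | cons x s ih => rw [Multiset.filterMap_cons_none _ _ rfl, ih]
    have h₆ : ∀ s : Multiset β, s.filterMap (fun _ => (none : Option α)) = 0 := fun s => by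
      induction s using Multiset.induction with
      | empty => rfl
      | cons x s ih => rw [Multiset.filterMap_cons_none _ _ rfl, ih]
    refine Prod.ext ?_ ?_
    · simp only [Multiset.filterMap_add, Multiset.filterMap_map, h₁, h₂, h₆,
        Multiset.filterMap_some, add_zero]
    · simp only [Multiset.filterMap_add, Multiset.filterMap_map, h₃, h₄, h₅,
        Multiset.filterMap_some, zero_add]

end MultisetSum

/-! ### The triangular decomposition of the enveloping algebra -/

section Triangular

variable {𝔤 : Type u} [LieRing 𝔤] [LieAlgebra ℂ 𝔤] [FiniteDimensional ℂ 𝔤]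
  [LieAlgebra.IsSemisimple ℂ 𝔤] {H : LieSubalgebra ℂ 𝔤} [H.IsCartanSubalgebra]
  {b : (LieAlgebra.IsKilling.rootSystem H).Base}

/-- The PBW monomials of `U𝔫₋`. -/
def monMinus (s : Multiset (PosRoot b)) : U (nMinus b) := mon fVec s.toList

/-- The PBW monomials of `U𝔫₊`. -/
def monPlus (s : Multiset (PosRoot b)) : U (nPlus b) := mon eVec s.toList

/-- The PBW monomials of `U𝔥`. -/
def monCartan (s : Multiset (Fin (Module.finrank ℂ H))) : U H :=
  mon (Module.finBasis ℂ H) s.toList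

theorem span_monMinus : Submodule.span ℂ (Set.range (monMinus (b := b))) = ⊤ :=
  span_range_mon_comp span_fVec Multiset.toList Multiset.coe_toList

theorem span_monPlus : Submodule.span ℂ (Set.range (monPlus (b := b))) = ⊤ :=
  span_range_mon_comp span_eVec Multiset.toList Multiset.coe_toList

omit [LieAlgebra.IsSemisimple ℂ 𝔤] [H.IsCartanSubalgebra] in
theorem span_monCartan : Submodule.span ℂ (Set.range (monCartan (H := H))) = ⊤ :=
  span_range_mon_comp (Module.finBasis ℂ H).span_eq Multiset.toList Multiset.coe_toList

theorem monMinus_zero : monMinus (0 : Multiset (PosRoot b)) = 1 := by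
  simp [monMinus]

theorem monPlus_zero : monPlus (0 : Multiset (PosRoot b)) = 1 := by
  simp [monPlus]

omit [LieAlgebra.IsSemisimple ℂ 𝔤] [H.IsCartanSubalgebra] in
theorem monCartan_zero : monCartan (H := H) 0 = 1 := by
  simp [monCartan]

theorem counit_mon_cons {L : Type u} [LieRing L] [LieAlgebra ℂ L] {ι : Type*} (X : ι → L)
    (i : ι) (l : List ι) : counit L (mon X (i :: l)) = 0 := by
  rw [mon_cons, map_mul, counit_ι, zero_mul]

theorem counit_monMinus {s : Multiset (PosRoot b)} (hs : s ≠ 0) :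
    counit (nMinus b) (monMinus s) = 0 := by
  obtain ⟨i, l, h⟩ := List.exists_cons_of_ne_nil (mt Multiset.toList_eq_nil.1 hs)
  rw [monMinus, h, counit_mon_cons]

/-- The PBW monomials of `U𝔤`, for a basis adapted to the triangular decomposition. -/
def monTri (p : Multiset (PosRoot b) ×
    (Multiset (Fin (Module.finrank ℂ H)) × Multiset (PosRoot b))) : U 𝔤 :=
  inclU (nMinus b) (monMinus p.1) * (inclU H (monCartan p.2.1) *
    inclU (nPlus b) (monPlus p.2.2))

/-- Triples of multisets as multisets of indices of the adapted basis. -/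
def triIndexEquiv (b : (LieAlgebra.IsKilling.rootSystem H).Base) :
    Multiset (TriIndex b) ≃ Multiset (PosRoot b) ×
      (Multiset (Fin (Module.finrank ℂ H)) × Multiset (PosRoot b)) :=
  (multisetSumEquiv _ _).trans (Equiv.prodCongr (Equiv.refl _) (multisetSumEquiv _ _))

/-- The ordering of the factors of a monomial according to the triangular decomposition. -/
def triOrder (m : Multiset (TriIndex b)) : List (TriIndex b) :=
  (triIndexEquiv b m).1.toList.map Sum.inl ++
    ((triIndexEquiv b m).2.1.toList.map (Sum.inr ∘ Sum.inl) ++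
      (triIndexEquiv b m).2.2.toList.map (Sum.inr ∘ Sum.inr))

theorem coe_triOrder (m : Multiset (TriIndex b)) : (triOrder m : Multiset (TriIndex b)) = m := by
  conv_rhs => rw [← (triIndexEquiv b).symm_apply_apply m]
  simp [triOrder, triIndexEquiv, multisetSumEquiv, ← Multiset.coe_add, ← Multiset.map_coe]

/-- Products of monomials from `𝔫₋`, `𝔥` and `𝔫₊` are ordered monomials of one basis of `𝔤`. This is
how the triangular decomposition of `U 𝔤` becomes an instance of PBW with the ordering `triOrder`.
-/
theorem monTri_comp : monTri ∘ triIndexEquiv b = mon (triBasis b) ∘ triOrder := by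
  funext m
  simp only [Function.comp_apply, monTri, triOrder, mon_append, monMinus, monCartan, monPlus,
    inclU_mon, mon_map, coe_triBasis]
  rfl

omit [LieAlgebra.IsSemisimple ℂ 𝔤] in
-- The adjoint representation is faithful because the radical, hence the centre, is trivial.
theorem exists_faithful_matrix [LieAlgebra.HasTrivialRadical ℂ 𝔤] : ∃ ρ : 𝔤 →ₗ⁅ℂ⁆
    Matrix (Fin (Module.finrank ℂ 𝔤)) (Fin (Module.finrank ℂ 𝔤)) ℂ, Function.Injective ρ := by
  refine ⟨((LinearMap.toMatrixAlgEquiv (Module.finBasis ℂ 𝔤)).toAlgHom.toLieHom).comp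
    (LieAlgebra.ad ℂ 𝔤), ?_⟩
  refine (LinearMap.toMatrixAlgEquiv (Module.finBasis ℂ 𝔤)).injective.comp
    ((LieHom.ker_eq_bot _).1 ?_)
  exact LieAlgebra.ad_ker_eq_bot_of_hasTrivialRadical ℂ 𝔤

theorem linearIndependent_monTri : LinearIndependent ℂ (monTri (b := b)) := by
  obtain ⟨ρ, hρ⟩ := exists_faithful_matrix (𝔤 := 𝔤)
  have := linearIndependent_mon_comp ρ hρ (triBasis b) triOrder coe_triOrder
  rw [← monTri_comp] at this
  exact (linearIndependent_equiv (triIndexEquiv b)).1 this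

theorem span_monTri : Submodule.span ℂ (Set.range (monTri (b := b))) = ⊤ := by
  rw [← (triIndexEquiv b).surjective.range_comp, monTri_comp]
  exact span_range_mon_comp (triBasis b).span_eq triOrder coe_triOrder

variable (b) in
/-- The PBW basis of `U𝔤`. -/
def basisTri : Module.Basis (Multiset (PosRoot b) ×
    (Multiset (Fin (Module.finrank ℂ H)) × Multiset (PosRoot b))) ℂ (U 𝔤) :=
  Module.Basis.mk linearIndependent_monTri span_monTri.ge

/-- A subfamily of the PBW basis of `U 𝔤`. Independence after mapping to `U 𝔤` yields both a basis
of `U𝔫₋` and the injectivity of `inclU`. -/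
theorem linearIndependent_inclU_monMinus :
    LinearIndependent ℂ fun s => inclU (nMinus b) (monMinus s) := by
  have := linearIndependent_monTri.comp
    (fun s : Multiset (PosRoot b) => (s, ((0 : Multiset (Fin (Module.finrank ℂ H))),
      (0 : Multiset (PosRoot b))))) fun s t h => congrArg Prod.fst h
  convert this using 1
  funext s
  simp [monTri, monCartan_zero, monPlus_zero]

theorem linearIndependent_inclU_monPlus :
    LinearIndependent ℂ fun s => inclU (nPlus b) (monPlus s) := by
  have := linearIndependent_monTri.comp
    (fun s : Multiset (PosRoot b) => ((0 : Multiset (PosRoot b)),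
      ((0 : Multiset (Fin (Module.finrank ℂ H))), s))) fun s t h => congrArg (fun p => p.2.2) h
  convert this using 1
  funext s
  simp [monTri, monCartan_zero, monMinus_zero]

variable (b) in
/-- The PBW basis of `U𝔫₋`. -/
def basisMinus : Module.Basis (Multiset (PosRoot b)) ℂ (U (nMinus b)) :=
  Module.Basis.mk (LinearIndependent.of_comp (inclU (nMinus b)).toLinearMap
    linearIndependent_inclU_monMinus) span_monMinus.ge

variable (b) in
/-- The PBW basis of `U𝔫₊`. -/
def basisPlus : Module.Basis (Multiset (PosRoot b)) ℂ (U (nPlus b)) :=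
  Module.Basis.mk (LinearIndependent.of_comp (inclU (nPlus b)).toLinearMap
    linearIndependent_inclU_monPlus) span_monPlus.ge

theorem basisMinus_apply (s : Multiset (PosRoot b)) : basisMinus b s = monMinus s :=
  Module.Basis.mk_apply _ _ s

theorem basisPlus_apply (s : Multiset (PosRoot b)) : basisPlus b s = monPlus s :=
  Module.Basis.mk_apply _ _ s

theorem injective_of_linearIndependent_basis {ι V W : Type*} [AddCommGroup V] [Module ℂ V]
    [AddCommGroup W] [Module ℂ W] (B : Module.Basis ι ℂ V) (f : V →ₗ[ℂ] W)
    (h : LinearIndependent ℂ fun i => f (B i)) : Function.Injective f := by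
  rw [← LinearMap.ker_eq_bot, LinearMap.ker_eq_bot']
  intro v hv
  rw [← B.linearCombination_repr v, Finsupp.linearCombination_apply, map_finsuppSum] at hv
  simp only [map_smul] at hv
  have := (linearIndependent_iff.1 h) (B.repr v) hv
  exact B.repr.map_eq_zero_iff.1 this

theorem inclU_nMinus_injective : Function.Injective (inclU (nMinus b)) := by
  refine injective_of_linearIndependent_basis (basisMinus b) (inclU (nMinus b)).toLinearMap ?_
  simp only [basisMinus_apply]
  exact linearIndependent_inclU_monMinus

theorem inclU_nPlus_injective : Function.Injective (inclU (nPlus b)) := by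
  refine injective_of_linearIndependent_basis (basisPlus b) (inclU (nPlus b)).toLinearMap ?_
  simp only [basisPlus_apply]
  exact linearIndependent_inclU_monPlus

/-! ### Verma modules are free over `U𝔫₋` -/

theorem evalCartan_ι (lam : Module.Dual ℂ H) (h : H) :
    evalCartan lam (UniversalEnvelopingAlgebra.ι ℂ h) = lam h := by
  rw [evalCartan, UniversalEnvelopingAlgebra.lift_ι_apply]; rfl

variable (b)

/-- The projection `U𝔤 → U𝔫₋`, `y z x ↦ z(lam) ε(x) y` for `y ∈ U𝔫₋`, `z ∈ U𝔥`, `x ∈ U𝔫₊`. -/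
def vermaProj (lam : Module.Dual ℂ H) : U 𝔤 →ₗ[ℂ] U (nMinus b) :=
  (basisTri b).constr ℂ fun p =>
    (evalCartan lam (monCartan p.2.1) * counit (nPlus b) (monPlus p.2.2)) • monMinus p.1

variable {b}

theorem tri_hom_ext {W : Type*} [AddCommGroup W] [Module ℂ W] {f g : U 𝔤 →ₗ[ℂ] W}
    (h : ∀ (y : U (nMinus b)) (z : U H) (x : U (nPlus b)),
      f (inclU (nMinus b) y * (inclU H z * inclU (nPlus b) x)) =
        g (inclU (nMinus b) y * (inclU H z * inclU (nPlus b) x))) : f = g := by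
  refine LinearMap.ext_on_range (v := monTri (b := b)) span_monTri fun p => h _ _ _

theorem vermaProj_tri (lam : Module.Dual ℂ H) (y : U (nMinus b)) (z : U H) (x : U (nPlus b)) :
    vermaProj b lam (inclU (nMinus b) y * (inclU H z * inclU (nPlus b) x)) =
      (evalCartan lam z * counit (nPlus b) x) • y := by
  have hx : x ∈ Submodule.span ℂ (Set.range (monPlus (b := b))) :=
    by
    rw [span_monPlus]; exact Submodule.mem_top
  have hy : y ∈ Submodule.span ℂ (Set.range (monMinus (b := b))) :=
    by
    rw [span_monMinus]; exact Submodule.mem_top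
  have hz : z ∈ Submodule.span ℂ (Set.range (monCartan (H := H))) :=
    by
    rw [span_monCartan]; exact Submodule.mem_top
  induction hy using Submodule.span_induction with
  | mem y hy =>
    obtain ⟨s, rfl⟩ := hy
    induction hz using Submodule.span_induction with
    | mem z hz =>
      obtain ⟨t, rfl⟩ := hz
      induction hx using Submodule.span_induction with
      | mem x hx =>
        obtain ⟨r, rfl⟩ := hx
        have : inclU (nMinus b) (monMinus s) * (inclU H (monCartan t) *
            inclU (nPlus b) (monPlus r)) = basisTri b (s, (t, r)) :=
          (Module.Basis.mk_apply linearIndependent_monTri span_monTri.ge (s, (t, r))).symm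
        rw [this, vermaProj, Module.Basis.constr_basis]
      | zero => simp
      | add x x' _ _ h h' => simp only [map_add, mul_add, add_smul, h, h']
      | smul c x _ h =>
        simp only [map_smul, mul_smul_comm, h, smul_smul, smul_eq_mul]
        congr 1; ring
    | zero => simp
    | add z z' _ _ h h' => simp only [map_add, mul_add, add_mul, add_smul, h, h']
    | smul c z _ h =>
      simp only [map_smul, mul_smul_comm, smul_mul_assoc, h, smul_smul, smul_eq_mul, mul_assoc]
  | zero => simp
  | add y y' _ _ h h' => simp only [map_add, add_mul, smul_add, h, h']
  | smul c y _ h =>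
    simp only [map_smul, smul_mul_assoc, h, smul_smul]
    congr 1; ring

theorem vermaProj_inclU_mul (lam : Module.Dual ℂ H) (y : U (nMinus b)) (a : U 𝔤) :
    vermaProj b lam (inclU (nMinus b) y * a) = y * vermaProj b lam a := by
  refine LinearMap.congr_fun (f := vermaProj b lam ∘ₗ LinearMap.mulLeft ℂ (inclU (nMinus b) y))
    (g := LinearMap.mulLeft ℂ y ∘ₗ vermaProj b lam) (tri_hom_ext (b := b) fun y' z x => ?_) a
  simp only [LinearMap.comp_apply, LinearMap.mulLeft_apply]
  rw [← mul_assoc, ← map_mul, vermaProj_tri, vermaProj_tri, mul_smul_comm]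

theorem vermaProj_mul_inclU (lam : Module.Dual ℂ H) (a : U 𝔤) (x : U (nPlus b)) :
    vermaProj b lam (a * inclU (nPlus b) x) = counit (nPlus b) x • vermaProj b lam a := by
  refine LinearMap.congr_fun
    (f := vermaProj b lam ∘ₗ LinearMap.mulRight ℂ (inclU (nPlus b) x))
    (g := counit (nPlus b) x • vermaProj b lam) (tri_hom_ext (b := b) fun y z x' => ?_) a
  simp only [LinearMap.comp_apply, LinearMap.mulRight_apply, LinearMap.smul_apply]
  rw [mul_assoc, mul_assoc, ← map_mul, vermaProj_tri, vermaProj_tri, map_mul, smul_smul]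
  congr 1; ring

omit [FiniteDimensional ℂ 𝔤] [LieAlgebra.IsSemisimple ℂ 𝔤] [H.IsCartanSubalgebra] in
-- Here `x'` is the commutator of `h` with `x`. Since `ad h` preserves `𝔫` it acts on `U𝔫` as a
-- derivation with values in the augmentation ideal. Hence the commutator term drops out wherever
-- only the counit of the `𝔫`-factor matters.
theorem exists_inclU_mul_cartan {𝔫 : LieSubalgebra ℂ 𝔤} (h : H)
    (hn : ∀ x ∈ 𝔫, ⁅(h : 𝔤), x⁆ ∈ 𝔫) (x : U 𝔫) :
    ∃ x' : U 𝔫, counit 𝔫 x' = 0 ∧ UniversalEnvelopingAlgebra.ι ℂ (h : 𝔤) * inclU 𝔫 x =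
      inclU 𝔫 x * UniversalEnvelopingAlgebra.ι ℂ (h : 𝔤) + inclU 𝔫 x' := by
  induction x using enveloping_induction with
  | hc c => exact ⟨0, map_zero _, by rw [AlgHom.commutes, map_zero, add_zero, Algebra.commutes]⟩
  | hι x =>
    refine ⟨UniversalEnvelopingAlgebra.ι ℂ ⟨⁅(h : 𝔤), (x : 𝔤)⁆, hn x x.2⟩, counit_ι _, ?_⟩
    rw [inclU_ι, inclU_ι, LieHom.map_lie, LieRing.of_associative_ring_bracket]
    abel
  | hmul x y hx hy =>
    obtain ⟨x', hx', hx⟩ := hx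
    obtain ⟨y', hy', hy⟩ := hy
    refine ⟨x' * y + x * y', by simp [hx', hy'], ?_⟩
    rw [map_mul, ← mul_assoc, hx, add_mul, mul_assoc, hy, map_add, map_mul, map_mul]
    simp only [mul_add, mul_assoc]
    abel
  | hadd x y hx hy =>
    obtain ⟨x', hx', hx⟩ := hx
    obtain ⟨y', hy', hy⟩ := hy
    refine ⟨x' + y', by simp [hx', hy'], ?_⟩
    rw [map_add, mul_add, hx, hy, map_add]
    simp only [add_mul]
    abel

omit [FiniteDimensional ℂ 𝔤] [LieAlgebra.IsSemisimple ℂ 𝔤] [H.IsCartanSubalgebra] in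
theorem lie_cartan_mem_of_span {𝔫 : LieSubalgebra ℂ 𝔤} {ι : Type*} {v : ι → 𝔫}
    (hv : Submodule.span ℂ (Set.range v) = ⊤) (h : H)
    (c : ι → ℂ) (hc : ∀ i, ⁅(h : 𝔤), (v i : 𝔤)⁆ = c i • (v i : 𝔤)) (x : 𝔤) (hx : x ∈ 𝔫) :
    ⁅(h : 𝔤), x⁆ ∈ 𝔫 := by
  have : (⟨x, hx⟩ : 𝔫) ∈ Submodule.span ℂ (Set.range v) := hv ▸ Submodule.mem_top
  suffices H' : ∀ y : 𝔫, y ∈ Submodule.span ℂ (Set.range v) → ⁅(h : 𝔤), (y : 𝔤)⁆ ∈ 𝔫 from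
    H' _ this
  intro y hy
  induction hy using Submodule.span_induction with
  | mem y hy => obtain ⟨i, rfl⟩ := hy; rw [hc]; exact 𝔫.smul_mem _ (v i).2
  | zero => rw [ZeroMemClass.coe_zero, lie_zero]; exact 𝔫.zero_mem
  | add y z _ _ hy hz => change ⁅(h : 𝔤), (y : 𝔤) + z⁆ ∈ 𝔫; rw [lie_add]; exact 𝔫.add_mem hy hz
  | smul c y _ hy => change ⁅(h : 𝔤), c • (y : 𝔤)⁆ ∈ 𝔫; rw [lie_smul]; exact 𝔫.smul_mem _ hy

theorem lie_cartan_mem_nPlus (h : H) (x : 𝔤) (hx : x ∈ nPlus b) : ⁅(h : 𝔤), x⁆ ∈ nPlus b :=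
  lie_cartan_mem_of_span span_eVec h _ (lie_eVec h) x hx

theorem lie_cartan_mem_nMinus (h : H) (x : 𝔤) (hx : x ∈ nMinus b) : ⁅(h : 𝔤), x⁆ ∈ nMinus b :=
  lie_cartan_mem_of_span span_fVec h _ (lie_fVec h) x hx

theorem vermaProj_mul_cartan (lam : Module.Dual ℂ H) (a : U 𝔤) (h : H) :
    vermaProj b lam (a * UniversalEnvelopingAlgebra.ι ℂ (h : 𝔤)) =
      lam h • vermaProj b lam a := by
  refine LinearMap.congr_fun
    (f := vermaProj b lam ∘ₗ LinearMap.mulRight ℂ (UniversalEnvelopingAlgebra.ι ℂ (h : 𝔤)))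
    (g := lam h • vermaProj b lam) (tri_hom_ext (b := b) fun y z x => ?_) a
  simp only [LinearMap.comp_apply, LinearMap.mulRight_apply, LinearMap.smul_apply]
  obtain ⟨x', hx', hx⟩ := exists_inclU_mul_cartan h (lie_cartan_mem_nPlus (b := b) h) x
  have : inclU (nMinus b) y * (inclU H z * inclU (nPlus b) x) *
      UniversalEnvelopingAlgebra.ι ℂ (h : 𝔤) =
      inclU (nMinus b) y * (inclU H (z * UniversalEnvelopingAlgebra.ι ℂ h) * inclU (nPlus b) x) -
        inclU (nMinus b) y * (inclU H z * inclU (nPlus b) x') := by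
    rw [map_mul, inclU_ι, mul_assoc (inclU H z) (UniversalEnvelopingAlgebra.ι ℂ (h : 𝔤)), hx]
    simp only [mul_add, mul_assoc]
    abel
  rw [this, map_sub, vermaProj_tri, vermaProj_tri, vermaProj_tri, hx', mul_zero, zero_smul,
    sub_zero, map_mul, evalCartan_ι, smul_smul]
  congr 1; ring

theorem vermaProj_eq_zero (lam : Module.Dual ℂ H) {a : U 𝔤} (ha : a ∈ vermaIdeal b lam) :
    vermaProj b lam a = 0 := by
  -- The extra left factor lets the induction pass through multiples of generators of a left ideal.
  suffices h : ∀ u : U 𝔤, vermaProj b lam (u * a) = 0 by simpa using h 1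
  induction ha using Submodule.span_induction with
  | mem a ha =>
    intro u
    rcases ha with ⟨x, hx, rfl⟩ | ⟨h, rfl⟩
    · rw [← inclU_ι (nPlus b) ⟨x, hx⟩, vermaProj_mul_inclU, counit_ι, zero_smul]
    · rw [mul_sub, map_sub, vermaProj_mul_cartan, ← Algebra.commutes, ← Algebra.smul_def,
        map_smul, sub_self]
  | zero => intro u; rw [mul_zero, map_zero]
  | add a c _ _ ha hc => intro u; rw [mul_add, map_add, ha, hc, add_zero]
  | smul v a _ ha => intro u; rw [smul_eq_mul, ← mul_assoc, ha]

variable (b)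

/-- The class in `M(lam)` of an element of `U𝔤`. -/
def vermaMk (lam : Module.Dual ℂ H) : U 𝔤 →ₗ[ℂ] Verma b lam where
  toFun a := Submodule.Quotient.mk (p := vermaIdeal b lam) a
  map_add' _ _ := rfl
  map_smul' _ _ := rfl

/-- The map `M(lam) → U𝔫₋` inverse to `y ↦ y·1_lam`. -/
def vermaLift (lam : Module.Dual ℂ H) : Verma b lam →ₗ[ℂ] U (nMinus b) :=
  ((vermaIdeal b lam).restrictScalars ℂ).liftQ (vermaProj b lam)
    fun _ ha => vermaProj_eq_zero lam ha

variable {b}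
variable {lam : Module.Dual ℂ H}

theorem vermaLift_mk (a : U 𝔤) : vermaLift b lam (vermaMk b lam a) = vermaProj b lam a := rfl

theorem vermaMk_surjective : Function.Surjective (vermaMk b lam) :=
  Submodule.Quotient.mk_surjective _

theorem act_verma (a : U 𝔤) (m : Verma b lam) : act (Verma b lam) a m = a • m := by
  induction a using enveloping_induction generalizing m with
  | hc c => rw [AlgHom.commutes, Module.algebraMap_end_apply, algebraMap_smul]
  | hι x => rw [act_ι]; rfl
  | hmul a c ha hc => rw [map_mul, Module.End.mul_apply, ha, hc, mul_smul]
  | hadd a c ha hc => rw [map_add, LinearMap.add_apply, ha, hc, add_smul]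

theorem act_vermaMk (a c : U 𝔤) :
    act (Verma b lam) a (vermaMk b lam c) = vermaMk b lam (a * c) := act_verma a _

theorem vermaMk_one : vermaMk b lam 1 = vermaOne b lam := rfl

theorem act_vermaOne (a : U 𝔤) : act (Verma b lam) a (vermaOne b lam) = vermaMk b lam a := by
  rw [← vermaMk_one, act_vermaMk, mul_one]

theorem vermaCan_eq (y : U (nMinus b)) :
    vermaCan b lam y = vermaMk b lam (inclU (nMinus b) y) := by
  rw [← act_vermaOne, act_inclU]; rfl

theorem lie_vermaOne_nPlus {x : 𝔤} (hx : x ∈ nPlus b) : ⁅x, vermaOne b lam⁆ = 0 := by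
  rw [← act_ι (L := 𝔤), act_vermaOne]
  exact (Submodule.Quotient.mk_eq_zero _).2 (Submodule.subset_span (Or.inl ⟨x, hx, rfl⟩))

theorem lie_vermaOne_cartan (h : H) :
    ⁅(h : 𝔤), vermaOne b lam⁆ = lam h • vermaOne b lam := by
  rw [← act_ι (L := 𝔤), act_vermaOne, ← vermaMk_one, ← map_smul, ← sub_eq_zero, ← map_sub,
    ← Algebra.algebraMap_eq_smul_one]
  exact (Submodule.Quotient.mk_eq_zero _).2 (Submodule.subset_span (Or.inr ⟨h, rfl⟩))

theorem act_inclU_of_singular {M : Type*} [AddCommGroup M] [Module ℂ M] [LieRingModule 𝔤 M]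
    [LieModule ℂ 𝔤 M] {m : M} (hm : ∀ x ∈ nPlus b, ⁅x, m⁆ = 0) (x : U (nPlus b)) :
    act M (inclU (nPlus b) x) m = counit (nPlus b) x • m := by
  induction x using enveloping_induction with
  | hc c => simp only [AlgHom.commutes, Module.algebraMap_end_apply]; rfl
  | hι x => rw [inclU_ι, act_ι, hm x x.2, counit_ι, zero_smul]
  | hmul a c ha hc =>
    rw [map_mul, map_mul, Module.End.mul_apply, hc, map_smul, ha, smul_smul, map_mul, mul_comm]
  | hadd a c ha hc => rw [map_add, map_add, LinearMap.add_apply, ha, hc, map_add, add_smul]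

theorem act_inclU_of_weight {M : Type*} [AddCommGroup M] [Module ℂ M] [LieRingModule 𝔤 M]
    [LieModule ℂ 𝔤 M] {m : M} {μ : Module.Dual ℂ H} (hm : ∀ h : H, ⁅(h : 𝔤), m⁆ = μ h • m)
    (z : U H) : act M (inclU H z) m = evalCartan μ z • m := by
  induction z using enveloping_induction with
  | hc c => simp only [AlgHom.commutes, Module.algebraMap_end_apply]; rfl
  | hι x => rw [inclU_ι, act_ι, hm x, evalCartan_ι]
  | hmul a c ha hc =>
    rw [map_mul, map_mul, Module.End.mul_apply, hc, map_smul, ha, smul_smul, map_mul, mul_comm]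
  | hadd a c ha hc => rw [map_add, map_add, LinearMap.add_apply, ha, hc, map_add, add_smul]

/-- On a product `y z x` the factor `x` acts on the highest weight vector by the counit and `z` by
evaluation at `lam`, which is how `vermaProj` is defined. Together with `vermaProj_inclU` this makes
`M(lam)` free of rank one over `U𝔫₋`. -/
theorem vermaCan_vermaProj (a : U 𝔤) :
    vermaCan b lam (vermaProj b lam a) = vermaMk b lam a := by
  refine LinearMap.congr_fun (f := vermaCan b lam ∘ₗ vermaProj b lam) (g := vermaMk b lam)
    (tri_hom_ext (b := b) fun y z x => ?_) a
  rw [LinearMap.comp_apply, vermaProj_tri, ← act_vermaOne, map_mul, Module.End.mul_apply, map_mul,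
    Module.End.mul_apply, act_inclU_of_singular fun _ hx => lie_vermaOne_nPlus hx, map_smul,
    map_smul, act_inclU_of_weight lie_vermaOne_cartan, map_smul, map_smul, act_vermaOne, vermaCan_eq,
    smul_smul, mul_comm]

theorem vermaProj_inclU (y : U (nMinus b)) : vermaProj b lam (inclU (nMinus b) y) = y := by
  have := vermaProj_tri lam y 1 1
  simpa using this

variable (b lam) in
/-- The identification of `U𝔫₋` with `M(lam)`. -/
def vermaEquiv : U (nMinus b) ≃ₗ[ℂ] Verma b lam :=
  LinearEquiv.ofLinearMap (vermaCan b lam) (vermaLift b lam)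
    (LinearMap.ext fun m => by
      obtain ⟨a, rfl⟩ := vermaMk_surjective m
      exact vermaCan_vermaProj a)
    (LinearMap.ext fun y => by
      rw [LinearMap.comp_apply, vermaCan_eq, vermaLift_mk, vermaProj_inclU]; rfl)

theorem vermaCan_injective : Function.Injective (vermaCan b lam) := (vermaEquiv b lam).injective

theorem vermaCan_surjective : Function.Surjective (vermaCan b lam) :=
  (vermaEquiv b lam).surjective

theorem vermaCan_mul (y y' : U (nMinus b)) :
    vermaCan b lam (y * y') = act (Verma b lam) (inclU (nMinus b) y) (vermaCan b lam y') := by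
  rw [vermaCan_eq, vermaCan_eq, act_vermaMk, map_mul]

theorem vermaCan_one : vermaCan b lam 1 = vermaOne b lam := by
  rw [vermaCan_eq, map_one, vermaMk_one]

/-! ### The vacuum functional -/

variable (b lam) in
/-- The functional on `M(lam)` that reads off the coefficient of `1_lam`. -/
def vacuum : Verma b lam →ₗ[ℂ] ℂ := (counit (nMinus b)).toLinearMap ∘ₗ vermaLift b lam

theorem vacuum_mk (a : U 𝔤) :
    vacuum b lam (vermaMk b lam a) = counit (nMinus b) (vermaProj b lam a) := rfl

theorem vacuum_vermaCan (y : U (nMinus b)) :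
    vacuum b lam (vermaCan b lam y) = counit (nMinus b) y := by
  rw [vermaCan_eq, vacuum_mk, vermaProj_inclU]

theorem vacuum_one : vacuum b lam (vermaOne b lam) = 1 := by
  rw [← vermaCan_one, vacuum_vermaCan, map_one]

/-- The vacuum functional is invariant under `𝔫₋`, and by `vacuum_lie_cartan` it is an eigenvector
for `𝔥`. By the triangular decomposition only `U𝔫₊` can move it to anything new. -/
theorem vacuum_act_nMinus (y : U (nMinus b)) (m : Verma b lam) :
    vacuum b lam (act (Verma b lam) (inclU (nMinus b) y) m) =
      counit (nMinus b) y * vacuum b lam m := by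
  obtain ⟨a, rfl⟩ := vermaMk_surjective m
  rw [act_vermaMk, vacuum_mk, vermaProj_inclU_mul, map_mul, vacuum_mk]

theorem vacuum_lie_cartan (h : H) (m : Verma b lam) :
    vacuum b lam ⁅(h : 𝔤), m⁆ = lam h * vacuum b lam m := by
  obtain ⟨y, rfl⟩ := vermaCan_surjective m
  obtain ⟨y', hy', hy⟩ := exists_inclU_mul_cartan h (lie_cartan_mem_nMinus (b := b) h) y
  rw [← act_ι (L := 𝔤), vermaCan_eq, act_vermaMk, hy, map_add, map_add, ← vermaCan_eq,
    vacuum_vermaCan, hy', add_zero, ← act_vermaMk, ← act_vermaOne, act_ι, lie_vermaOne_cartan,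
    map_smul, act_vermaOne, map_smul, smul_eq_mul]

theorem vacuum_act_cartan (z : U H) (m : Verma b lam) :
    vacuum b lam (act (Verma b lam) (inclU H z) m) = evalCartan lam z * vacuum b lam m := by
  induction z using enveloping_induction generalizing m with
  | hc c =>
    simp only [AlgHom.commutes, Module.algebraMap_end_apply, map_smul, smul_eq_mul]; rfl
  | hι x => rw [inclU_ι, act_ι, vacuum_lie_cartan, evalCartan_ι]
  | hmul a c ha hc =>
    rw [map_mul, map_mul, Module.End.mul_apply, ha, hc, map_mul, mul_assoc]
  | hadd a c ha hc => simp only [map_add, LinearMap.add_apply, ha, hc, add_mul]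

/-! ### The Harish-Chandra projection -/

theorem vacuum_hcKernel {a : U 𝔤} (ha : a ∈ hcKernel b) :
    vacuum b lam (vermaMk b lam a) = 0 := by
  induction ha using Submodule.span_induction with
  | mem a ha =>
    rcases ha with ⟨y, hy, c, rfl⟩ | ⟨x, hx, c, rfl⟩
    · rw [← act_vermaMk, ← inclU_ι (nMinus b) ⟨y, hy⟩, vacuum_act_nMinus, counit_ι, zero_mul]
    · rw [← act_vermaMk, ← act_vermaOne, act_ι, lie_vermaOne_nPlus hx, map_zero, map_zero]
  | zero => rw [map_zero, map_zero]
  | add a c _ _ ha hc => rw [map_add, map_add, ha, hc, add_zero]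
  | smul r a _ ha => rw [map_smul, map_smul, ha, smul_zero]

theorem inclU_mul_sub_mem_hcKernel (y : U (nMinus b)) (c : U 𝔤) :
    inclU (nMinus b) y * c - counit (nMinus b) y • c ∈ hcKernel b := by
  induction y using enveloping_induction generalizing c with
  | hc r =>
    have : counit (nMinus b) (algebraMap ℂ _ r) = r := AlgHom.commutes _ r
    rw [this, AlgHom.commutes, Algebra.smul_def, sub_self]
    exact Submodule.zero_mem _
  | hι y =>
    rw [inclU_ι, counit_ι, zero_smul, sub_zero]
    exact Submodule.subset_span (Or.inl ⟨y, y.2, c, rfl⟩)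
  | hmul y y' hy hy' =>
    have := Submodule.add_mem _ (hy (inclU (nMinus b) y' * c))
      (Submodule.smul_mem _ (counit (nMinus b) y) (hy' c))
    rw [smul_sub, smul_smul, sub_add_sub_cancel] at this
    rwa [map_mul, map_mul, mul_assoc]
  | hadd y y' hy hy' =>
    rw [map_add, map_add, add_mul, add_smul, add_sub_add_comm]
    exact Submodule.add_mem _ (hy c) (hy' c)

theorem mul_inclU_sub_mem_hcKernel (x : U (nPlus b)) (c : U 𝔤) :
    c * inclU (nPlus b) x - counit (nPlus b) x • c ∈ hcKernel b := by
  induction x using enveloping_induction generalizing c with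
  | hc r =>
    have : counit (nPlus b) (algebraMap ℂ _ r) = r := AlgHom.commutes _ r
    rw [this, AlgHom.commutes, Algebra.smul_def, Algebra.commutes, sub_self]
    exact Submodule.zero_mem _
  | hι x =>
    rw [inclU_ι, counit_ι, zero_smul, sub_zero]
    exact Submodule.subset_span (Or.inr ⟨x, x.2, c, rfl⟩)
  | hmul x x' hx hx' =>
    have := Submodule.add_mem _ (hx' (c * inclU (nPlus b) x))
      (Submodule.smul_mem _ (counit (nPlus b) x') (hx c))
    rw [smul_sub, smul_smul, sub_add_sub_cancel] at this
    rwa [map_mul, map_mul, ← mul_assoc, mul_comm (counit (nPlus b) x)]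
  | hadd x x' hx hx' =>
    rw [map_add, map_add, mul_add, add_smul, add_sub_add_comm]
    exact Submodule.add_mem _ (hx c) (hx' c)

theorem exists_sub_mem_hcKernel (a : U 𝔤) : ∃ z : U H, a - inclU H z ∈ hcKernel b := by
  have ha : a ∈ Submodule.span ℂ (Set.range (monTri (b := b))) := by
    rw [span_monTri]; exact Submodule.mem_top
  induction ha using Submodule.span_induction with
  | mem a ha =>
    obtain ⟨p, rfl⟩ := ha
    refine ⟨(counit (nMinus b) (monMinus p.1) * counit (nPlus b) (monPlus p.2.2)) •
      monCartan p.2.1, ?_⟩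
    have := Submodule.add_mem _ (inclU_mul_sub_mem_hcKernel (monMinus p.1)
      (inclU H (monCartan p.2.1) * inclU (nPlus b) (monPlus p.2.2)))
      (Submodule.smul_mem _ (counit (nMinus b) (monMinus p.1))
        (mul_inclU_sub_mem_hcKernel (monPlus p.2.2) (inclU H (monCartan p.2.1))))
    rwa [smul_sub, smul_smul, sub_add_sub_cancel, ← map_smul] at this
  | zero => exact ⟨0, by rw [map_zero, sub_zero]; exact Submodule.zero_mem _⟩
  | add a c _ _ ha hc =>
    obtain ⟨z, hz⟩ := ha
    obtain ⟨w, hw⟩ := hc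
    exact ⟨z + w, by rw [map_add, add_sub_add_comm]; exact Submodule.add_mem _ hz hw⟩
  | smul r a _ ha =>
    obtain ⟨z, hz⟩ := ha
    exact ⟨r • z, by rw [map_smul, ← smul_sub]; exact Submodule.smul_mem _ _ hz⟩

/-- The part in `𝔫₋ U𝔤` dies against the vacuum functional and the part in `U𝔤 𝔫₊` dies on the
highest weight vector. Any admissible Cartan component therefore evaluates to the same number, and
its uniqueness is not needed. -/
theorem hcEval_eq (a : U 𝔤) : hcEval b lam a = vacuum b lam (vermaMk b lam a) := by
  have h := Classical.epsilon_spec (exists_sub_mem_hcKernel (b := b) a)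
  have h' := vacuum_hcKernel (lam := lam) h
  rw [map_sub, map_sub, sub_eq_zero] at h'
  rw [hcEval, h', ← act_vermaOne, vacuum_act_cartan, vacuum_one, mul_one]

theorem pairing_eq (x : U (nPlus b)) (y : U (nMinus b)) :
    pairing b lam x y = vacuum b lam
      (act (Verma b lam) (antipode 𝔤 (inclU (nPlus b) x)) (vermaCan b lam y)) := by
  rw [pairing, hcEval_eq, vermaCan_eq, act_vermaMk]

end Triangular

/-! ### Weights in enveloping algebras and Verma modules -/

section Weights

variable {𝔤 : Type u} [LieRing 𝔤] [LieAlgebra ℂ 𝔤] [FiniteDimensional ℂ 𝔤]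
  [LieAlgebra.IsSemisimple ℂ 𝔤] {H : LieSubalgebra ℂ 𝔤} [H.IsCartanSubalgebra]

omit [FiniteDimensional ℂ 𝔤] [LieAlgebra.IsSemisimple ℂ 𝔤] [H.IsCartanSubalgebra] in
theorem mem_weightU {𝔫 : LieSubalgebra ℂ 𝔤} {μ : Module.Dual ℂ H} {y : U 𝔫} :
    y ∈ weightU 𝔫 μ ↔ ∀ h : H, UniversalEnvelopingAlgebra.ι ℂ (h : 𝔤) * inclU 𝔫 y -
      inclU 𝔫 y * UniversalEnvelopingAlgebra.ι ℂ (h : 𝔤) = μ h • inclU 𝔫 y := Iff.rfl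

omit [FiniteDimensional ℂ 𝔤] [LieAlgebra.IsSemisimple ℂ 𝔤] [H.IsCartanSubalgebra] in
theorem mul_mem_weightU {𝔫 : LieSubalgebra ℂ 𝔤} {μ ν : Module.Dual ℂ H} {x y : U 𝔫}
    (hx : x ∈ weightU 𝔫 μ) (hy : y ∈ weightU 𝔫 ν) : x * y ∈ weightU 𝔫 (μ + ν) := by
  rw [mem_weightU] at *
  intro h
  have h₁ := congrArg (· * inclU 𝔫 y) (hx h)
  have h₂ := congrArg (inclU 𝔫 x * ·) (hy h)
  simp only [sub_mul, mul_sub, mul_smul_comm, smul_mul_assoc] at h₁ h₂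
  rw [map_mul, LinearMap.add_apply, add_smul, ← h₁, ← h₂]
  simp only [mul_assoc]
  abel

omit [FiniteDimensional ℂ 𝔤] [LieAlgebra.IsSemisimple ℂ 𝔤] [H.IsCartanSubalgebra] in
theorem one_mem_weightU {𝔫 : LieSubalgebra ℂ 𝔤} :
    (1 : U 𝔫) ∈ weightU 𝔫 (0 : Module.Dual ℂ H) := by
  rw [mem_weightU]
  intro h
  rw [map_one, mul_one, one_mul, sub_self, LinearMap.zero_apply, zero_smul]

omit [FiniteDimensional ℂ 𝔤] [LieAlgebra.IsSemisimple ℂ 𝔤] [H.IsCartanSubalgebra] in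
theorem ι_mem_weightU {𝔫 : LieSubalgebra ℂ 𝔤} {μ : Module.Dual ℂ H} {x : 𝔫}
    (hx : ∀ h : H, ⁅(h : 𝔤), (x : 𝔤)⁆ = μ h • (x : 𝔤)) :
    UniversalEnvelopingAlgebra.ι ℂ x ∈ weightU 𝔫 μ := by
  rw [mem_weightU]
  intro h
  rw [inclU_ι, ← LieRing.of_associative_ring_bracket, ← LieHom.map_lie, hx, map_smul]

variable {b : (LieAlgebra.IsKilling.rootSystem H).Base}

theorem monMinus_mem_weightU (s : Multiset (PosRoot b)) :
    monMinus s ∈ weightU (nMinus b) (-msWt s) := by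
  suffices h : ∀ l : List (PosRoot b), mon fVec l ∈ weightU (nMinus b) (-msWt (Multiset.ofList l)) by
    have := h s.toList
    rwa [Multiset.coe_toList] at this
  intro l
  induction l with
  | nil => rw [show Multiset.ofList ([] : List (PosRoot b)) = 0 from rfl, msWt_zero, neg_zero]; exact one_mem_weightU
  | cons α l ih =>
    rw [mon_cons, show Multiset.ofList (α :: l) = α ::ₘ Multiset.ofList l from rfl, msWt_cons, neg_add]
    exact mul_mem_weightU (ι_mem_weightU fun h => lie_fVec h α) ih

theorem monPlus_mem_weightU (s : Multiset (PosRoot b)) :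
    monPlus s ∈ weightU (nPlus b) (msWt s) := by
  suffices h : ∀ l : List (PosRoot b), mon eVec l ∈ weightU (nPlus b) (msWt (Multiset.ofList l)) by
    have := h s.toList
    rwa [Multiset.coe_toList] at this
  intro l
  induction l with
  | nil => rw [show Multiset.ofList ([] : List (PosRoot b)) = 0 from rfl, msWt_zero]; exact one_mem_weightU
  | cons α l ih =>
    rw [mon_cons, show Multiset.ofList (α :: l) = α ::ₘ Multiset.ofList l from rfl, msWt_cons]
    exact mul_mem_weightU (ι_mem_weightU fun h => lie_eVec h α) ih

omit [FiniteDimensional ℂ 𝔤] [LieAlgebra.IsSemisimple ℂ 𝔤] [H.IsCartanSubalgebra] in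
theorem lie_act_of_mem_weightU {𝔫 : LieSubalgebra ℂ 𝔤} {μ ν : Module.Dual ℂ H} {x : U 𝔫}
    (hx : x ∈ weightU 𝔫 μ) {M : Type*} [AddCommGroup M] [Module ℂ M] [LieRingModule 𝔤 M]
    [LieModule ℂ 𝔤 M] {m : M} (hm : ∀ h : H, ⁅(h : 𝔤), m⁆ = ν h • m) (h : H) :
    ⁅(h : 𝔤), act M (inclU 𝔫 x) m⁆ = (μ h + ν h) • act M (inclU 𝔫 x) m := by
  have := congrArg (fun a => act M a m) (sub_eq_iff_eq_add.1 (mem_weightU.1 hx h))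
  simp only [map_mul, map_add, map_smul, LinearMap.add_apply, LinearMap.smul_apply,
    Module.End.mul_apply, act_ι, hm] at this
  rw [this, ← add_smul]

variable {lam : Module.Dual ℂ H}

theorem lie_vermaCan_monMinus (h : H) (s : Multiset (PosRoot b)) :
    ⁅(h : 𝔤), vermaCan b lam (monMinus s)⁆ =
      (lam h - msWt s h) • vermaCan b lam (monMinus s) := by
  rw [vermaCan_eq, ← act_vermaOne,
    lie_act_of_mem_weightU (monMinus_mem_weightU s) lie_vermaOne_cartan]
  congr 1
  rw [LinearMap.neg_apply]; ring

variable (b lam) in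
/-- The PBW basis of `M(lam)`. -/
def basisVerma : Module.Basis (Multiset (PosRoot b)) ℂ (Verma b lam) :=
  (basisMinus b).map (vermaEquiv b lam)

theorem basisVerma_apply (s : Multiset (PosRoot b)) :
    basisVerma b lam s = vermaCan b lam (monMinus s) := by
  rw [basisVerma, Module.Basis.map_apply, basisMinus_apply]; rfl

theorem basisVerma_zero : basisVerma b lam 0 = vermaOne b lam := by
  rw [basisVerma_apply, monMinus_zero, vermaCan_one]

theorem lie_basisVerma (h : H) (s : Multiset (PosRoot b)) :
    ⁅(h : 𝔤), basisVerma b lam s⁆ = (lam h - msWt s h) • basisVerma b lam s := by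
  rw [basisVerma_apply, lie_vermaCan_monMinus]

theorem repr_lie_cartan (h : H) (m : Verma b lam) (s : Multiset (PosRoot b)) :
    (basisVerma b lam).repr ⁅(h : 𝔤), m⁆ s =
      (lam h - msWt s h) * (basisVerma b lam).repr m s := by
  classical
  refine LinearMap.congr_fun (f := (basisVerma b lam).coord s ∘ₗ LieModule.toEnd ℂ 𝔤 _ (h : 𝔤))
    (g := (lam h - msWt s h) • (basisVerma b lam).coord s)
    ((basisVerma b lam).ext fun s' => ?_) m
  rw [LinearMap.comp_apply, LieModule.toEnd_apply_apply, lie_basisVerma, map_smul,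
    LinearMap.smul_apply, Module.Basis.coord_apply, Module.Basis.repr_self,
    Finsupp.single_apply]
  split_ifs with hs
  · rw [hs]
  · rw [smul_zero, smul_zero]

theorem vacuum_eq_repr (m : Verma b lam) : vacuum b lam m = (basisVerma b lam).repr m 0 := by
  classical
  refine LinearMap.congr_fun (f := vacuum b lam) (g := (basisVerma b lam).coord 0)
    ((basisVerma b lam).ext fun s => ?_) m
  rw [Module.Basis.coord_apply, Module.Basis.repr_self, basisVerma_apply, vacuum_vermaCan,
    Finsupp.single_apply]
  split_ifs with hs
  · rw [hs, monMinus_zero, map_one]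
  · exact counit_monMinus hs

theorem eq_top_of_vermaOne_mem {N : LieSubmodule ℂ 𝔤 (Verma b lam)} (h : vermaOne b lam ∈ N) :
    N = ⊤ := by
  rw [eq_top_iff]
  rintro m -
  obtain ⟨a, rfl⟩ := vermaMk_surjective m
  rw [← act_vermaOne]
  have : ∀ m ∈ N, act (Verma b lam) a m ∈ N := by
    induction a using enveloping_induction with
    | hc c =>
      intro m hm
      rw [AlgHom.commutes, Module.algebraMap_end_apply]
      exact N.smul_mem c hm
    | hι x => intro m hm; rw [act_ι]; exact N.lie_mem hm
    | hmul a c ha hc => intro m hm; rw [map_mul]; exact ha _ (hc _ hm)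
    | hadd a c ha hc => intro m hm; rw [map_add]; exact N.add_mem (ha _ hm) (hc _ hm)
  exact this _ h

/-- A vector of `N` with nonzero vacuum coefficient can be stripped of its other PBW terms inside
`N`, until a nonzero multiple of the highest weight vector remains and `N` is everything. The
induction is on the number of PBW terms. -/
theorem vacuum_eq_zero_of_mem {N : LieSubmodule ℂ 𝔤 (Verma b lam)} (hN : N ≠ ⊤)
    {n : Verma b lam} (hn : n ∈ N) : vacuum b lam n = 0 := by
  classical
  by_contra hv
  apply hN
  generalize hk : ((basisVerma b lam).repr n).support.card = k
  induction k using Nat.strong_induction_on generalizing n with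
  | _ k ih =>
    by_cases hs : ∃ s ∈ ((basisVerma b lam).repr n).support, s ≠ 0
    · obtain ⟨s, hs, hs0⟩ := hs
      set t := principal b with ht
      obtain ⟨j, hj, hj'⟩ := msWt_principal s
      have hst : msWt s t ≠ 0 := by
        rw [hj', Nat.cast_ne_zero]
        have := Multiset.card_pos.2 hs0
        omega
      -- This operator deletes the coefficient at `s` and multiplies the vacuum coefficient by the
      -- height of `s`, which is nonzero.
      have hmem : ⁅(t : 𝔤), n⁆ - (lam t - msWt s t) • n ∈ N :=
        N.sub_mem (N.lie_mem hn) (N.smul_mem _ hn)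
      have hrepr : ∀ s', (basisVerma b lam).repr (⁅(t : 𝔤), n⁆ - (lam t - msWt s t) • n) s' =
          (msWt s t - msWt s' t) * (basisVerma b lam).repr n s' := fun s' => by
        rw [map_sub, map_smul, Finsupp.sub_apply, Finsupp.smul_apply, repr_lie_cartan,
          smul_eq_mul]
        ring
      refine ih _ ?_ hmem ?_ rfl
      · rw [← hk]
        refine Finset.card_lt_card (Finset.ssubset_iff_subset_ne.2 ⟨fun s' hs' => ?_, ?_⟩)
        · rw [Finsupp.mem_support_iff, hrepr] at hs'
          exact Finsupp.mem_support_iff.2 (right_ne_zero_of_mul hs')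
        · intro h
          rw [← h, Finsupp.mem_support_iff, hrepr, sub_self, zero_mul] at hs
          exact hs rfl
      · rw [vacuum_eq_repr, hrepr, msWt_zero, LinearMap.zero_apply, sub_zero, ← vacuum_eq_repr]
        exact mul_ne_zero hst hv
    · push Not at hs
      have : (basisVerma b lam).repr n =
          Finsupp.single 0 (vacuum b lam n) := by
        ext s
        rw [Finsupp.single_apply]
        split_ifs with h
        · rw [vacuum_eq_repr, h]
        · by_contra hne
          exact h (hs s (Finsupp.mem_support_iff.2 hne)).symm
      have h₁ : n = vacuum b lam n • vermaOne b lam := by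
        rw [← basisVerma_zero, ← (basisVerma b lam).repr.injective.eq_iff, this, map_smul,
          Module.Basis.repr_self, Finsupp.smul_single, smul_eq_mul, mul_one]
      apply eq_top_of_vermaOne_mem
      have h₂ := N.smul_mem (vacuum b lam n)⁻¹ hn
      rwa [h₁, smul_smul, vacuum_eq_repr, map_smul, ← basisVerma_zero, Module.Basis.repr_self,
        Finsupp.smul_single, Finsupp.single_eq_same, smul_eq_mul, mul_one, inv_mul_cancel₀ hv,
        one_smul, basisVerma_zero] at h₂

/-- Vanishing of the vacuum functional on each proper submodule passes to their sum. Hence the sum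
is proper, and the functional descends to the irreducible quotient. -/
theorem maxSub_le_ker_vacuum : (maxSub b lam).toSubmodule ≤ LinearMap.ker (vacuum b lam) := by
  rw [maxSub, LieSubmodule.sSup_toSubmodule_eq_iSup]
  exact iSup₂_le fun N hN n hn => vacuum_eq_zero_of_mem hN hn

theorem maxSub_ne_top : maxSub b lam ≠ ⊤ := fun h => by
  have : vermaOne b lam ∈ (maxSub b lam).toSubmodule := by rw [h]; trivial
  have := maxSub_le_ker_vacuum this
  rw [LinearMap.mem_ker, vacuum_one] at this
  exact one_ne_zero this

theorem Generic.maxSub_eq_bot (h : Generic b lam) : maxSub b lam = ⊥ := by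
  have : LieModule.IsIrreducible ℂ 𝔤 (Verma b lam) := h
  exact (IsSimpleOrder.eq_bot_or_eq_top (maxSub b lam)).resolve_right maxSub_ne_top

variable (b) in
/-- The action of `U𝔫₊` on functionals on a `𝔤`-module: `(x ν)(v) = ν(x̄ v)`. -/
def twist {V : Type*} [AddCommGroup V] [Module ℂ V] [LieRingModule 𝔤 V] [LieModule ℂ 𝔤 V]
    (ν : Module.Dual ℂ V) (x : U (nPlus b)) : Module.Dual ℂ V :=
  ν ∘ₗ act V (antipode 𝔤 (inclU (nPlus b) x))

theorem twist_apply {V : Type*} [AddCommGroup V] [Module ℂ V] [LieRingModule 𝔤 V]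
    [LieModule ℂ 𝔤 V] (ν : Module.Dual ℂ V) (x : U (nPlus b)) (v : V) :
    twist b ν x v = ν (act V (antipode 𝔤 (inclU (nPlus b) x)) v) := rfl

/-- The vectors `m` such that the vacuum functional vanishes on `U𝔤·m` form a submodule, proper
because it misses the highest weight vector. By the triangular decomposition it suffices to test
`U𝔫₊`, since the functional absorbs `U𝔫₋` and `U𝔥` as scalars. -/
theorem mem_maxSub_of_twist {m : Verma b lam}
    (hm : ∀ x : U (nPlus b), twist b (vacuum b lam) x m = 0) : m ∈ maxSub b lam := by
  let R : LieSubmodule ℂ 𝔤 (Verma b lam) :=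
    { carrier := {m | ∀ a : U 𝔤, vacuum b lam (act (Verma b lam) a m) = 0}
      add_mem' := fun {m n} hm hn a => by rw [map_add, map_add, hm, hn, add_zero]
      zero_mem' := fun a => by rw [map_zero, map_zero]
      smul_mem' := fun c m hm a => by rw [map_smul, map_smul, hm, smul_zero]
      lie_mem := fun {x m} hm a => by
        rw [← act_ι (L := 𝔤), ← Module.End.mul_apply, ← map_mul]
        exact hm _ }
  have hR : R ≠ ⊤ := fun h => by
    have : vermaOne b lam ∈ R := h ▸ LieSubmodule.mem_top _
    have := this 1
    rw [map_one, Module.End.one_apply, vacuum_one] at this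
    exact one_ne_zero this
  have hle : R ≤ maxSub b lam := le_sSup hR
  apply hle
  intro a
  refine LinearMap.congr_fun (f := vacuum b lam ∘ₗ LinearMap.applyₗ (R := ℂ) m ∘ₗ
    (act (Verma b lam)).toLinearMap) (g := 0) (tri_hom_ext (b := b) fun y z x => ?_) a
  change vacuum b lam (act (Verma b lam) _ m) = 0
  have := hm (antipode _ x)
  rw [twist_apply, ← antipode_inclU, antipode_antipode] at this
  rw [map_mul, Module.End.mul_apply, vacuum_act_nMinus, map_mul, Module.End.mul_apply,
    vacuum_act_cartan, this, mul_zero, mul_zero]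

theorem Generic.eq_zero_of_twist (h : Generic b lam) {m : Verma b lam}
    (hm : ∀ x : U (nPlus b), twist b (vacuum b lam) x m = 0) : m = 0 := by
  have := mem_maxSub_of_twist hm
  rwa [h.maxSub_eq_bot, LieSubmodule.mem_bot] at this

/-! ### The irreducible quotient -/

variable (b lam) in
/-- The functional on `V(lam)` that reads off the coefficient of the highest weight vector. -/
def vacuumIrr : Irr b lam →ₗ[ℂ] ℂ :=
  (maxSub b lam).toSubmodule.liftQ (vacuum b lam) maxSub_le_ker_vacuum

theorem vacuumIrr_irrProj (m : Verma b lam) :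
    vacuumIrr b lam (irrProj b lam m) = vacuum b lam m := rfl

theorem irrProj_surjective : Function.Surjective (irrProj b lam) :=
  LieSubmodule.Quotient.surjective_mk' _

theorem irrProj_act (a : U 𝔤) (m : Verma b lam) :
    irrProj b lam (act (Verma b lam) a m) = act (Irr b lam) a (irrProj b lam m) :=
  act_equivariant (irrProj b lam).toLinearMap (fun x m => LieModuleHom.map_lie _ x m) a m

theorem twist_vacuumIrr (x : U (nPlus b)) (m : Verma b lam) :
    twist b (vacuumIrr b lam) x (irrProj b lam m) = twist b (vacuum b lam) x m := by
  rw [twist_apply, ← irrProj_act, vacuumIrr_irrProj, twist_apply]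

theorem irr_eq_zero_of_twist {v : Irr b lam}
    (hv : ∀ x : U (nPlus b), twist b (vacuumIrr b lam) x v = 0) : v = 0 := by
  obtain ⟨m, rfl⟩ := irrProj_surjective v
  refine (LieSubmodule.Quotient.mk_eq_zero' (N := maxSub b lam)).2
    (mem_maxSub_of_twist fun x => ?_)
  rw [← twist_vacuumIrr, hv]

theorem vacuumIrr_lie_cartan (h : H) (v : Irr b lam) :
    vacuumIrr b lam ⁅(h : 𝔤), v⁆ = lam h * vacuumIrr b lam v := by
  obtain ⟨m, rfl⟩ := irrProj_surjective v
  rw [← LieModuleHom.map_lie, vacuumIrr_irrProj, vacuumIrr_irrProj, vacuum_lie_cartan]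

end Weights

/-! ### Singular vectors in tensor products -/

section Singular

variable {𝔤 : Type u} [LieRing 𝔤] [LieAlgebra ℂ 𝔤] [FiniteDimensional ℂ 𝔤]
  [LieAlgebra.IsSemisimple ℂ 𝔤] {H : LieSubalgebra ℂ 𝔤} [H.IsCartanSubalgebra]
  {b : (LieAlgebra.IsKilling.rootSystem H).Base}
  {V : Type*} [AddCommGroup V] [Module ℂ V] [LieRingModule 𝔤 V] [LieModule ℂ 𝔤 V]
  {E : Type*} [AddCommGroup E] [Module ℂ E] [LieRingModule 𝔤 E] [LieModule ℂ 𝔤 E]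

/-- Contraction with a functional in the first tensor factor. -/
def contract {V E : Type*} [AddCommGroup V] [Module ℂ V] [AddCommGroup E] [Module ℂ E]
    (ξ : Module.Dual ℂ V) : V ⊗[ℂ] E →ₗ[ℂ] E :=
  (TensorProduct.lid ℂ E).toLinearMap ∘ₗ ξ.rTensor E

@[simp] theorem contract_tmul {V E : Type*} [AddCommGroup V] [Module ℂ V] [AddCommGroup E]
    [Module ℂ E] (ξ : Module.Dual ℂ V) (v : V) (f : E) : contract ξ (v ⊗ₜ[ℂ] f) = ξ v • f := rfl

theorem contract_add {V E : Type*} [AddCommGroup V] [Module ℂ V] [AddCommGroup E]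
    [Module ℂ E] (ξ η : Module.Dual ℂ V) (w : V ⊗[ℂ] E) :
    contract (ξ + η) w = contract ξ w + contract η w := by
  simp [contract, LinearMap.rTensor_add]

theorem contract_smul {V E : Type*} [AddCommGroup V] [Module ℂ V] [AddCommGroup E]
    [Module ℂ E] (c : ℂ) (ξ : Module.Dual ℂ V) (w : V ⊗[ℂ] E) :
    contract (c • ξ) w = c • contract ξ w := by
  simp [contract, LinearMap.rTensor_smul]

theorem contract_rTensor {V W E : Type*} [AddCommGroup V] [Module ℂ V] [AddCommGroup W]
    [Module ℂ W] [AddCommGroup E] [Module ℂ E] (ξ : Module.Dual ℂ W) (g : V →ₗ[ℂ] W)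
    (w : V ⊗[ℂ] E) : contract ξ (g.rTensor E w) = contract (ξ ∘ₗ g) w := by
  rw [contract, contract, LinearMap.rTensor_comp]; rfl

omit [FiniteDimensional ℂ 𝔤] [LieAlgebra.IsSemisimple ℂ 𝔤] in
theorem contract_lie (ξ : Module.Dual ℂ V) (a : 𝔤) (w : V ⊗[ℂ] E) :
    contract ξ ⁅a, w⁆ = contract (ξ ∘ₗ LieModule.toEnd ℂ 𝔤 V a) w + ⁅a, contract ξ w⁆ := by
  induction w using TensorProduct.induction_on with
  | zero => simp
  | tmul v f =>
    rw [TensorProduct.LieModule.lie_tmul_right, map_add, contract_tmul, contract_tmul,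
      contract_tmul, contract_tmul, lie_smul]; rfl
  | add w w' h h' => rw [lie_add, map_add, h, h', map_add, map_add, lie_add]; abel

/-- Expand `w` along a basis of `E`: its coefficients are vectors of `V` on which every functional
of `S` vanishes. No finite-dimensionality is required. -/
theorem eq_zero_of_contract {V E : Type*} [AddCommGroup V] [Module ℂ V] [AddCommGroup E]
    [Module ℂ E] {S : Set (Module.Dual ℂ V)} (hS : ∀ v : V, (∀ ξ ∈ S, ξ v = 0) → v = 0)
    {w : V ⊗[ℂ] E} (hw : ∀ ξ ∈ S, contract ξ w = 0) : w = 0 := by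
  classical
  let B := Module.Basis.ofVectorSpace ℂ E
  refine (TensorProduct.equivFinsuppOfBasisRight (M := V) B).map_eq_zero_iff.1 ?_
  ext i
  refine hS _ fun ξ hξ => ?_
  have h : ∀ w : V ⊗[ℂ] E, ξ (TensorProduct.equivFinsuppOfBasisRight B w i) =
      B.repr (contract ξ w) i := fun w => by
    induction w using TensorProduct.induction_on with
    | zero => simp
    | tmul v f => simp [mul_comm]
    | add w w' h h' => rw [map_add, Finsupp.add_apply, map_add, h, h', map_add, map_add]; rfl
  rw [h, hw ξ hξ, map_zero]; rfl

theorem twist_ι_mul (ν : Module.Dual ℂ V) (e : nPlus b) (x : U (nPlus b)) :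
    twist b ν (UniversalEnvelopingAlgebra.ι ℂ e * x) =
      -(twist b ν x ∘ₗ LieModule.toEnd ℂ 𝔤 V (e : 𝔤)) := by
  ext v
  rw [twist_apply, map_mul, antipode_mul, inclU_ι, antipode_ι, mul_neg, map_neg, map_mul,
    LinearMap.neg_apply, map_neg, Module.End.mul_apply, act_ι]
  rfl

theorem twist_mul (ν : Module.Dual ℂ V) (x y : U (nPlus b)) :
    twist b ν (x * y) = twist b (twist b ν y) x := by
  ext v
  rw [twist_apply, twist_apply, twist_apply, map_mul, antipode_mul, map_mul]; rfl

theorem twist_add (ν : Module.Dual ℂ V) (x y : U (nPlus b)) :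
    twist b ν (x + y) = twist b ν x + twist b ν y := by
  ext v
  rw [LinearMap.add_apply, twist_apply, twist_apply, twist_apply, map_add, antipode_add, map_add,
    LinearMap.add_apply, map_add]

theorem twist_smul (ν : Module.Dual ℂ V) (c : ℂ) (x : U (nPlus b)) :
    twist b ν (c • x) = c • twist b ν x := by
  ext v
  rw [LinearMap.smul_apply, twist_apply, twist_apply, map_smul, antipode_smul, map_smul,
    LinearMap.smul_apply, map_smul]

theorem twist_one (ν : Module.Dual ℂ V) : twist b ν 1 = ν := by
  ext v
  rw [twist_apply, map_one, antipode_one, map_one]; rfl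

/-- Contraction of a vector annihilated by `𝔫₊` intertwines the actions of `U𝔫₊`. -/
theorem contract_twist_of_singular {w : V ⊗[ℂ] E} (hw : ∀ e ∈ nPlus b, ⁅e, w⁆ = 0)
    (ν : Module.Dual ℂ V) (x : U (nPlus b)) :
    contract (twist b ν x) w = act E (inclU (nPlus b) x) (contract ν w) := by
  induction x using enveloping_induction generalizing ν with
  | hc c =>
    rw [Algebra.algebraMap_eq_smul_one, twist_smul, twist_one, contract_smul, map_smul, map_one,
      map_smul, map_one]
    rfl
  | hι e =>
    have h := contract_lie ν (e : 𝔤) w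
    rw [hw e e.2, map_zero] at h
    rw [← mul_one (UniversalEnvelopingAlgebra.ι ℂ e), twist_ι_mul, twist_one, ← neg_one_smul ℂ,
      contract_smul, mul_one, inclU_ι, act_ι, eq_neg_of_add_eq_zero_left h.symm, neg_one_smul,
      neg_neg]
  | hmul x y hx hy =>
    rw [twist_mul, hx, hy, map_mul, map_mul, Module.End.mul_apply]
  | hadd x y hx hy =>
    rw [twist_add, contract_add, hx, hy, map_add, map_add]; rfl

/-- A vector annihilated by `𝔫₊` is determined by its leading coefficient. -/
theorem eq_zero_of_singular {ν : Module.Dual ℂ V}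
    (hν : ∀ v : V, (∀ x : U (nPlus b), twist b ν x v = 0) → v = 0)
    {w : V ⊗[ℂ] E} (hw : ∀ e ∈ nPlus b, ⁅e, w⁆ = 0) (h0 : contract ν w = 0) : w = 0 := by
  refine eq_zero_of_contract (S := Set.range (twist b ν))
    (fun v hv => hν v fun x => hv _ ⟨x, rfl⟩) ?_
  rintro _ ⟨x, rfl⟩
  rw [contract_twist_of_singular hw, h0, map_zero]

/-- Contracting `e·w` with `x·ν` gives `-(e x)·u + e·(x·u) = 0`, and the translates of `ν` separate
points. This is the converse of `contract_twist_of_singular`. -/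
theorem singular_of_contract_twist {ν : Module.Dual ℂ V}
    (hν : ∀ v : V, (∀ x : U (nPlus b), twist b ν x v = 0) → v = 0) {w : V ⊗[ℂ] E} {u : E}
    (hw : ∀ x, contract (twist b ν x) w = act E (inclU (nPlus b) x) u) {e : 𝔤}
    (he : e ∈ nPlus b) : ⁅e, w⁆ = 0 := by
  refine eq_zero_of_contract (S := Set.range (twist b ν))
    (fun v hv => hν v fun x => hv _ ⟨x, rfl⟩) ?_
  rintro _ ⟨x, rfl⟩
  have h₁ : twist b ν x ∘ₗ LieModule.toEnd ℂ 𝔤 V e =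
      (-1 : ℂ) • twist b ν (UniversalEnvelopingAlgebra.ι ℂ (⟨e, he⟩ : nPlus b) * x) := by
    rw [twist_ι_mul, neg_one_smul, neg_neg]
  rw [contract_lie, h₁, contract_smul, hw, hw, map_mul, map_mul, inclU_ι, Module.End.mul_apply,
    act_ι, neg_one_smul, neg_add_cancel]

/-- The contractions of `h·w` with translates of `ν` are computed by moving `h` past `x`. The
commutator contributes on the functional and on `u`, and these two contributions cancel because `u`
has weight zero. -/
theorem weight_of_contract_twist {ν : Module.Dual ℂ V} {lam : Module.Dual ℂ H}
    (hν : ∀ v : V, (∀ x : U (nPlus b), twist b ν x v = 0) → v = 0)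
    (hνh : ∀ (h : H) (v : V), ν ⁅(h : 𝔤), v⁆ = lam h * ν v) {w : V ⊗[ℂ] E} {u : E}
    (hu : ∀ h : H, ⁅(h : 𝔤), u⁆ = 0)
    (hw : ∀ x, contract (twist b ν x) w = act E (inclU (nPlus b) x) u) (h : H) :
    ⁅(h : 𝔤), w⁆ = lam h • w := by
  rw [← sub_eq_zero]
  refine eq_zero_of_contract (S := Set.range (twist b ν))
    (fun v hv => hν v fun x => hv _ ⟨x, rfl⟩) ?_
  rintro _ ⟨x, rfl⟩
  obtain ⟨x', -, hx⟩ := exists_inclU_mul_cartan h (lie_cartan_mem_nPlus (b := b) h) x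
  have h₁ : twist b ν x ∘ₗ LieModule.toEnd ℂ 𝔤 V (h : 𝔤) =
      lam h • twist b ν x + (-1 : ℂ) • twist b ν x' := by
    ext v
    have h₂ := congrArg (fun a => ν (act V (antipode 𝔤 a) v)) hx
    simp only [antipode_mul, antipode_add, antipode_ι, mul_neg, neg_mul, map_neg, map_mul,
      map_add, LinearMap.neg_apply, LinearMap.add_apply, Module.End.mul_apply, act_ι, hνh] at h₂
    simp only [LinearMap.comp_apply, LinearMap.add_apply, LinearMap.smul_apply, twist_apply,
      LieModule.toEnd_apply_apply, smul_eq_mul]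
    linear_combination -h₂
  have h₃ := congrArg (fun a => act E a u) hx
  simp only [map_mul, map_add, LinearMap.add_apply, Module.End.mul_apply, act_ι, hu, map_zero,
    zero_add] at h₃
  rw [map_sub, contract_lie, h₁, contract_add, contract_smul, contract_smul, hw, hw, map_smul, hw,
    h₃, neg_one_smul]
  abel

end Singular

/-! ### The Casimir operator -/

section Casimir

variable {𝔤 : Type u} [LieRing 𝔤] [LieAlgebra ℂ 𝔤] [FiniteDimensional ℂ 𝔤]
  [LieAlgebra.IsSemisimple ℂ 𝔤] {H : LieSubalgebra ℂ 𝔤} [H.IsCartanSubalgebra]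
  {b : (LieAlgebra.IsKilling.rootSystem H).Base}

open LieAlgebra LieAlgebra.IsKilling

/-- The Killing form pairs the chosen root vectors of opposite roots nontrivially. -/
theorem killingForm_rootVec_ne_zero (α : H.root) :
    killingForm ℂ 𝔤 (rootVec α) (rootVec (negRoot α)) ≠ 0 := fun h => by
  have := mem_ker_killingForm_of_mem_rootSpace_of_forall_rootSpace_neg ℂ 𝔤 H (rootVec_mem α)
    fun y hy => by
      rw [← coe_negRoot] at hy
      have hy' : y ∈ (rootSpace H (negRoot α).1).toSubmodule := hy
      rw [rootSpace_eq_span] at hy'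
      obtain ⟨c, rfl⟩ := Submodule.mem_span_singleton.1 hy'
      rw [map_smul, h, smul_zero]
  rw [LinearMap.mem_ker] at this
  exact rootVec_ne_zero α ((killingForm_nondegenerate ℂ 𝔤).1 _ fun y => by rw [this]; rfl)

/-- The inverse of the value of the Killing form on root vectors of opposite roots. -/
def killingCoeff (α : PosRoot b) : ℂ := (killingForm ℂ 𝔤 (eVec α : 𝔤) (fVec α : 𝔤))⁻¹

theorem killingCoeff_mul (α : PosRoot b) :
    killingCoeff α * killingForm ℂ 𝔤 (eVec α : 𝔤) (fVec α : 𝔤) = 1 :=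
  inv_mul_cancel₀ (killingForm_rootVec_ne_zero α.1)

/-- The basis of `𝔥` dual to `finBasis` with respect to the Killing form. -/
def cartanDual (i : Fin (Module.finrank ℂ H)) : H :=
  (cartanEquivDual H).symm ((Module.finBasis ℂ H).coord i)

/-- The dual with respect to the Killing form of the adapted basis. -/
def triDual : TriIndex b → 𝔤 :=
  Sum.elim (fun α => killingCoeff α • (eVec α : 𝔤))
    (Sum.elim (fun i => (cartanDual i : 𝔤)) fun α => killingCoeff α • (fVec α : 𝔤))

theorem killingForm_cartanDual (i : Fin (Module.finrank ℂ H)) (h : H) :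
    killingForm ℂ 𝔤 (cartanDual i : 𝔤) h = (Module.finBasis ℂ H).coord i h := by
  have : cartanEquivDual H (cartanDual i) h = (Module.finBasis ℂ H).coord i h := by
    rw [cartanDual, LinearEquiv.apply_symm_apply]
  rwa [cartanEquivDual_apply_apply] at this

omit [FiniteDimensional ℂ 𝔤] [IsSemisimple ℂ 𝔤] in
theorem killingForm_comm (x y : 𝔤) : killingForm ℂ 𝔤 x y = killingForm ℂ 𝔤 y x :=
  LieModule.traceForm_comm ℂ 𝔤 𝔤 x y

theorem eVec_mem (α : PosRoot b) : (eVec α : 𝔤) ∈ rootSpace H α.1.1 := rootVec_mem α.1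

theorem fVec_mem (α : PosRoot b) : (fVec α : 𝔤) ∈ rootSpace H (-⇑α.1.1) := by
  rw [← coe_negRoot]; exact rootVec_mem _

omit [IsSemisimple ℂ 𝔤] in
theorem cartan_mem (h : H) : (h : 𝔤) ∈ rootSpace H (0 : H → ℂ) := by
  have : (h : 𝔤) ∈ H.toLieSubmodule := h.2
  rwa [← rootSpace_zero_eq ℂ 𝔤 H] at this

theorem add_ne_zero_of_pos (α β : PosRoot b) : ⇑α.1.1 + ⇑β.1.1 ≠ 0 := fun h =>
  not_isPos_add_eq_zero α.2 β.2 (by ext x; exact congrFun h x)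

theorem coe_posRoot_ne_zero (α : PosRoot b) : ⇑α.1.1 ≠ 0 :=
  LieSubalgebra.isNonZero_coe_root α.1

theorem add_neg_ne_zero_of_ne {α β : PosRoot b} (h : α ≠ β) : ⇑α.1.1 + -⇑β.1.1 ≠ 0 := fun h' => by
  apply h
  refine Subtype.ext (Subtype.ext (DFunLike.coe_injective ?_))
  rwa [← sub_eq_add_neg, sub_eq_zero] at h'

theorem killingForm_triVec_triDual [DecidableEq (TriIndex b)] (i j : TriIndex b) :
    killingForm ℂ 𝔤 (triVec i) (triDual j) = if i = j then 1 else 0 := by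
  classical
  have orth := fun {α β : H → ℂ} {x y : 𝔤} (hx : x ∈ rootSpace H α) (hy : y ∈ rootSpace H β)
    (h : α + β ≠ 0) => killingForm_apply_eq_zero_of_mem_rootSpace_of_add_ne_zero ℂ 𝔤 H hx hy h
  rcases i with α | i | α <;> rcases j with β | j | β
  · change killingForm ℂ 𝔤 (fVec α : 𝔤) (killingCoeff β • (eVec β : 𝔤)) = _
    rw [map_smul, smul_eq_mul, killingForm_comm]
    by_cases h : α = β
    · rw [h, if_pos rfl, killingCoeff_mul]
    · rw [orth (eVec_mem β) (fVec_mem α) (add_neg_ne_zero_of_ne (Ne.symm h)), mul_zero,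
        if_neg (by simpa using h)]
  · rw [if_neg (by simp)]
    exact orth (fVec_mem α) (cartan_mem _) (by
      rw [add_zero]; exact neg_ne_zero.2 (coe_posRoot_ne_zero α))
  · change killingForm ℂ 𝔤 (fVec α : 𝔤) (killingCoeff β • (fVec β : 𝔤)) = _
    rw [if_neg (by simp), map_smul, orth (fVec_mem α) (fVec_mem β) (by
      rw [← neg_add]; exact neg_ne_zero.2 (add_ne_zero_of_pos α β)), smul_zero]
  · change killingForm ℂ 𝔤 (Module.finBasis ℂ H i : 𝔤) (killingCoeff β • (eVec β : 𝔤)) = _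
    rw [if_neg (by simp), map_smul, orth (cartan_mem _) (eVec_mem β) (by
      rw [zero_add]; exact coe_posRoot_ne_zero β), smul_zero]
  · change killingForm ℂ 𝔤 (Module.finBasis ℂ H i : 𝔤) (cartanDual j : 𝔤) = _
    rw [killingForm_comm, killingForm_cartanDual, Module.Basis.coord_apply,
      Module.Basis.repr_self, Finsupp.single_apply]
    simp
  · change killingForm ℂ 𝔤 (Module.finBasis ℂ H i : 𝔤) (killingCoeff β • (fVec β : 𝔤)) = _
    rw [if_neg (by simp), map_smul, orth (cartan_mem _) (fVec_mem β) (by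
      rw [zero_add]; exact neg_ne_zero.2 (coe_posRoot_ne_zero β)), smul_zero]
  · change killingForm ℂ 𝔤 (eVec α : 𝔤) (killingCoeff β • (eVec β : 𝔤)) = _
    rw [if_neg (by simp), map_smul, orth (eVec_mem α) (eVec_mem β) (add_ne_zero_of_pos α β),
      smul_zero]
  · rw [if_neg (by simp)]
    exact orth (eVec_mem α) (cartan_mem _) (by
      rw [add_zero]; exact coe_posRoot_ne_zero α)
  · change killingForm ℂ 𝔤 (eVec α : 𝔤) (killingCoeff β • (fVec β : 𝔤)) = _
    rw [map_smul, smul_eq_mul]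
    by_cases h : α = β
    · rw [h, if_pos rfl, killingCoeff_mul]
    · rw [orth (eVec_mem α) (fVec_mem β) (add_neg_ne_zero_of_ne h), mul_zero,
        if_neg (by simpa using h)]

theorem killingForm_triDual_triVec [DecidableEq (TriIndex b)] (i j : TriIndex b) :
    killingForm ℂ 𝔤 (triDual j) (triVec i) = if i = j then 1 else 0 := by
  rw [killingForm_comm, killingForm_triVec_triDual]

theorem sum_killingForm_triDual_smul (z : 𝔤) :
    ∑ i : TriIndex b, killingForm ℂ 𝔤 (triDual i) z • triVec i = z := by
  classical
  let φ : 𝔤 →ₗ[ℂ] 𝔤 := ∑ i : TriIndex b, (killingForm ℂ 𝔤 (triDual i)).smulRight (triVec i)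
  have : φ = LinearMap.id := (triBasis b).ext fun j => by
    simp only [φ, LinearMap.sum_apply, LinearMap.smulRight_apply, coe_triBasis,
      killingForm_triDual_triVec, ite_smul, one_smul, zero_smul, Finset.sum_ite_eq,
      Finset.mem_univ, if_true, LinearMap.id_apply]
  have h := LinearMap.congr_fun this z
  simpa only [φ, LinearMap.sum_apply, LinearMap.smulRight_apply, LinearMap.id_apply] using h

theorem sum_killingForm_triVec_smul (z : 𝔤) :
    ∑ i : TriIndex b, killingForm ℂ 𝔤 z (triVec i) • triDual i = z := by
  classical
  rw [← sub_eq_zero]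
  refine (killingForm_nondegenerate ℂ 𝔤).1 _ fun y => ?_
  refine LinearMap.congr_fun (f := killingForm ℂ 𝔤 _) (g := 0)
    ((triBasis b).ext fun j => ?_) y
  simp only [coe_triBasis, map_sub, map_sum, map_smul, LinearMap.sub_apply, LinearMap.sum_apply,
    LinearMap.smul_apply, killingForm_triDual_triVec, smul_eq_mul, mul_ite, mul_one, mul_zero,
    Finset.sum_ite_eq, Finset.mem_univ, if_true, LinearMap.zero_apply, sub_self]

variable (b) in
/-- The Casimir operator on a `𝔤`-module. -/
def casimir (M : Type*) [AddCommGroup M] [Module ℂ M] [LieRingModule 𝔤 M] [LieModule ℂ 𝔤 M] :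
    Module.End ℂ M :=
  ∑ i : TriIndex b, LieModule.toEnd ℂ 𝔤 M (triVec i) * LieModule.toEnd ℂ 𝔤 M (triDual i)

section

variable {M : Type*} [AddCommGroup M] [Module ℂ M] [LieRingModule 𝔤 M] [LieModule ℂ 𝔤 M]

theorem casimir_apply (m : M) :
    casimir b M m = ∑ i : TriIndex b, ⁅triVec i, ⁅triDual i, m⁆⁆ := by
  simp [casimir]

/-- Invariance of the Killing form makes the matrices of `ad a` in two dual bases negative
transposes of each other, so the terms in which `a` hits one of the two factors cancel. -/
theorem lie_casimir (a : 𝔤) (m : M) : ⁅a, casimir b M m⁆ = casimir b M ⁅a, m⁆ := by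
  have h₁ : ∑ i : TriIndex b, ⁅⁅a, triVec i⁆, ⁅triDual i, m⁆⁆ = ∑ i : TriIndex b, ∑ j : TriIndex b,
      killingForm ℂ 𝔤 (triDual j) ⁅a, triVec i⁆ • ⁅triVec j, ⁅triDual i, m⁆⁆ := by
    refine Finset.sum_congr rfl fun i _ => ?_
    conv_lhs => rw [← sum_killingForm_triDual_smul (b := b) ⁅a, triVec i⁆]
    rw [sum_lie]
    simp only [smul_lie]
  have h₂ : ∑ i : TriIndex b, ⁅triVec i, ⁅⁅a, triDual i⁆, m⁆⁆ = ∑ i : TriIndex b, ∑ j : TriIndex b,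
      killingForm ℂ 𝔤 ⁅a, triDual i⁆ (triVec j) • ⁅triVec i, ⁅triDual j, m⁆⁆ := by
    refine Finset.sum_congr rfl fun i _ => ?_
    conv_lhs => rw [← sum_killingForm_triVec_smul (b := b) ⁅a, triDual i⁆]
    rw [sum_lie, lie_sum]
    simp only [smul_lie, lie_smul]
  have h₃ : ∑ i : TriIndex b, ⁅⁅a, triVec i⁆, ⁅triDual i, m⁆⁆ +
      ∑ i : TriIndex b, ⁅triVec i, ⁅⁅a, triDual i⁆, m⁆⁆ = 0 := by
    rw [h₁, h₂, Finset.sum_comm, ← Finset.sum_add_distrib]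
    refine Finset.sum_eq_zero fun i _ => ?_
    rw [← Finset.sum_add_distrib]
    refine Finset.sum_eq_zero fun j _ => ?_
    rw [← add_smul, killingForm, LieModule.traceForm_apply_lie_apply' ℂ 𝔤 𝔤 a (triDual i),
      add_neg_cancel, zero_smul]
  rw [casimir_apply, casimir_apply, lie_sum]
  simp only [leibniz_lie a, lie_add, Finset.sum_add_distrib]
  rw [← add_assoc, h₃, zero_add]

variable (b) in
/-- The value of the Casimir operator on a singular vector of weight `ν`. -/
def casimirScalar (ν : Module.Dual ℂ H) : ℂ :=
  ∑ i, ν (Module.finBasis ℂ H i) * ν (cartanDual i) +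
    ∑ α : PosRoot b, ν ((cartanEquivDual H).symm (posWt α))

variable (b) in
/-- The operator by which the Casimir operator acts on singular vectors. -/
theorem casimir_of_singular {m : M} (hm : ∀ α : PosRoot b, ⁅(eVec α : 𝔤), m⁆ = 0) :
    casimir b M m = ∑ i, ⁅(Module.finBasis ℂ H i : 𝔤), ⁅(cartanDual i : 𝔤), m⁆⁆ +
      ∑ α : PosRoot b, ⁅(((cartanEquivDual H).symm (posWt α) : H) : 𝔤), m⁆ := by
  rw [casimir_apply, Fintype.sum_sum_type, Fintype.sum_sum_type]
  have h₁ : ∀ α : PosRoot b, ⁅triVec (.inl α : TriIndex b), ⁅triDual (.inl α), m⁆⁆ = 0 := fun α => by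
    change ⁅_, ⁅killingCoeff α • (eVec α : 𝔤), m⁆⁆ = 0
    rw [smul_lie, hm, smul_zero, lie_zero]
  -- As `e` kills `m`, the product `e f` acts as the commutator, a multiple of the Killing dual of
  -- the root; `killingCoeff` normalizes that multiple to one.
  have h₂ : ∀ α : PosRoot b, ⁅triVec (.inr (.inr α) : TriIndex b), ⁅triDual (.inr (.inr α)), m⁆⁆ =
      ⁅(((cartanEquivDual H).symm (posWt α) : H) : 𝔤), m⁆ := fun α => by
    change ⁅(eVec α : 𝔤), ⁅killingCoeff α • (fVec α : 𝔤), m⁆⁆ = _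
    rw [leibniz_lie, hm, lie_zero, add_zero, lie_smul,
      lie_eq_killingForm_smul_of_mem_rootSpace_of_mem_rootSpace_neg (eVec_mem α) (fVec_mem α),
      smul_smul, killingCoeff_mul, one_smul]
    rfl
  simp only [h₁, h₂, Finset.sum_const_zero, zero_add]
  rfl

end

theorem casimir_vermaOne (lam : Module.Dual ℂ H) : casimir b (Verma b lam) (vermaOne b lam) =
    casimirScalar b lam • vermaOne b lam := by
  rw [casimir_of_singular b fun α => lie_vermaOne_nPlus (eVec α).2]
  simp only [lie_vermaOne_cartan, lie_smul, smul_smul, casimirScalar, add_smul, Finset.sum_smul]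
  congr 1
  exact Finset.sum_congr rfl fun i _ => by rw [mul_comm]

theorem casimir_verma (lam : Module.Dual ℂ H) (m : Verma b lam) :
    casimir b (Verma b lam) m = casimirScalar b lam • m := by
  obtain ⟨a, rfl⟩ := vermaMk_surjective m
  rw [← act_vermaOne, act_equivariant _ (fun x m => (lie_casimir x m).symm), casimir_vermaOne,
    map_smul]

/-- On a singular vector the Casimir operator reduces to Cartan elements, while on the whole Verma
module it is a scalar. Comparing the coefficient at `s` equates the two values; `m` need not be a
weight vector. -/
theorem casimirScalar_of_singular {lam : Module.Dual ℂ H} {m : Verma b lam}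
    (hm : ∀ α : PosRoot b, ⁅(eVec α : 𝔤), m⁆ = 0) {s : Multiset (PosRoot b)}
    (hs : (basisVerma b lam).repr m s ≠ 0) :
    casimirScalar b (lam - msWt s) = casimirScalar b lam := by
  have h := congrArg (fun v => (basisVerma b lam).repr v s) (casimir_of_singular b hm)
  simp only [casimir_verma, map_smul, map_add, map_sum, Finsupp.add_apply, Finsupp.smul_apply,
    Finsupp.finsetSum_apply, repr_lie_cartan, smul_eq_mul] at h
  apply mul_right_cancel₀ hs
  rw [h, casimirScalar, add_mul, Finset.sum_mul, Finset.sum_mul]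
  simp only [LinearMap.sub_apply]
  congr 1
  exact Finset.sum_congr rfl fun i _ => by ring

end Casimir

/-! ### Generic weights -/

section GenericWeights

variable {𝔤 : Type u} [LieRing 𝔤] [LieAlgebra ℂ 𝔤] [FiniteDimensional ℂ 𝔤]
  [LieAlgebra.IsSemisimple ℂ 𝔤] {H : LieSubalgebra ℂ 𝔤} [H.IsCartanSubalgebra]
  {b : (LieAlgebra.IsKilling.rootSystem H).Base}

open LieAlgebra LieAlgebra.IsKilling

/-- The height of the weight of a multiset of positive roots. -/
def msHeight (s : Multiset (PosRoot b)) : ℕ := (msWt_principal s).choose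

theorem msWt_principal_eq (s : Multiset (PosRoot b)) : msWt s (principal b) = msHeight s :=
  (msWt_principal s).choose_spec.2

theorem msHeight_lt_of_repr_lie_eVec {lam : Module.Dual ℂ H} (α : PosRoot b)
    {s s' : Multiset (PosRoot b)}
    (h : (basisVerma b lam).repr ⁅(eVec α : 𝔤), basisVerma b lam s⁆ s' ≠ 0) :
    msHeight s' < msHeight s := by
  have h₁ := repr_lie_cartan (principal b) ⁅(eVec α : 𝔤), basisVerma b lam s⁆ s'
  rw [leibniz_lie, lie_eVec, lie_basisVerma, smul_lie, lie_smul, ← add_smul, map_smul,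
    Finsupp.smul_apply, smul_eq_mul] at h₁
  have h₂ := mul_right_cancel₀ h h₁
  obtain ⟨n, hn, hn'⟩ := QPlus_principal (posWt_mem_QPlus α)
  rw [msWt_principal_eq, msWt_principal_eq, hn'] at h₂
  have h₃ : ((n + msHeight s' : ℕ) : ℂ) = (msHeight s : ℕ) := by
    rw [Nat.cast_add]; linear_combination h₂
  have h₄ : n + msHeight s' = msHeight s := Nat.cast_injective h₃
  omega

/-- Positive root vectors strictly lower the height of PBW terms. A nonzero vector of `N` whose
highest term is as low as possible must therefore be killed by all of them. -/
theorem exists_singular_mem {lam : Module.Dual ℂ H} {N : LieSubmodule ℂ 𝔤 (Verma b lam)}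
    (hN : N ≠ ⊥) : ∃ n ∈ N, n ≠ 0 ∧ ∀ α : PosRoot b, ⁅(eVec α : 𝔤), n⁆ = 0 := by
  let top : Verma b lam → ℕ := fun n => ((basisVerma b lam).repr n).support.sup msHeight
  obtain ⟨n₀, hn₀, hn₀'⟩ : ∃ n ∈ N, n ≠ 0 := by
    by_contra! hne
    exact hN ((LieSubmodule.eq_bot_iff N).2 hne)
  obtain ⟨n, ⟨hn, hn'⟩, hmin⟩ := (measure top).wf.has_min {n | n ∈ N ∧ n ≠ 0} ⟨n₀, hn₀, hn₀'⟩
  refine ⟨n, hn, hn', fun α => ?_⟩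
  by_contra hne
  refine hmin _ ⟨N.lie_mem hn, hne⟩ ?_
  change ((basisVerma b lam).repr ⁅(eVec α : 𝔤), n⁆).support.sup msHeight < top n
  have hlt : ∀ s' ∈ ((basisVerma b lam).repr ⁅(eVec α : 𝔤), n⁆).support,
      msHeight s' < top n := by
    intro s' hs'
    rw [Finsupp.mem_support_iff] at hs'
    have hsum : (basisVerma b lam).repr ⁅(eVec α : 𝔤), n⁆ s' =
        ∑ s ∈ ((basisVerma b lam).repr n).support, (basisVerma b lam).repr n s *
          (basisVerma b lam).repr ⁅(eVec α : 𝔤), basisVerma b lam s⁆ s' := by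
      conv_lhs => rw [← (basisVerma b lam).linearCombination_repr n,
        Finsupp.linearCombination_apply, Finsupp.sum, lie_sum]
      simp only [lie_smul, map_sum, map_smul, Finsupp.finsetSum_apply, Finsupp.smul_apply,
        smul_eq_mul]
    rw [hsum] at hs'
    obtain ⟨s, hs, hs₂⟩ := Finset.exists_ne_zero_of_sum_ne_zero hs'
    exact (msHeight_lt_of_repr_lie_eVec α (right_ne_zero_of_mul hs₂)).trans_le
      (Finset.le_sup (f := msHeight) hs)
  -- The supremum over an empty support would be zero, so the strict inequality needs `top n` to be
  -- positive; a term of the image provides this.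
  obtain ⟨s', hs'⟩ := Finsupp.support_nonempty_iff.2
    (mt (basisVerma b lam).repr.map_eq_zero_iff.1 hne)
  exact (Finset.sup_lt_iff (lt_of_le_of_lt (Nat.zero_le _) (hlt s' hs'))).2 hlt

/-- A nonzero proper submodule contains a singular vector with zero vacuum coefficient. Some nonzero
`s` then occurs in it, giving a forbidden equality of Casimir values. -/
theorem generic_of_casimirScalar {lam : Module.Dual ℂ H}
    (h : ∀ s : Multiset (PosRoot b), s ≠ 0 →
      casimirScalar b (lam - msWt s) ≠ casimirScalar b lam) : Generic b lam := by
  have hnt : Nontrivial (Verma b lam) := by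
    refine ⟨vermaOne b lam, 0, fun h => ?_⟩
    have := vacuum_one (b := b) (lam := lam)
    rw [h, map_zero] at this
    exact zero_ne_one this
  refine LieModule.IsIrreducible.mk fun N hN => ?_
  by_contra htop
  obtain ⟨n, hn, hn0, hsing⟩ := exists_singular_mem hN
  obtain ⟨s, hs⟩ := Finsupp.support_nonempty_iff.2
    (mt (basisVerma b lam).repr.map_eq_zero_iff.1 hn0)
  rw [Finsupp.mem_support_iff] at hs
  refine h s (fun hs0 => hs ?_) (casimirScalar_of_singular hsing hs)
  rw [hs0, ← vacuum_eq_repr, vacuum_eq_zero_of_mem htop hn]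

theorem sum_killingForm_cartan_smul (t : H) :
    ∑ i, killingForm ℂ 𝔤 (t : 𝔤) (Module.finBasis ℂ H i : 𝔤) • cartanDual i = t := by
  apply (cartanEquivDual H).injective
  rw [map_sum]
  simp only [map_smul, cartanDual, LinearEquiv.apply_symm_apply]
  exact (Module.finBasis ℂ H).sum_dual_apply_smul_coord (cartanEquivDual H t)

theorem sum_killingForm_cartanDual_smul (t : H) :
    ∑ i, killingForm ℂ 𝔤 (t : 𝔤) (cartanDual i : 𝔤) • Module.finBasis ℂ H i = t := by
  simp only [killingForm_comm (t : 𝔤), killingForm_cartanDual, Module.Basis.coord_apply]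
  exact (Module.finBasis ℂ H).sum_repr t

variable (b) in
/-- A regular direction in `𝔥*`. -/
def regularDir : Module.Dual ℂ H := cartanEquivDual H (principal b)

/-- The Casimir value is a quadratic polynomial in the weight, so its difference under a shift by
`β` is affine. Its slope along `regularDir` is `-2 β (principal b)`, because `regularDir` is the
Killing dual of `principal`. -/
theorem casimirScalar_line (lam β : Module.Dual ℂ H) (z : ℂ) :
    casimirScalar b (lam + z • regularDir b - β) - casimirScalar b (lam + z • regularDir b) =
      casimirScalar b (lam - β) - casimirScalar b lam - 2 * z * β (principal b) := by
  have h₁ : ∑ i, regularDir b (Module.finBasis ℂ H i) * β (cartanDual i) = β (principal b) := by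
    conv_rhs => rw [← sum_killingForm_cartan_smul (principal b), map_sum]
    simp only [map_smul, smul_eq_mul]
    rfl
  have h₂ : ∑ i, β (Module.finBasis ℂ H i) * regularDir b (cartanDual i) = β (principal b) := by
    conv_rhs => rw [← sum_killingForm_cartanDual_smul (principal b), map_sum]
    simp only [map_smul, smul_eq_mul, mul_comm (β _)]
    rfl
  have h₃ : 2 * z * β (principal b) =
      ∑ i, z * (regularDir b (Module.finBasis ℂ H i) * β (cartanDual i)) +
      ∑ i, z * (β (Module.finBasis ℂ H i) * regularDir b (cartanDual i)) := by
    rw [← Finset.mul_sum, ← Finset.mul_sum, h₁, h₂]; ring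
  rw [h₃]
  simp only [casimirScalar, LinearMap.sub_apply, LinearMap.add_apply, LinearMap.smul_apply,
    smul_eq_mul, Finset.sum_sub_distrib, Finset.sum_add_distrib, sub_mul, mul_sub, add_mul, mul_add]
  have e₁ : ∀ f g : Fin (Module.finrank ℂ H) → ℂ, (∀ i, f i = g i) → ∑ i, f i = ∑ i, g i :=
    fun f g h => Finset.sum_congr rfl fun i _ => h i
  rw [e₁ (fun i => z * regularDir b (Module.finBasis ℂ H i) * β (cartanDual i)) _
      fun i => mul_assoc _ _ _,
    e₁ (fun i => β (Module.finBasis ℂ H i) * (z * regularDir b (cartanDual i)))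
      (fun i => z * (β (Module.finBasis ℂ H i) * regularDir b (cartanDual i))) fun i => by ring]
  ring

/-- For each nonzero `s` the height is nonzero, so the coincidence of Casimir values is a nontrivial
affine equation with at most one solution; there are countably many `s`. -/
theorem countable_not_generic (lam : Module.Dual ℂ H) :
    {z : ℂ | ¬ Generic b (lam + z • regularDir b)}.Countable := by
  have hc : Countable (Multiset (PosRoot b)) :=
    Function.Surjective.countable (f := (Multiset.ofList : List (PosRoot b) → _))
      Quotient.mk_surjective
  refine (Set.countable_iUnion fun s : {s : Multiset (PosRoot b) // s ≠ 0} =>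
    (Set.Subsingleton.countable (s := {z : ℂ | casimirScalar b (lam + z • regularDir b - msWt s.1) =
      casimirScalar b (lam + z • regularDir b)}) ?_)).mono ?_
  · intro z hz w hw
    have h₁ := casimirScalar_line (b := b) lam (msWt s.1) z
    have h₂ := casimirScalar_line (b := b) lam (msWt s.1) w
    rw [sub_eq_zero.2 (show _ = _ from hz)] at h₁
    rw [sub_eq_zero.2 (show _ = _ from hw)] at h₂
    obtain ⟨n, hn, hn'⟩ := QPlus_principal (msWt_mem_QPlus s.2)
    have h₃ : msWt s.1 (principal b) ≠ 0 := by
      rw [hn', Nat.cast_ne_zero]; omega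
    apply mul_right_cancel₀ (mul_ne_zero (two_ne_zero (α := ℂ)) h₃)
    linear_combination h₁ - h₂
  · intro z hz
    by_contra hne
    refine hz (generic_of_casimirScalar fun s hs h => hne ?_)
    exact Set.mem_iUnion.2 ⟨⟨s, hs⟩, h⟩

/-- Generic weights are Zariski dense. -/
theorem eval_eq_zero_of_generic (p : MvPolynomial H ℂ)
    (hp : ∀ lam, Generic b lam → MvPolynomial.eval (fun h => lam h) p = 0)
    (lam : Module.Dual ℂ H) : MvPolynomial.eval (fun h => lam h) p = 0 := by
  -- The restriction of `p` to the line through `lam` in direction `regularDir` has uncountably many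
  -- zeros, so it vanishes identically, in particular at `lam`.
  let q : Polynomial ℂ := MvPolynomial.eval₂ Polynomial.C
    (fun h => Polynomial.C (lam h) + Polynomial.X * Polynomial.C (regularDir b h)) p
  have hq : ∀ z : ℂ, q.eval z =
      MvPolynomial.eval (fun h => (lam + z • regularDir b) h) p := fun z => by
    rw [MvPolynomial.polynomial_eval_eval₂, MvPolynomial.eval, MvPolynomial.coe_eval₂Hom]
    congr 1
    · ext; simp
    · funext h; simp; ring
  have h0 : q = 0 := by
    by_contra hne
    refine not_countable_complex (((countable_not_generic (b := b) lam).union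
      (q.rootSet_finite ℂ).countable).mono fun z _ => ?_)
    by_cases hz : Generic b (lam + z • regularDir b)
    · refine Or.inr ((Polynomial.mem_rootSet_of_ne hne).2 ?_)
      rw [Polynomial.coe_aeval_eq_eval, hq, hp _ hz]
    · exact Or.inl hz
  have := hq 0
  rwa [h0, Polynomial.eval_zero, zero_smul, add_zero, eq_comm] at this

end GenericWeights

/-! ### Weight spaces of enveloping algebras -/

section WeightSpaces

variable {𝔤 : Type u} [LieRing 𝔤] [LieAlgebra ℂ 𝔤] [FiniteDimensional ℂ 𝔤]
  [LieAlgebra.IsSemisimple ℂ 𝔤] {H : LieSubalgebra ℂ 𝔤} [H.IsCartanSubalgebra]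

section Abstract

variable {𝔫 : LieSubalgebra ℂ 𝔤} {ι : Type*} (B : Module.Basis ι ℂ (U 𝔫))
  (hinj : Function.Injective (inclU 𝔫)) {wt : ι → Module.Dual ℂ H}
  (hB : ∀ i, B i ∈ weightU 𝔫 (wt i))

include hinj hB

omit [FiniteDimensional ℂ 𝔤] [LieAlgebra.IsSemisimple ℂ 𝔤] [H.IsCartanSubalgebra] in
-- The commutator with `h` is diagonal in `B` and multiplies `y` by `μ h`; comparing a nonzero
-- coordinate gives the claim. Injectivity of `inclU` brings the comparison back to `U𝔫`.
theorem wt_eq_of_repr_ne_zero {μ : Module.Dual ℂ H} {y : U 𝔫} (hy : y ∈ weightU 𝔫 μ) {i : ι}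
    (hi : B.repr y i ≠ 0) : wt i = μ := by
  classical
  ext h
  let T : U 𝔫 →ₗ[ℂ] U 𝔫 := B.constr ℂ fun i => wt i h • B i
  have h₁ : inclU 𝔫 (T y) = UniversalEnvelopingAlgebra.ι ℂ (h : 𝔤) * inclU 𝔫 y -
      inclU 𝔫 y * UniversalEnvelopingAlgebra.ι ℂ (h : 𝔤) := by
    refine LinearMap.congr_fun (f := (inclU 𝔫).toLinearMap ∘ₗ T)
      (g := (LinearMap.mulLeft ℂ (UniversalEnvelopingAlgebra.ι ℂ (h : 𝔤)) -
        LinearMap.mulRight ℂ (UniversalEnvelopingAlgebra.ι ℂ (h : 𝔤))) ∘ₗ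
          (inclU 𝔫).toLinearMap) (B.ext fun i => ?_) y
    rw [LinearMap.comp_apply, Module.Basis.constr_basis, map_smul]
    exact (hB i h).symm
  rw [hy h, ← map_smul] at h₁
  have h₂ : B.repr (T y) i = wt i h * B.repr y i := by
    refine LinearMap.congr_fun (f := B.coord i ∘ₗ T) (g := wt i h • B.coord i)
      (B.ext fun j => ?_) y
    rw [LinearMap.comp_apply, Module.Basis.constr_basis, map_smul, LinearMap.smul_apply,
      Module.Basis.coord_apply, Module.Basis.repr_self, Finsupp.single_apply]
    split_ifs with hj
    · rw [hj]
    · rw [smul_zero, smul_zero]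
  rw [hinj h₁, map_smul, Finsupp.smul_apply, smul_eq_mul] at h₂
  exact (mul_right_cancel₀ hi h₂).symm

omit [FiniteDimensional ℂ 𝔤] [LieAlgebra.IsSemisimple ℂ 𝔤] [H.IsCartanSubalgebra] in
theorem mem_span_of_mem_weightU {μ : Module.Dual ℂ H} {y : U 𝔫} (hy : y ∈ weightU 𝔫 μ) :
    y ∈ Submodule.span ℂ (B '' {i | wt i = μ}) := by
  rw [← B.linearCombination_repr y, Finsupp.linearCombination_apply]
  refine Submodule.sum_mem _ fun i hi => Submodule.smul_mem _ _ (Submodule.subset_span ⟨i, ?_, rfl⟩)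
  exact wt_eq_of_repr_ne_zero B hinj hB hy (Finsupp.mem_support_iff.1 hi)

/-- The basis of a weight space of `U𝔫` extracted from a basis of weight vectors. -/
def basisWeightU {κ : Type*} {μ : Module.Dual ℂ H} (e : κ ≃ {i | wt i = μ}) :
    Module.Basis κ ℂ (weightU 𝔫 μ) :=
  Module.Basis.mk (v := fun k => (⟨B (e k), by
      have := hB (e k); rwa [show wt (e k) = μ from (e k).2] at this⟩ : weightU 𝔫 μ))
    (LinearIndependent.of_comp (weightU 𝔫 μ).subtype
      (B.linearIndependent.comp (fun k => (e k : ι)) (Subtype.val_injective.comp e.injective)))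
    (by
      rintro ⟨y, hy⟩ -
      have h := mem_span_of_mem_weightU B hinj hB hy
      refine ((weightU 𝔫 μ).subtype_injective.mem_set_image
        (s := (Submodule.span ℂ _ : Submodule ℂ (weightU 𝔫 μ)))).1 ?_
      rw [← Submodule.map_coe]
      rw [Submodule.map_span]
      refine Submodule.span_mono (R := ℂ) ?_ h
      rintro _ ⟨i, hi, rfl⟩
      refine ⟨_, ⟨e.symm ⟨i, hi⟩, rfl⟩, ?_⟩
      simp)

end Abstract

variable {b : (LieAlgebra.IsKilling.rootSystem H).Base}

/-- Both weight spaces have PBW bases indexed by the finitely many multisets of weight `β`. Hence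
`fusionComponent` never takes its default value. -/
theorem nonempty_weightBases (β : Module.Dual ℂ H) : Nonempty (WeightBases b β) := by
  have hfin : Finite {s : Multiset (PosRoot b) | msWt s = β} := (finite_msWt_eq β).to_subtype
  let e : Fin (Nat.card {s : Multiset (PosRoot b) | msWt s = β}) ≃
      {s : Multiset (PosRoot b) | msWt s = β} := (Finite.equivFin _).symm
  exact ⟨{
    n := _
    y := basisWeightU (basisMinus b) inclU_nMinus_injective (wt := fun s => -msWt s)
      (fun s => by rw [basisMinus_apply]; exact monMinus_mem_weightU s)
      (e.trans (Equiv.setCongr (by ext s; simp)))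
    x := basisWeightU (basisPlus b) inclU_nPlus_injective (wt := msWt)
      (fun s => by rw [basisPlus_apply]; exact monPlus_mem_weightU s) e }⟩

omit [FiniteDimensional ℂ 𝔤] [LieAlgebra.IsSemisimple ℂ 𝔤] [H.IsCartanSubalgebra] in
theorem antipode_mem_weightU {𝔫 : LieSubalgebra ℂ 𝔤} {μ : Module.Dual ℂ H} {x : U 𝔫}
    (hx : x ∈ weightU 𝔫 μ) : antipode 𝔫 x ∈ weightU 𝔫 μ := by
  intro h
  have := congrArg (antipode 𝔤) (sub_eq_iff_eq_add.1 (hx h))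
  rw [antipode_mul, antipode_add, antipode_smul, antipode_mul, antipode_ι, antipode_inclU] at this
  rw [mul_neg, neg_mul] at this
  rw [sub_eq_iff_eq_add, ← neg_inj, neg_add, this]
  abel_nf

variable {lam : Module.Dual ℂ H}

/-- The vector `x̄ y·1` has weight `lam + γ - β`, while the vacuum functional only sees weight
`lam`. -/
theorem twist_vacuum_eq_zero {γ β : Module.Dual ℂ H} (hγ : γ ≠ β) {x : U (nPlus b)}
    {y : U (nMinus b)} (hx : x ∈ weightU (nPlus b) γ) (hy : y ∈ weightU (nMinus b) (-β)) :
    twist b (vacuum b lam) x (vermaCan b lam y) = 0 := by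
  by_contra hne
  apply hγ
  ext h
  rw [twist_apply] at hne
  have hy' := lie_act_of_mem_weightU hy (lie_vermaOne_cartan (b := b) (lam := lam))
  rw [act_vermaOne, ← vermaCan_eq] at hy'
  have h₁ := congrArg (vacuum b lam) (lie_act_of_mem_weightU (ν := -β + lam)
    (antipode_mem_weightU hx) hy' h)
  rw [← antipode_inclU, vacuum_lie_cartan, map_smul, smul_eq_mul] at h₁
  have h₂ := mul_right_cancel₀ hne h₁
  simp only [LinearMap.add_apply, LinearMap.neg_apply] at h₂
  linear_combination -h₂

variable (b) in
/-- The map `x ↦ x ν` as a linear map. -/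
def twistHom {V : Type*} [AddCommGroup V] [Module ℂ V] [LieRingModule 𝔤 V] [LieModule ℂ 𝔤 V]
    (ν : Module.Dual ℂ V) : U (nPlus b) →ₗ[ℂ] Module.Dual ℂ V where
  toFun := twist b ν
  map_add' := twist_add ν
  map_smul' c x := twist_smul ν c x

/-- A vector in the kernel of the matrix gives an element of `M(lam)` on which all translates of the
vacuum vanish: those of weight `β` by assumption, the others by weight orthogonality. In an
irreducible Verma module it is zero. -/
theorem Generic.isUnit_pairing (hlam : Generic b lam) {β : Module.Dual ℂ H}
    (B : WeightBases b β) :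
    IsUnit (Matrix.of fun i j => pairing b lam (B.x i).1 (B.y j).1) := by
  rw [← Matrix.mulVec_injective_iff_isUnit, ← Matrix.coe_mulVecLin, injective_iff_map_eq_zero
    (Matrix.mulVecLin (Matrix.of fun i j => pairing b lam (B.x i).1 (B.y j).1))]
  intro c hc
  have hx : ∀ x : U (nPlus b), twist b (vacuum b lam) x
      (vermaCan b lam (∑ j, c j • B.y j : weightU (nMinus b) (-β)).1) = 0 := fun x => by
    refine LinearMap.congr_fun (f := LinearMap.applyₗ (R := ℂ) (vermaCan b lam _) ∘ₗ
      twistHom b (vacuum b lam)) (g := 0) ((basisPlus b).ext fun s => ?_) x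
    rw [basisPlus_apply]
    change twist b (vacuum b lam) (monPlus s) _ = 0
    by_cases hs : msWt s = β
    · subst hs
      have hB : ∀ i, twist b (vacuum b lam) (B.x i).1
          (vermaCan b lam (∑ j, c j • B.y j : weightU (nMinus b) (-msWt s)).1) = 0 := fun i => by
        have := congrFun hc i
        rw [Matrix.mulVecLin_apply, Matrix.mulVec, dotProduct] at this
        simp only [Matrix.of_apply, pairing_eq] at this
        rw [AddSubmonoidClass.coe_finsetSum, map_sum, map_sum]
        refine Eq.trans ?_ this
        refine Finset.sum_congr rfl fun j _ => ?_
        rw [Submodule.coe_smul, map_smul, map_smul, smul_eq_mul, mul_comm]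
        rfl
      exact LinearMap.congr_fun (f := LinearMap.applyₗ (R := ℂ) (vermaCan b lam _) ∘ₗ
        twistHom b (vacuum b lam) ∘ₗ (weightU (nPlus b) (msWt s)).subtype) (g := 0)
        (B.x.ext hB) ⟨monPlus s, monPlus_mem_weightU s⟩
    · exact twist_vacuum_eq_zero hs (monPlus_mem_weightU s) (Subtype.prop _)
  have h0 := hlam.eq_zero_of_twist hx
  rw [map_eq_zero_iff _ vermaCan_injective, Submodule.coe_eq_zero] at h0
  funext j
  exact Fintype.linearIndependent_iff.1 B.y.linearIndependent c h0 j

end WeightSpaces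

/-! ### Local finiteness of `F` -/

section LocallyFinite

variable {𝔤 : Type u} [LieRing 𝔤] [LieAlgebra ℂ 𝔤] [FiniteDimensional ℂ 𝔤]
  [LieAlgebra.IsSemisimple ℂ 𝔤] {H : LieSubalgebra ℂ 𝔤} [H.IsCartanSubalgebra]

/-- `F` as a subspace of the dual of `U L`. -/
def F.toDual (L : Type u) [LieRing L] [LieAlgebra ℂ L] : F L →ₗ[ℂ] Module.Dual ℂ (U L) :=
  (matrixElements L).subtype

theorem F.toDual_injective (L : Type u) [LieRing L] [LieAlgebra ℂ L] :
    Function.Injective (F.toDual L) := Subtype.val_injective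

theorem F.toDual_act {L : Type u} [LieRing L] [LieAlgebra ℂ L] (a : U L) (f : F L) :
    F.toDual L (act (F L) a f) = translate a (F.toDual L f) := by
  induction a using enveloping_induction generalizing f with
  | hc c =>
    ext x
    rw [AlgHom.commutes, Module.algebraMap_end_apply, map_smul, translate_apply,
      LinearMap.smul_apply, ← Algebra.commutes, ← Algebra.smul_def, map_smul]
  | hι x => rw [act_ι]; rfl
  | hmul a c ha hc =>
    rw [map_mul, Module.End.mul_apply, ha, hc]
    ext x
    rw [translate_apply, translate_apply, translate_apply, mul_assoc]
  | hadd a c ha hc =>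
    rw [map_add, LinearMap.add_apply, map_add, ha, hc]
    ext x
    rw [translate_apply, LinearMap.add_apply, translate_apply, translate_apply, mul_add, map_add]

/-- Translates of a matrix element stay in the span of the entries of the same row. -/
theorem exists_finite_translate {L : Type u} [LieRing L] [LieAlgebra ℂ L] (f : F L) :
    ∃ W : Submodule ℂ (Module.Dual ℂ (U L)), FiniteDimensional ℂ W ∧
      ∀ a, translate a (F.toDual L f) ∈ W := by
  have hf : F.toDual L f ∈ matrixElements L := Subtype.prop f
  generalize F.toDual L f = f at hf ⊢
  induction hf using Submodule.span_induction with
  | mem f hf =>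
    obtain ⟨n, ρ, i, j, h⟩ := hf
    let g : Fin n → Module.Dual ℂ (U L) := fun k => (Matrix.entryLinearMap ℂ ℂ i k).comp ρ.toLinearMap
    refine ⟨Submodule.span ℂ (Set.range g),
      FiniteDimensional.span_of_finite ℂ (Set.finite_range g), fun a => ?_⟩
    have : translate a f = ∑ k, ρ a k j • g k := by
      ext x
      simp [g, translate_apply, h, Matrix.mul_apply, mul_comm]
    rw [this]
    exact Submodule.sum_mem _ fun k _ => Submodule.smul_mem _ _ (Submodule.subset_span ⟨k, rfl⟩)
  | zero => exact ⟨⊥, inferInstance, fun a => by rw [map_zero]; exact Submodule.zero_mem _⟩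
  | add f g _ _ hf hg =>
    obtain ⟨W, hW, hf⟩ := hf
    obtain ⟨W', hW', hg⟩ := hg
    exact ⟨W ⊔ W', inferInstance, fun a => by
      rw [map_add]; exact Submodule.add_mem_sup (hf a) (hg a)⟩
  | smul c f _ hf =>
    obtain ⟨W, hW, hf⟩ := hf
    exact ⟨W, hW, fun a => by rw [map_smul]; exact Submodule.smul_mem _ _ (hf a)⟩

variable {b : (LieAlgebra.IsKilling.rootSystem H).Base}

/-- The nonzero vectors are eigenvectors of `principal` with the height as eigenvalue, and they lie
in a finite-dimensional space of translates. So finitely many heights occur, hence finitely many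
`s`. This makes the sum defining the fusion operator finite. -/
theorem finite_act_monPlus_ne_zero {u : F 𝔤} (hu : ∀ h : H, ⁅(h : 𝔤), u⁆ = 0) :
    {s : Multiset (PosRoot b) | act (F 𝔤) (inclU (nPlus b) (monPlus s)) u ≠ 0}.Finite := by
  obtain ⟨W, hW, hfW⟩ := exists_finite_translate u
  let S : Set ℕ := {n | ∃ s : Multiset (PosRoot b), msHeight s = n ∧
    act (F 𝔤) (inclU (nPlus b) (monPlus s)) u ≠ 0}
  have hS : S.Finite := by
    choose s hs hs' using fun n : S => n.2
    have h₁ : LinearIndependent ℂ fun n : S => act (F 𝔤) (inclU (nPlus b) (monPlus (s n))) u := by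
      refine Module.End.eigenvectors_linearIndependent'
        (LieModule.toEnd ℂ 𝔤 (F 𝔤) (principal b : 𝔤)) (fun n : S => ((n : ℕ) : ℂ))
        (Nat.cast_injective.comp Subtype.val_injective) _ fun n => ⟨?_, hs' n⟩
      rw [Module.End.mem_eigenspace_iff, LieModule.toEnd_apply_apply,
        lie_act_of_mem_weightU (ν := 0) (monPlus_mem_weightU (s n))
          (fun h => by rw [hu, LinearMap.zero_apply, zero_smul]), msWt_principal_eq, hs,
        LinearMap.zero_apply, add_zero]
    have h₂ : LinearIndependent ℂ fun n : S =>
        (⟨F.toDual 𝔤 (act (F 𝔤) (inclU (nPlus b) (monPlus (s n))) u), by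
          rw [F.toDual_act]; exact hfW _⟩ : W) :=
      LinearIndependent.of_comp W.subtype
        (h₁.map' (F.toDual 𝔤) (LinearMap.ker_eq_bot.2 (F.toDual_injective 𝔤)))
    exact Set.finite_coe_iff.1 h₂.finite
  obtain ⟨N, hN⟩ := hS.bddAbove
  refine (finite_msWt_principal_le N).subset fun s hs => ?_
  exact ⟨msHeight s, hN ⟨s, rfl, hs⟩, msWt_principal_eq s⟩

theorem finite_act_weightU_ne_zero {u : F 𝔤} (hu : ∀ h : H, ⁅(h : 𝔤), u⁆ = 0) :
    {β : Module.Dual ℂ H | ∃ x ∈ weightU (nPlus b) β,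
      act (F 𝔤) (inclU (nPlus b) x) u ≠ 0}.Finite := by
  refine ((finite_act_monPlus_ne_zero (b := b) hu).image msWt).subset ?_
  rintro β ⟨x, hx, hne⟩
  by_contra hβ
  apply hne
  have h := mem_span_of_mem_weightU (basisPlus b) inclU_nPlus_injective (wt := msWt)
    (fun s => by rw [basisPlus_apply]; exact monPlus_mem_weightU s) hx
  clear hx hne
  induction h using Submodule.span_induction with
  | mem x hx =>
    obtain ⟨s, hs, rfl⟩ := hx
    rw [basisPlus_apply]
    by_contra hne
    exact hβ ⟨s, hne, hs⟩
  | zero => rw [map_zero, map_zero, LinearMap.zero_apply]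
  | add x y _ _ hx hy => rw [map_add, map_add, LinearMap.add_apply, hx, hy, add_zero]
  | smul c x _ hx => rw [map_smul, map_smul, LinearMap.smul_apply, hx, smul_zero]

end LocallyFinite

/-! ### The fusion operator -/

section Fusion

variable {𝔤 : Type u} [LieRing 𝔤] [LieAlgebra ℂ 𝔤] [FiniteDimensional ℂ 𝔤]
  [LieAlgebra.IsSemisimple ℂ 𝔤] {H : LieSubalgebra ℂ 𝔤} [H.IsCartanSubalgebra]
  {b : (LieAlgebra.IsKilling.rootSystem H).Base} {lam : Module.Dual ℂ H}
  {M : Type*} [AddCommGroup M] [Module ℂ M] [LieRingModule (nMinus b) M]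
  [LieModule ℂ (nMinus b) M]
  {N : Type*} [AddCommGroup N] [Module ℂ N] [LieRingModule (nMinus b) N]
  [LieModule ℂ (nMinus b) N]

variable (b lam M) in
/-- The component of weight `(-β, β)` of the fusion operator. -/
def fusionTerm (β : Module.Dual ℂ H) : M ⊗[ℂ] F 𝔤 →ₗ[ℂ] M ⊗[ℂ] F 𝔤 :=
  TensorProduct.homTensorHomMap (RingHom.id ℂ) M (F 𝔤) M (F 𝔤)
    (TensorProduct.map (act M).toLinearMap (act (F 𝔤)).toLinearMap (fusionComponent b lam β))

theorem fusionOp_eq (w : M ⊗[ℂ] F 𝔤) :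
    fusionOp b lam M w = w + ∑ᶠ β ∈ QPlus b, fusionTerm b lam M β w := rfl

variable (b lam) in
theorem exists_fusionTerm_tmul (β : Module.Dual ℂ H) : ∃ B : WeightBases b β,
    ∀ (M : Type u) [AddCommGroup M] [Module ℂ M] [LieRingModule (nMinus b) M]
      [LieModule ℂ (nMinus b) M] (m : M) (f : F 𝔤), fusionTerm b lam M β (m ⊗ₜ[ℂ] f) =
        ∑ i, ∑ j, (Matrix.of fun i j => pairing b lam (B.x i).1 (B.y j).1)⁻¹ i j •
          (act M (B.y i).1 m ⊗ₜ[ℂ] act (F 𝔤) (inclU (nPlus b) (B.x j).1) f) := by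
  refine ⟨(nonempty_weightBases β).some, fun M _ _ _ _ m f => ?_⟩
  rw [fusionTerm, fusionComponent, dif_pos (nonempty_weightBases β), fusionElement]
  simp only [map_sum, map_smul, TensorProduct.map_tmul, LinearMap.sum_apply, LinearMap.smul_apply,
    TensorProduct.homTensorHomMap_apply, AlgHom.toLinearMap_apply, act_inclU]

theorem rTensor_fusionTerm (g : M →ₗ[ℂ] N) (hg : ∀ (y : nMinus b) (m : M), g ⁅y, m⁆ = ⁅y, g m⁆)
    (β : Module.Dual ℂ H) (w : M ⊗[ℂ] F 𝔤) :
    g.rTensor (F 𝔤) (fusionTerm b lam M β w) = fusionTerm b lam N β (g.rTensor (F 𝔤) w) := by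
  rw [fusionTerm, fusionTerm]
  generalize fusionComponent b lam β = c
  induction c using TensorProduct.induction_on with
  | zero => simp
  | add c d hc hd =>
    rw [map_add, map_add, LinearMap.add_apply, map_add, hc, hd, map_add, map_add,
      LinearMap.add_apply]
  | tmul y x =>
    induction w using TensorProduct.induction_on with
    | zero => simp
    | add w w' hw hw' => simp only [map_add, hw, hw']
    | tmul m f =>
      simp only [TensorProduct.map_tmul, TensorProduct.homTensorHomMap_apply,
        LinearMap.rTensor_tmul, AlgHom.toLinearMap_apply, act_equivariant g hg]

theorem finite_fusionTerm (lam : Module.Dual ℂ H) {M : Type u} [AddCommGroup M] [Module ℂ M]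
    [LieRingModule (nMinus b) M] [LieModule ℂ (nMinus b) M] (m : M) {u : F 𝔤}
    (hu : ∀ h : H, ⁅(h : 𝔤), u⁆ = 0) :
    (QPlus b ∩ Function.support fun β => fusionTerm b lam M β (m ⊗ₜ[ℂ] u)).Finite := by
  refine (finite_act_weightU_ne_zero (b := b) hu).subset ?_
  rintro β ⟨-, hβ⟩
  obtain ⟨B, hB⟩ := exists_fusionTerm_tmul b lam β
  by_contra hne
  apply hβ
  refine (hB M m u).trans ?_
  refine Finset.sum_eq_zero fun i _ => Finset.sum_eq_zero fun j _ => ?_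
  have : act (F 𝔤) (inclU (nPlus b) (B.x j).1) u = 0 := by
    by_contra h
    exact hne ⟨_, (B.x j).2, h⟩
  rw [this, TensorProduct.tmul_zero, smul_zero]

theorem map_fusionOp {M : Type u} [AddCommGroup M] [Module ℂ M]
    [LieRingModule (nMinus b) M] [LieModule ℂ (nMinus b) M] (m : M) {u : F 𝔤}
    (hu : ∀ h : H, ⁅(h : 𝔤), u⁆ = 0) {W : Type*} [AddCommGroup W] [Module ℂ W]
    (g : M ⊗[ℂ] F 𝔤 →ₗ[ℂ] W) :
    g (fusionOp b lam M (m ⊗ₜ[ℂ] u)) =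
      g (m ⊗ₜ[ℂ] u) + ∑ᶠ β ∈ QPlus b, g (fusionTerm b lam M β (m ⊗ₜ[ℂ] u)) := by
  rw [fusionOp_eq, map_add]
  congr 1
  exact AddMonoidHom.map_finsum_mem' g.toAddMonoidHom (finite_fusionTerm lam m hu)

/-- Only `U𝔫₋` acts on the first factor, so `𝔫₋`-linearity of `g` is enough. Applied to `y ↦
y·1_lam`, it relates the fixed module `U𝔫₋` to the varying modules `M(lam)`. -/
theorem rTensor_fusionOp {M N : Type u} [AddCommGroup M] [Module ℂ M]
    [LieRingModule (nMinus b) M] [LieModule ℂ (nMinus b) M] [AddCommGroup N] [Module ℂ N]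
    [LieRingModule (nMinus b) N] [LieModule ℂ (nMinus b) N] (g : M →ₗ[ℂ] N)
    (hg : ∀ (y : nMinus b) (m : M), g ⁅y, m⁆ = ⁅y, g m⁆) (m : M) {u : F 𝔤}
    (hu : ∀ h : H, ⁅(h : 𝔤), u⁆ = 0) :
    g.rTensor (F 𝔤) (fusionOp b lam M (m ⊗ₜ[ℂ] u)) = fusionOp b lam N (g m ⊗ₜ[ℂ] u) := by
  rw [map_fusionOp m hu, fusionOp_eq]
  simp only [rTensor_fusionTerm g hg, LinearMap.rTensor_tmul]

/-- The fusion component is the canonical element of the pairing in weight `β`: contracting with the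
basis vector `x_k` produces row `k` of `P P⁻¹ = 1`, which leaves `x_k·u`. Other weights vanish by
orthogonality. -/
theorem contract_fusionTerm (hlam : Generic b lam) (β : Module.Dual ℂ H) (u : F 𝔤)
    (s : Multiset (PosRoot b)) [Decidable (msWt s = β)] :
    contract (twist b (vacuum b lam) (monPlus s))
      (fusionTerm b lam (Verma b lam) β (vermaOne b lam ⊗ₜ[ℂ] u)) =
        if msWt s = β then act (F 𝔤) (inclU (nPlus b) (monPlus s)) u else 0 := by
  obtain ⟨B, hB⟩ := exists_fusionTerm_tmul b lam β
  have hy : ∀ i, act (Verma b lam) (B.y i).1 (vermaOne b lam) = vermaCan b lam (B.y i).1 :=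
    fun i => rfl
  rw [hB (Verma b lam)]
  simp only [hy, map_sum, map_smul, contract_tmul]
  split_ifs with hs
  · subst hs
    have hunit := hlam.isUnit_pairing B
    generalize hP : (Matrix.of fun i j => pairing b lam (B.x i).1 (B.y j).1) = P at hunit
    have hP' : ∀ k i, twist b (vacuum b lam) (B.x k).1 (vermaCan b lam (B.y i).1) = P k i :=
      fun k i => by rw [← hP, Matrix.of_apply, pairing_eq]; rfl
    -- Both sides are made linear in the element of `U𝔫₊`, so that the identity is checked on the
    -- basis `B.x` and then read at `monPlus s`.
    let L : U (nPlus b) →ₗ[ℂ] F 𝔤 := ∑ i, ∑ j, P⁻¹ i j •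
      (LinearMap.toSpanSingleton ℂ (F 𝔤) (act (F 𝔤) (inclU (nPlus b) (B.x j).1) u) ∘ₗ
        LinearMap.applyₗ (R := ℂ) (vermaCan b lam (B.y i).1) ∘ₗ twistHom b (vacuum b lam))
    let R : U (nPlus b) →ₗ[ℂ] F 𝔤 := LinearMap.applyₗ (R := ℂ) u ∘ₗ
      (act (F 𝔤)).toLinearMap ∘ₗ (inclU (nPlus b)).toLinearMap
    have hL : ∀ x, L x = ∑ i, ∑ j, P⁻¹ i j • twist b (vacuum b lam) x
        (vermaCan b lam (B.y i).1) • act (F 𝔤) (inclU (nPlus b) (B.x j).1) u := fun x => by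
      simp only [L, LinearMap.sum_apply]; rfl
    rw [← hL]
    refine LinearMap.congr_fun (f := L ∘ₗ (weightU (nPlus b) (msWt s)).subtype)
      (g := R ∘ₗ (weightU (nPlus b) (msWt s)).subtype) (B.x.ext fun k => ?_)
      ⟨monPlus s, monPlus_mem_weightU s⟩
    change L (B.x k).1 = act (F 𝔤) (inclU (nPlus b) (B.x k).1) u
    rw [hL, Finset.sum_comm]
    simp only [hP', smul_smul, ← Finset.sum_smul, mul_comm (P⁻¹ _ _)]
    have h1 : ∀ j, ∑ i, P k i * P⁻¹ i j = (1 : Matrix _ _ ℂ) k j := fun j => by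
      rw [← Matrix.mul_nonsing_inv P ((Matrix.isUnit_iff_isUnit_det P).1 hunit), Matrix.mul_apply]
    simp only [h1, Matrix.one_apply, ite_smul, one_smul, zero_smul, Finset.sum_ite_eq,
      Finset.mem_univ, if_true]
  · refine Finset.sum_eq_zero fun i _ => Finset.sum_eq_zero fun j _ => ?_
    rw [twist_vacuum_eq_zero hs (monPlus_mem_weightU s) (B.y i).2, zero_smul, smul_zero]

/-- On a PBW monomial only one term survives: the leading `1 ⊗ u` when `s = 0`, and the component
with `β = msWt s` otherwise. -/
theorem contract_fusionOp (hlam : Generic b lam) {u : F 𝔤} (hu : ∀ h : H, ⁅(h : 𝔤), u⁆ = 0)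
    (x : U (nPlus b)) :
    contract (twist b (vacuum b lam) x)
      (fusionOp b lam (Verma b lam) (vermaOne b lam ⊗ₜ[ℂ] u)) =
        act (F 𝔤) (inclU (nPlus b) x) u := by
  classical
  let C : U (nPlus b) →ₗ[ℂ] F 𝔤 :=
    { toFun := fun x => contract (twist b (vacuum b lam) x)
        (fusionOp b lam (Verma b lam) (vermaOne b lam ⊗ₜ[ℂ] u))
      map_add' := fun x y => by rw [twist_add, contract_add]
      map_smul' := fun c x => by rw [twist_smul, contract_smul]; rfl }
  refine LinearMap.congr_fun (f := C) (g := LinearMap.applyₗ (R := ℂ) u ∘ₗ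
    (act (F 𝔤)).toLinearMap ∘ₗ (inclU (nPlus b)).toLinearMap) ((basisPlus b).ext fun s => ?_) x
  rw [basisPlus_apply]
  change contract (twist b (vacuum b lam) (monPlus s)) _ =
    act (F 𝔤) (inclU (nPlus b) (monPlus s)) u
  rw [map_fusionOp _ hu, contract_tmul]
  simp only [contract_fusionTerm hlam]
  by_cases hs : s = 0
  · subst hs
    rw [monPlus_zero, twist_one, vacuum_one, one_smul, map_one, map_one, Module.End.one_apply,
      finsum_mem_eq_zero_of_forall_eq_zero, add_zero]
    intro β hβ
    rw [msWt_zero, if_neg]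
    exact fun h => hβ.2 h.symm
  · have h1 : (1 : U (nMinus b)) ∈ weightU (nMinus b) (-(0 : Module.Dual ℂ H)) := by
      rw [neg_zero]; exact one_mem_weightU
    rw [← vermaCan_one, twist_vacuum_eq_zero (msWt_ne_zero hs) (monPlus_mem_weightU s) h1,
      zero_smul, zero_add, finsum_eq_single _ (msWt s), finsum_eq_if,
      if_pos (msWt_mem_QPlus hs), if_pos rfl]
    intro β hβ
    rw [if_neg hβ.symm, finsum_zero]

theorem lie_fusionOp_nPlus (hlam : Generic b lam) {u : F 𝔤} (hu : ∀ h : H, ⁅(h : 𝔤), u⁆ = 0)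
    {e : 𝔤} (he : e ∈ nPlus b) :
    ⁅e, fusionOp b lam (Verma b lam) (vermaOne b lam ⊗ₜ[ℂ] u)⁆ = 0 :=
  singular_of_contract_twist (fun _ hv => hlam.eq_zero_of_twist hv)
    (contract_fusionOp hlam hu) he

theorem lie_fusionOp_cartan (hlam : Generic b lam) {u : F 𝔤}
    (hu : ∀ h : H, ⁅(h : 𝔤), u⁆ = 0) (h : H) :
    ⁅(h : 𝔤), fusionOp b lam (Verma b lam) (vermaOne b lam ⊗ₜ[ℂ] u)⁆ =
      lam h • fusionOp b lam (Verma b lam) (vermaOne b lam ⊗ₜ[ℂ] u) :=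
  weight_of_contract_twist (fun _ hv => hlam.eq_zero_of_twist hv) vacuum_lie_cartan hu
    (contract_fusionOp hlam hu) h

end Fusion

/-! ### Specialization of regular families -/

section Polynomial

variable {𝔤 : Type u} [LieRing 𝔤] [LieAlgebra ℂ 𝔤] [FiniteDimensional ℂ 𝔤]
  [LieAlgebra.IsSemisimple ℂ 𝔤] {H : LieSubalgebra ℂ 𝔤} [H.IsCartanSubalgebra]
  {W W' : Type*} [AddCommGroup W] [Module ℂ W] [AddCommGroup W'] [Module ℂ W']

/-- Polynomial functions on `𝔥*`. -/
def IsPoly (f : Module.Dual ℂ H → ℂ) : Prop :=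
  ∃ p : MvPolynomial H ℂ, ∀ lam, f lam = MvPolynomial.eval (fun h => lam h) p

/-- Weakly polynomial functions on `𝔥*` with values in a vector space. -/
def IsPolyVec (f : Module.Dual ℂ H → W) : Prop :=
  ∀ ξ : Module.Dual ℂ W, IsPoly fun lam => ξ (f lam)

omit [FiniteDimensional ℂ 𝔤] [LieAlgebra.IsSemisimple ℂ 𝔤] [H.IsCartanSubalgebra]

theorem isPoly_const (c : ℂ) : IsPoly (fun _ : Module.Dual ℂ H => c) :=
  ⟨MvPolynomial.C c, fun _ => by rw [MvPolynomial.eval_C]⟩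

theorem isPoly_apply (h : H) : IsPoly (fun lam : Module.Dual ℂ H => lam h) :=
  ⟨MvPolynomial.X h, fun _ => by rw [MvPolynomial.eval_X]⟩

theorem isPoly_eval (p : MvPolynomial H ℂ) :
    IsPoly (fun lam : Module.Dual ℂ H => MvPolynomial.eval (fun h => lam h) p) :=
  ⟨p, fun _ => rfl⟩

theorem IsPoly.add {f g : Module.Dual ℂ H → ℂ} (hf : IsPoly f) (hg : IsPoly g) :
    IsPoly fun lam => f lam + g lam := by
  obtain ⟨p, hp⟩ := hf
  obtain ⟨q, hq⟩ := hg
  exact ⟨p + q, fun lam => by simp only [hp, hq, map_add]⟩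

theorem IsPoly.sub {f g : Module.Dual ℂ H → ℂ} (hf : IsPoly f) (hg : IsPoly g) :
    IsPoly fun lam => f lam - g lam := by
  obtain ⟨p, hp⟩ := hf
  obtain ⟨q, hq⟩ := hg
  exact ⟨p - q, fun lam => by simp only [hp, hq, map_sub]⟩

theorem IsPoly.mul {f g : Module.Dual ℂ H → ℂ} (hf : IsPoly f) (hg : IsPoly g) :
    IsPoly fun lam => f lam * g lam := by
  obtain ⟨p, hp⟩ := hf
  obtain ⟨q, hq⟩ := hg
  exact ⟨p * q, fun lam => by simp only [hp, hq, map_mul]⟩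

theorem IsPoly.sum {ι : Type*} {s : Finset ι} {f : ι → Module.Dual ℂ H → ℂ}
    (hf : ∀ i ∈ s, IsPoly (f i)) : IsPoly fun lam => ∑ i ∈ s, f i lam := by
  choose! p hp using hf
  refine ⟨∑ i ∈ s, p i, fun lam => ?_⟩
  rw [map_sum]
  exact Finset.sum_congr rfl fun i hi => hp i hi lam

theorem isPolyVec_const (w : W) : IsPolyVec (fun _ : Module.Dual ℂ H => w) :=
  fun _ => isPoly_const _

theorem IsPolyVec.add {f g : Module.Dual ℂ H → W} (hf : IsPolyVec f) (hg : IsPolyVec g) :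
    IsPolyVec fun lam => f lam + g lam := fun ξ => by
  simp only [map_add]; exact (hf ξ).add (hg ξ)

theorem IsPolyVec.sub {f g : Module.Dual ℂ H → W} (hf : IsPolyVec f) (hg : IsPolyVec g) :
    IsPolyVec fun lam => f lam - g lam := fun ξ => by
  simp only [map_sub]; exact (hf ξ).sub (hg ξ)

theorem IsPoly.smul {f : Module.Dual ℂ H → ℂ} {g : Module.Dual ℂ H → W} (hf : IsPoly f)
    (hg : IsPolyVec g) : IsPolyVec fun lam => f lam • g lam := fun ξ => by
  simp only [map_smul, smul_eq_mul]; exact hf.mul (hg ξ)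

theorem IsPolyVec.map {f : Module.Dual ℂ H → W} (hf : IsPolyVec f) (g : W →ₗ[ℂ] W') :
    IsPolyVec fun lam => g (f lam) := fun ξ => hf (ξ ∘ₗ g)

end Polynomial

/-! ### Regular families, their limits, and limits of singular vectors. -/

section Limit

variable {𝔤 : Type u} [LieRing 𝔤] [LieAlgebra ℂ 𝔤] [FiniteDimensional ℂ 𝔤]
  [LieAlgebra.IsSemisimple ℂ 𝔤] {H : LieSubalgebra ℂ 𝔤} [H.IsCartanSubalgebra]
  {b : (LieAlgebra.IsKilling.rootSystem H).Base}

theorem isPoly_evalCartan (z : U H) :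
    IsPoly fun lam : Module.Dual ℂ H => evalCartan lam z := by
  induction z using enveloping_induction with
  | hc c => simp only [AlgHom.commutes]; exact isPoly_const _
  | hι h => simp only [evalCartan_ι]; exact isPoly_apply h
  | hmul a c ha hc => simp only [map_mul]; exact ha.mul hc
  | hadd a c ha hc => simp only [map_add]; exact ha.add hc

/-- The weight enters only through evaluation of the Cartan factor of a triangular product. -/
theorem isPolyVec_vermaProj (a : U 𝔤) : IsPolyVec fun lam => vermaProj b lam a := by
  have ha : a ∈ Submodule.span ℂ (Set.range (monTri (b := b))) := by
    rw [span_monTri]; exact Submodule.mem_top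
  induction ha using Submodule.span_induction with
  | mem a ha =>
    obtain ⟨p, rfl⟩ := ha
    simp only [monTri, vermaProj_tri]
    exact ((isPoly_evalCartan _).mul (isPoly_const _)).smul (isPolyVec_const _)
  | zero => simp only [map_zero]; exact isPolyVec_const _
  | add a c _ _ ha hc => simp only [map_add]; exact ha.add hc
  | smul r a _ ha => simp only [map_smul]; exact (isPoly_const r).smul ha

variable (b) in
/-- The action of `a ∈ 𝔤` on `U𝔫₋ ⊗ E` obtained from `M(lam) ⊗ E` by identifying `M(lam)` with
`U𝔫₋`. -/
def vermaTensorAct (lam : Module.Dual ℂ H) (E : Type*) [AddCommGroup E] [Module ℂ E]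
    [LieRingModule 𝔤 E] [LieModule ℂ 𝔤 E] (a : 𝔤) :
    U (nMinus b) ⊗[ℂ] E →ₗ[ℂ] U (nMinus b) ⊗[ℂ] E :=
  (vermaProj b lam ∘ₗ LinearMap.mulLeft ℂ (UniversalEnvelopingAlgebra.ι ℂ a) ∘ₗ
    (inclU (nMinus b)).toLinearMap).rTensor E + (LieModule.toEnd ℂ 𝔤 E a).lTensor _

theorem rTensor_vermaTensorAct {lam : Module.Dual ℂ H} {E : Type*} [AddCommGroup E] [Module ℂ E]
    [LieRingModule 𝔤 E] [LieModule ℂ 𝔤 E] (a : 𝔤) (w : U (nMinus b) ⊗[ℂ] E) :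
    (vermaCan b lam).rTensor E (vermaTensorAct b lam E a w) =
      ⁅a, (vermaCan b lam).rTensor E w⁆ := by
  induction w using TensorProduct.induction_on with
  | zero => simp
  | add w w' h h' => rw [map_add, map_add, h, h', map_add, lie_add]
  | tmul y f =>
    rw [vermaTensorAct, LinearMap.add_apply, LinearMap.rTensor_tmul, LinearMap.lTensor_tmul,
      map_add, LinearMap.rTensor_tmul, LinearMap.rTensor_tmul, LinearMap.rTensor_tmul,
      TensorProduct.LieModule.lie_tmul_right, LinearMap.comp_apply, vermaCan_vermaProj,
      ← act_ι (L := 𝔤) (Verma b lam), vermaCan_eq, act_vermaMk]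
    rfl

theorem isPolyVec_vermaTensorAct {E : Type*} [AddCommGroup E] [Module ℂ E]
    [LieRingModule 𝔤 E] [LieModule ℂ 𝔤 E] (a : 𝔤) (w : U (nMinus b) ⊗[ℂ] E) :
    IsPolyVec fun lam => vermaTensorAct b lam E a w := by
  induction w using TensorProduct.induction_on with
  | zero => simp only [map_zero]; exact isPolyVec_const _
  | add w w' h h' => simp only [map_add]; exact h.add h'
  | tmul y f =>
    exact ((isPolyVec_vermaProj _).map ((TensorProduct.mk ℂ (U (nMinus b)) E).flip f)).add
      (isPolyVec_const _)

theorem isPolyVec_vermaTensorAct_sub {E : Type*} [AddCommGroup E] [Module ℂ E]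
    [LieRingModule 𝔤 E] [LieModule ℂ 𝔤 E] (h : H) (w : U (nMinus b) ⊗[ℂ] E) :
    IsPolyVec fun lam =>
      (vermaTensorAct b lam E (h : 𝔤) -
        lam h • (LinearMap.id : U (nMinus b) ⊗[ℂ] E →ₗ[ℂ] U (nMinus b) ⊗[ℂ] E)) w := by
  simp only [LinearMap.sub_apply, LinearMap.smul_apply, LinearMap.id_apply]
  exact (isPolyVec_vermaTensorAct (h : 𝔤) w).sub ((isPoly_apply h).smul (isPolyVec_const w))

theorem rTensor_vermaCan_injective {lam : Module.Dual ℂ H} (E : Type*) [AddCommGroup E]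
    [Module ℂ E] : Function.Injective ((vermaCan b lam).rTensor E) :=
  Module.Flat.rTensor_preserves_injective_linearMap _ vermaCan_injective

section Value

variable {W : Type*} [AddCommGroup W] [Module ℂ W]

/-- The value at `lam` of a polynomial function with values in a vector space. -/
def polyVal (P : W →₀ MvPolynomial H ℂ) (lam : Module.Dual ℂ H) : W :=
  P.sum fun w p => MvPolynomial.eval (fun h => lam h) p • w

/-- Polynomial identities satisfied by a rational family at generic points hold at every regular
point. -/
theorem map_polyVal_eq {W' : Type*} [AddCommGroup W'] [Module ℂ W'] {q : MvPolynomial H ℂ}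
    {P : W →₀ MvPolynomial H ℂ} {X : Module.Dual ℂ H → W}
    (hX : ∀ lam, Generic b lam →
      MvPolynomial.eval (fun h => lam h) q • X lam = polyVal P lam)
    {T : Module.Dual ℂ H → W →ₗ[ℂ] W'} (hT : ∀ w, IsPolyVec fun lam => T lam w) {v : W'}
    (hTX : ∀ lam, Generic b lam → T lam (X lam) = v) (lam : Module.Dual ℂ H) :
    T lam (polyVal P lam) = MvPolynomial.eval (fun h => lam h) q • v := by
  -- Testing with functionals reduces the identity to a scalar polynomial in `lam` that vanishes at
  -- generic weights, where `q X` equals the polynomial family.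
  rw [← sub_eq_zero, ← Module.forall_dual_apply_eq_zero_iff ℂ]
  intro ξ
  have hpoly : IsPoly fun lam => ξ (T lam (polyVal P lam) -
      MvPolynomial.eval (fun h => lam h) q • v) := by
    simp only [polyVal, Finsupp.sum, map_sub, map_sum, map_smul, smul_eq_mul]
    exact (IsPoly.sum fun w _ => (isPoly_eval _).mul (hT w ξ)).sub
      ((isPoly_eval q).mul (isPoly_const _))
  obtain ⟨p, hp⟩ : ∃ p : MvPolynomial H ℂ, ∀ lam, _ = _ := hpoly
  rw [hp]
  refine eval_eq_zero_of_generic (b := b) p (fun lam hlam => ?_) lam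
  rw [← hp, ← hX lam hlam, map_smul, hTX lam hlam, sub_self, map_zero]

/-- Near `lam₀` the denominator does not vanish, so at generic weights the family stays in the span
of the finite support of `P`, with continuous coefficients. -/
theorem tendstoFin_polyVal {q : MvPolynomial H ℂ}
    {P : W →₀ MvPolynomial H ℂ} {X : Module.Dual ℂ H → W}
    (hX : ∀ lam, Generic b lam →
      MvPolynomial.eval (fun h => lam h) q • X lam = polyVal P lam)
    {lam₀ : Module.Dual ℂ H} (hq : MvPolynomial.eval (fun h => lam₀ h) q ≠ 0) :
    TendstoFin X (genericNhds b lam₀)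
      ((MvPolynomial.eval (fun h => lam₀ h) q)⁻¹ • polyVal P lam₀) := by
  have hcont : ∀ p : MvPolynomial H ℂ, Tendsto
      (fun lam : Module.Dual ℂ H => MvPolynomial.eval (fun h => lam h) p) (genericNhds b lam₀)
      (𝓝 (MvPolynomial.eval (fun h => lam₀ h) p)) := fun p =>
    ((MvPolynomial.continuous_eval p).tendsto _).comp (tendsto_comap.mono_left inf_le_left)
  have hev : ∀ᶠ lam in genericNhds b lam₀,
      X lam = (MvPolynomial.eval (fun h => lam h) q)⁻¹ • polyVal P lam := by
    have hgen : ∀ᶠ lam in genericNhds b lam₀, Generic b lam :=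
      mem_inf_of_right (mem_principal_self _)
    filter_upwards [(hcont q).eventually_ne hq, hgen] with lam h₁ h₂
    rw [← hX lam h₂, smul_smul, inv_mul_cancel₀ h₁, one_smul]
  refine ⟨⟨Submodule.span ℂ (P.support : Set W),
    FiniteDimensional.span_finset ℂ P.support, hev.mono fun lam h => ?_⟩, fun ξ => ?_⟩
  · rw [h]
    exact Submodule.smul_mem _ _ (Submodule.sum_mem _ fun w hw =>
      Submodule.smul_mem _ _ (Submodule.subset_span hw))
  · refine Tendsto.congr' (hev.mono fun lam h => (congrArg ξ h).symm) ?_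
    simp only [polyVal, Finsupp.sum, map_sum, map_smul, smul_eq_mul]
    exact ((hcont q).inv₀ hq).mul (tendsto_finsetSum _ fun w _ => (hcont _).mul_const _)

end Value

/-- `U L` as an `L`-module under left multiplication. -/
@[reducible] def leftRegularLieRingModule (L : Type u) [LieRing L] [LieAlgebra ℂ L] :
    LieRingModule L (U L) where
  bracket x a := UniversalEnvelopingAlgebra.ι ℂ x * a
  add_lie x y a := by rw [map_add, add_mul]
  lie_add x a c := mul_add _ _ _
  leibniz_lie x y a := by
    change UniversalEnvelopingAlgebra.ι ℂ x * (UniversalEnvelopingAlgebra.ι ℂ y * a) =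
      UniversalEnvelopingAlgebra.ι ℂ ⁅x, y⁆ * a +
        UniversalEnvelopingAlgebra.ι ℂ y * (UniversalEnvelopingAlgebra.ι ℂ x * a)
    rw [LieHom.map_lie, LieRing.of_associative_ring_bracket, sub_mul, mul_assoc, mul_assoc,
      sub_add_cancel]

attribute [local instance] leftRegularLieRingModule

theorem leftRegularLieModule (L : Type u) [LieRing L] [LieAlgebra ℂ L] :
    LieModule ℂ L (U L) where
  smul_lie c x a := by
    change UniversalEnvelopingAlgebra.ι ℂ (c • x) * a = c • (UniversalEnvelopingAlgebra.ι ℂ x * a)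
    rw [map_smul, smul_mul_assoc]
  lie_smul c x a := mul_smul_comm _ _ _

attribute [local instance] leftRegularLieModule

theorem vermaCan_lie {lam : Module.Dual ℂ H} (y : nMinus b) (a : U (nMinus b)) :
    vermaCan b lam ⁅y, a⁆ = ⁅y, vermaCan b lam a⁆ := by
  change vermaCan b lam (UniversalEnvelopingAlgebra.ι ℂ y * a) = _
  rw [vermaCan_mul, inclU_ι, act_ι]
  rfl

/-- The limit of the fusion operator applied to an invariant vector is a singular vector. -/
theorem exists_limit_fusionOp {lam₀ : Module.Dual ℂ H} (hreg : GoodRegularity b lam₀) {u : F 𝔤}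
    (hu : u ∈ FInv b lam₀) :
    ∃ (X : Module.Dual ℂ H → U (nMinus b) ⊗[ℂ] F 𝔤) (Z : U (nMinus b) ⊗[ℂ] F 𝔤),
      (∀ lam, (vermaCan b lam).rTensor (F 𝔤) (X lam) =
        fusionOp b lam (Verma b lam) (vermaOne b lam ⊗ₜ[ℂ] u)) ∧
      TendstoFin X (genericNhds b lam₀) Z ∧
      (∀ e ∈ nPlus b, ⁅e, (vermaCan b lam₀).rTensor (F 𝔤) Z⁆ = 0) ∧
      (∀ h : H, ⁅(h : 𝔤), (vermaCan b lam₀).rTensor (F 𝔤) Z⁆ =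
        lam₀ h • (vermaCan b lam₀).rTensor (F 𝔤) Z) ∧
      contract (vacuum b lam₀) ((vermaCan b lam₀).rTensor (F 𝔤) Z) = u := by
  -- Good regularity is used for a single module, `U𝔫₋` under left multiplication, which does not
  -- depend on `lam` and maps onto every Verma module.
  obtain ⟨q, P, hq, hX⟩ := hreg (U (nMinus b)) 1 u hu
  change ∀ lam, Generic b lam → _ = polyVal P lam at hX
  have hnat : ∀ lam, (vermaCan b lam).rTensor (F 𝔤)
      (fusionOp b lam (U (nMinus b)) (1 ⊗ₜ[ℂ] u)) =
        fusionOp b lam (Verma b lam) (vermaOne b lam ⊗ₜ[ℂ] u) := fun lam => by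
    rw [rTensor_fusionOp (vermaCan b lam) vermaCan_lie 1 hu.1, vermaCan_one]
  -- Under the identification with `U𝔫₋` the vacuum functional becomes the counit, independent of
  -- `lam`, so the leading coefficient survives specialization.
  have hvac : ∀ (lam : Module.Dual ℂ H) (w : U (nMinus b) ⊗[ℂ] F 𝔤),
      contract (vacuum b lam) ((vermaCan b lam).rTensor (F 𝔤) w) =
        contract (counit (nMinus b)).toLinearMap w := fun lam w => by
    rw [contract_rTensor]
    congr 2
    exact LinearMap.ext vacuum_vermaCan
  refine ⟨_, _, hnat, tendstoFin_polyVal hX hq, fun e he => ?_, fun h => ?_, ?_⟩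
  -- Annihilation by `e`, transported to `U𝔫₋ ⊗ F`, is an equation polynomial in `lam`; it passes
  -- from generic weights to `lam₀`.
  · have h₁ := map_polyVal_eq hX (T := fun lam => vermaTensorAct b lam (F 𝔤) e)
      (isPolyVec_vermaTensorAct e) (v := 0) (fun lam hlam => by
        apply rTensor_vermaCan_injective (b := b) (lam := lam)
        rw [rTensor_vermaTensorAct, hnat, lie_fusionOp_nPlus hlam hu.1 he, map_zero]) lam₀
    rw [← rTensor_vermaTensorAct, map_smul, h₁, smul_zero, smul_zero, map_zero]
  · have h₁ := map_polyVal_eq hX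
      (T := fun lam => vermaTensorAct b lam (F 𝔤) (h : 𝔤) -
        lam h • (LinearMap.id : U (nMinus b) ⊗[ℂ] F 𝔤 →ₗ[ℂ] U (nMinus b) ⊗[ℂ] F 𝔤))
      (isPolyVec_vermaTensorAct_sub h)
      (v := 0) (fun lam hlam => by
        apply rTensor_vermaCan_injective (b := b) (lam := lam)
        rw [LinearMap.sub_apply, map_sub, rTensor_vermaTensorAct, hnat,
          lie_fusionOp_cartan hlam hu.1, LinearMap.smul_apply, map_smul, LinearMap.id_apply, hnat,
          sub_self, map_zero]) lam₀
    rw [smul_zero, LinearMap.sub_apply, sub_eq_zero] at h₁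
    rw [← rTensor_vermaTensorAct, map_smul, h₁, LinearMap.smul_apply, LinearMap.id_apply,
      smul_comm, map_smul]
  · have h₁ := map_polyVal_eq hX
      (T := fun _ => contract (counit (nMinus b)).toLinearMap) (fun _ => isPolyVec_const _)
      (v := u) (fun lam hlam => by
        rw [← hvac lam, hnat, ← twist_one (vacuum b lam) (b := b), contract_fusionOp hlam hu.1,
          map_one, map_one]
        rfl) lam₀
    rw [hvac, map_smul, h₁, smul_smul, inv_mul_cancel₀ hq, one_smul]

end Limit

/-! ### Lifting homomorphisms -/

section Lifting

variable {𝔤 : Type u} [LieRing 𝔤] [LieAlgebra ℂ 𝔤] [FiniteDimensional ℂ 𝔤]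
  [LieAlgebra.IsSemisimple ℂ 𝔤] {H : LieSubalgebra ℂ 𝔤} [H.IsCartanSubalgebra]
  {b : (LieAlgebra.IsKilling.rootSystem H).Base} {lam : Module.Dual ℂ H}

theorem act_eq_zero_of_mem_vermaIdeal {N : Type*} [AddCommGroup N] [Module ℂ N]
    [LieRingModule 𝔤 N] [LieModule ℂ 𝔤 N] {w : N} (hw : ∀ e ∈ nPlus b, ⁅e, w⁆ = 0)
    (hw' : ∀ h : H, ⁅(h : 𝔤), w⁆ = lam h • w) {a : U 𝔤} (ha : a ∈ vermaIdeal b lam) :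
    act N a w = 0 := by
  induction ha using Submodule.span_induction with
  | mem a ha =>
    rcases ha with ⟨x, hx, rfl⟩ | ⟨h, rfl⟩
    · rw [act_ι, hw x hx]
    · rw [map_sub, LinearMap.sub_apply, act_ι, AlgHom.commutes, Module.algebraMap_end_apply, hw',
        sub_self]
  | zero => rw [map_zero, LinearMap.zero_apply]
  | add a c _ _ ha hc => rw [map_add, LinearMap.add_apply, ha, hc, add_zero]
  | smul c a _ ha => rw [smul_eq_mul, map_mul, Module.End.mul_apply, ha, map_zero]

/-- The homomorphism `M(lam) → N` defined by a singular vector of weight `lam`. -/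
def vermaHom {N : Type*} [AddCommGroup N] [Module ℂ N] [LieRingModule 𝔤 N] [LieModule ℂ 𝔤 N]
    (w : N) (hw : ∀ e ∈ nPlus b, ⁅e, w⁆ = 0) (hw' : ∀ h : H, ⁅(h : 𝔤), w⁆ = lam h • w) :
    Verma b lam →ₗ⁅ℂ, 𝔤⁆ N :=
  { ((vermaIdeal b lam).restrictScalars ℂ).liftQ
      ((LinearMap.applyₗ (R := ℂ) w) ∘ₗ (act N).toLinearMap)
      (fun _ ha => act_eq_zero_of_mem_vermaIdeal hw hw' ha) with
    map_lie' := fun {x m} => by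
      obtain ⟨a, rfl⟩ := vermaMk_surjective m
      rw [← act_ι (L := 𝔤), act_vermaMk]
      change act N (UniversalEnvelopingAlgebra.ι ℂ x * a) w = ⁅x, act N a w⁆
      rw [map_mul, Module.End.mul_apply, act_ι] }

theorem vermaHom_one {N : Type*} [AddCommGroup N] [Module ℂ N] [LieRingModule 𝔤 N]
    [LieModule ℂ 𝔤 N] (w : N) (hw : ∀ e ∈ nPlus b, ⁅e, w⁆ = 0)
    (hw' : ∀ h : H, ⁅(h : 𝔤), w⁆ = lam h • w) : vermaHom w hw hw' (vermaOne b lam) = w := by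
  change act N 1 w = w
  rw [map_one, Module.End.one_apply]

theorem verma_hom_ext {N : Type*} [AddCommGroup N] [Module ℂ N] [LieRingModule 𝔤 N]
    [LieModule ℂ 𝔤 N] {φ φ' : Verma b lam →ₗ⁅ℂ, 𝔤⁆ N}
    (h : φ (vermaOne b lam) = φ' (vermaOne b lam)) : φ = φ' := by
  refine LieModuleHom.ext fun m => ?_
  obtain ⟨a, rfl⟩ := vermaMk_surjective m
  rw [← act_vermaOne]
  have h₁ := act_equivariant φ.toLinearMap (fun x m => LieModuleHom.map_lie φ x m) a
    (vermaOne b lam)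
  have h₂ := act_equivariant φ'.toLinearMap (fun x m => LieModuleHom.map_lie φ' x m) a
    (vermaOne b lam)
  exact h₁.trans ((congrArg _ h).trans h₂.symm)

theorem counit_antipode {L : Type u} [LieRing L] [LieAlgebra ℂ L] (a : U L) :
    counit L (antipode L a) = counit L a := by
  induction a using enveloping_induction with
  | hc c => rw [antipode_algebraMap]
  | hι x => rw [antipode_ι, map_neg, counit_ι, neg_zero]
  | hmul a c ha hc => rw [antipode_mul, map_mul, map_mul, ha, hc, mul_comm]
  | hadd a c ha hc => rw [antipode_add, map_add, map_add, ha, hc]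

/-- Taking `y = 1` shows that the counit vanishes on `K̃`, so being invariant under `K̃` means being
annihilated by it. -/
theorem pairing_one (x : U (nPlus b)) : pairing b lam x 1 = counit (nPlus b) x := by
  rw [pairing_eq, vermaCan_one, antipode_inclU,
    act_inclU_of_singular fun _ hx => lie_vermaOne_nPlus hx, map_smul, vacuum_one,
    smul_eq_mul, mul_one, counit_antipode]

theorem twist_vacuumIrr_of_mem_KTilde {x : U (nPlus b)} (hx : x ∈ KTilde b lam) :
    twist b (vacuumIrr b lam) x = 0 := by
  ext v
  obtain ⟨m, rfl⟩ := irrProj_surjective v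
  obtain ⟨y, rfl⟩ := vermaCan_surjective m
  rw [twist_vacuumIrr, twist_apply, ← pairing_eq, hx y, LinearMap.zero_apply]

variable {ψ : Irr b lam →ₗ⁅ℂ, 𝔤⁆ Irr b lam ⊗[ℂ] F 𝔤}

variable (ψ) in
/-- The leading coefficient of the image of the highest weight vector. -/
def leadingCoeff : F 𝔤 :=
  contract (vacuumIrr b lam) (ψ (irrProj b lam (vermaOne b lam)))

theorem lie_highest_nPlus {e : 𝔤} (he : e ∈ nPlus b) :
    ⁅e, ψ (irrProj b lam (vermaOne b lam))⁆ = 0 := by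
  rw [← LieModuleHom.map_lie, ← LieModuleHom.map_lie, lie_vermaOne_nPlus he,
    map_zero, map_zero]

theorem lie_highest_cartan (h : H) : ⁅(h : 𝔤), ψ (irrProj b lam (vermaOne b lam))⁆ =
    lam h • ψ (irrProj b lam (vermaOne b lam)) := by
  rw [← LieModuleHom.map_lie, ← LieModuleHom.map_lie, lie_vermaOne_cartan,
    map_smul, map_smul]

theorem lie_leadingCoeff (h : H) : ⁅(h : 𝔤), leadingCoeff ψ⁆ = 0 := by
  have h₁ := contract_lie (vacuumIrr b lam) (h : 𝔤) (ψ (irrProj b lam (vermaOne b lam)))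
  have h₂ : vacuumIrr b lam ∘ₗ LieModule.toEnd ℂ 𝔤 (Irr b lam) (h : 𝔤) =
      lam h • vacuumIrr b lam := LinearMap.ext fun v => vacuumIrr_lie_cartan h v
  rw [lie_highest_cartan, map_smul, h₂, contract_smul] at h₁
  exact left_eq_add.1 h₁

/-- Since `ψ(1̄)` is singular, `x·u` is its contraction with `x` applied to the vacuum functional of
`V(lam)`. For `x` in `K̃` that functional is zero. -/
theorem leadingCoeff_mem_FInv : leadingCoeff ψ ∈ FInv b lam := by
  refine ⟨lie_leadingCoeff, fun x hx => ?_⟩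
  have h₁ := contract_twist_of_singular (b := b) (fun e he => lie_highest_nPlus (ψ := ψ) he)
    (vacuumIrr b lam) x
  -- The zero functional is written as `0 • 0` so that `contract_smul` evaluates the contraction to
  -- zero.
  rw [twist_vacuumIrr_of_mem_KTilde hx, ← zero_smul ℂ (0 : Module.Dual ℂ (Irr b lam)),
    contract_smul, zero_smul, act_inclU] at h₁
  rw [← pairing_one (lam := lam) x, hx 1, zero_smul]
  exact h₁.symm

/-- Expanding in images of PBW vectors, the contraction accounts for the term `s = 0`, and every
other term has weight `lam - msWt s` with `msWt s` in `QPlus`. -/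
theorem sub_tmul_contract_mem (w : Irr b lam ⊗[ℂ] F 𝔤) :
    w - irrProj b lam (vermaOne b lam) ⊗ₜ[ℂ] contract (vacuumIrr b lam) w ∈
      Submodule.span ℂ {w | ∃ β ∈ QPlus b, ∃ (v : Irr b lam) (f : F 𝔤),
        (∀ h : H, ⁅(h : 𝔤), v⁆ = (lam h - β h) • v) ∧ w = v ⊗ₜ[ℂ] f} := by
  induction w using TensorProduct.induction_on with
  | zero => simp
  | add w w' h h' =>
    rw [map_add, TensorProduct.tmul_add, add_sub_add_comm]
    exact Submodule.add_mem _ h h'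
  | tmul v f =>
    rw [contract_tmul]
    obtain ⟨m, rfl⟩ := irrProj_surjective v
    rw [vacuumIrr_irrProj]
    have hm : m ∈ Submodule.span ℂ (Set.range (basisVerma b lam)) := by
      rw [(basisVerma b lam).span_eq]; exact Submodule.mem_top
    induction hm using Submodule.span_induction with
    | mem m hm =>
      obtain ⟨s, rfl⟩ := hm
      by_cases hs : s = 0
      · rw [hs, basisVerma_zero, vacuum_one, one_smul, sub_self]
        exact Submodule.zero_mem _
      · rw [basisVerma_apply, vacuum_vermaCan, counit_monMinus hs, zero_smul,
          TensorProduct.tmul_zero, sub_zero]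
        refine Submodule.subset_span ⟨msWt s, msWt_mem_QPlus hs, _, f, fun h => ?_, rfl⟩
        rw [← LieModuleHom.map_lie, lie_vermaCan_monMinus, map_smul]
    | zero => simp
    | add m m' _ _ hm hm' =>
      rw [map_add, map_add, TensorProduct.add_tmul, add_smul, TensorProduct.tmul_add,
        add_sub_add_comm]
      exact Submodule.add_mem _ hm hm'
    | smul c m _ hm =>
      rw [map_smul, map_smul, smul_assoc, TensorProduct.tmul_smul,
        ← TensorProduct.smul_tmul', ← smul_sub]
      exact Submodule.smul_mem _ c hm

theorem isTheta_leadingCoeff : IsTheta b lam ψ (leadingCoeff ψ) :=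
  ⟨lie_leadingCoeff, sub_tmul_contract_mem _⟩

theorem contract_projF (w : Verma b lam ⊗[ℂ] F 𝔤) :
    contract (vacuumIrr b lam) (projF b lam w) = contract (vacuum b lam) w :=
  contract_rTensor (vacuumIrr b lam) (irrProj b lam).toLinearMap w

/-- Right exactness of the tensor product with `F`. -/
theorem mem_range_rTensor_of_projF {w : Verma b lam ⊗[ℂ] F 𝔤} (hw : projF b lam w = 0) :
    w ∈ LinearMap.range ((maxSub b lam).toSubmodule.subtype.rTensor (F 𝔤)) := by
  have hex : Function.Exact (maxSub b lam).toSubmodule.subtype (irrProj b lam).toLinearMap :=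
    LinearMap.exact_subtype_mkQ _
  exact (rTensor_exact (F 𝔤) hex irrProj_surjective w).1 hw

/-- A singular vector with the same leading coefficient as `ψ(1̄)` lifts `ψ`. -/
theorem exists_lift {w : Verma b lam ⊗[ℂ] F 𝔤} (hw : ∀ e ∈ nPlus b, ⁅e, w⁆ = 0)
    (hw' : ∀ h : H, ⁅(h : 𝔤), w⁆ = lam h • w)
    (hwu : contract (vacuum b lam) w = leadingCoeff ψ) :
    ∃ φ : homPreserving b lam, naturalMap b lam φ = ψ ∧ φ.1 (vermaOne b lam) = w := by
  -- Both vectors are singular in `V(lam) ⊗ F` with the same leading coefficient, and translates of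
  -- the vacuum separate points of `V(lam)`.
  have hproj : projF b lam w = ψ (irrProj b lam (vermaOne b lam)) := by
    rw [← sub_eq_zero]
    refine eq_zero_of_singular (b := b) (ν := vacuumIrr b lam)
      (fun v hv => irr_eq_zero_of_twist hv) (fun e he => ?_) ?_
    · rw [lie_sub, ← LieModuleHom.map_lie, hw e he, map_zero, lie_highest_nPlus he,
        sub_self]
    · rw [map_sub, contract_projF, hwu, leadingCoeff, sub_self]
  have hcomp : (projF b lam).comp (vermaHom w hw hw') = ψ.comp (irrProj b lam) := by
    refine verma_hom_ext ?_
    rw [LieModuleHom.comp_apply, LieModuleHom.comp_apply, vermaHom_one, hproj]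
  have hcomp' : ∀ m, projF b lam (vermaHom w hw hw' m) = ψ (irrProj b lam m) :=
    fun m => congrArg (fun f => f m) hcomp
  refine ⟨⟨vermaHom w hw hw', fun m hm => mem_range_rTensor_of_projF ?_⟩,
    LieModuleHom.ext fun v => ?_, vermaHom_one w hw hw'⟩
  -- Preservation of `K` comes for free: on `K` the composite with the projection equals `ψ` applied
  -- to zero.
  · have : irrProj b lam m = 0 :=
      (LieSubmodule.Quotient.mk_eq_zero' (N := maxSub b lam)).2 hm
    rw [hcomp', this, map_zero]
  · obtain ⟨m, rfl⟩ := irrProj_surjective v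
    rw [naturalMap_apply, hcomp']

end Lifting

end EquivQuant

end

/-! ### Surjectivity of the natural map. -/

open EquivQuant in
theorem mainTheorem11 {𝔤 : Type*} [LieRing 𝔤] [LieAlgebra ℂ 𝔤] [FiniteDimensional ℂ 𝔤]
    [LieAlgebra.IsSemisimple ℂ 𝔤] (H : LieSubalgebra ℂ 𝔤) [H.IsCartanSubalgebra]
    (b : (LieAlgebra.IsKilling.rootSystem H).Base) (lam₀ : Module.Dual ℂ H)
    (hreg : GoodRegularity b lam₀) :
    Function.Surjective (naturalMap b lam₀) ∧
    ∀ ψ : Irr b lam₀ →ₗ⁅ℂ, 𝔤⁆ Irr b lam₀ ⊗[ℂ] F 𝔤, ∃ u : F 𝔤, IsTheta b lam₀ ψ u ∧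
      ∃ φ : homPreserving b lam₀, naturalMap b lam₀ φ = ψ ∧
        ∃ (X : Module.Dual ℂ H → U (nMinus b) ⊗[ℂ] F 𝔤) (Z : U (nMinus b) ⊗[ℂ] F 𝔤),
          (∀ lam, Generic b lam → (vermaCan b lam).rTensor (F 𝔤) (X lam) =
            fusionOp b lam (Verma b lam) (vermaOne b lam ⊗ₜ[ℂ] u)) ∧
          TendstoFin X (genericNhds b lam₀) Z ∧
          φ.1 (vermaOne b lam₀) = (vermaCan b lam₀).rTensor (F 𝔤) Z := by
  have key : ∀ ψ : Irr b lam₀ →ₗ⁅ℂ, 𝔤⁆ Irr b lam₀ ⊗[ℂ] F 𝔤, ∃ u : F 𝔤, IsTheta b lam₀ ψ u ∧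
      ∃ φ : homPreserving b lam₀, naturalMap b lam₀ φ = ψ ∧
        ∃ (X : Module.Dual ℂ H → U (nMinus b) ⊗[ℂ] F 𝔤) (Z : U (nMinus b) ⊗[ℂ] F 𝔤),
          (∀ lam, Generic b lam → (vermaCan b lam).rTensor (F 𝔤) (X lam) =
            fusionOp b lam (Verma b lam) (vermaOne b lam ⊗ₜ[ℂ] u)) ∧
          TendstoFin X (genericNhds b lam₀) Z ∧
          φ.1 (vermaOne b lam₀) = (vermaCan b lam₀).rTensor (F 𝔤) Z := by
    intro ψ
    obtain ⟨X, Z, hX, hlim, hZ, hZ', hZu⟩ := exists_limit_fusionOp hreg leadingCoeff_mem_FInv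
    obtain ⟨φ, hφ, hφ'⟩ := exists_lift (ψ := ψ) hZ hZ' hZu
    exact ⟨leadingCoeff ψ, isTheta_leadingCoeff, φ, hφ, X, Z, fun lam _ => hX lam, hlim, hφ'⟩
  refine ⟨fun ψ => ?_, key⟩
  obtain ⟨u, -, φ, hφ, -⟩ := key ψ
  exact ⟨φ, hφ⟩
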